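/- Let $V$ be a finite dimensional complex vector space with a rational structure $V_{\mathbb Q}$ (so $V=V_{\mathbb Q}\otimes\mathbb C$), a finite increasing filtration $W$ of $V$ defined over $\mathbb Q$, and rational non-degenerate bilinear forms $\mathcal S_k$ of parity $(-1)^k$ on $Gr^W_k=W_k/W_{k-1}$; let $\{h^{p,q}\}$ be a partition of $\dim V$ into non-negative integers. Let $\mathcal M$ be the classifying space of all (finite decreasing) filtrations $F$ of $V$ such that $(F,W)$ is a mixed Hodge structure, each $Gr^W_k$ is polarized by $\mathcal S_k$, and $\dim I^{p,q}_{(F,W)}=h^{p,q}$. Here $V=\bigoplus_{p,q} I^{p,q}_{(F,W)}$ is Deligne's bigrading, i.e. the unique bigrading with $F^p=\bigoplus_{r\ge p,s}I^{r,s}$, $W_k=\bigoplus_{r+s\le k}I^{r,s}$ and $I^{p,q}=\overline{I^{q,p}}$ modulo $\bigoplus_{r<p,s<q}I^{r,s}$. Let $\check{\mathcal M}\supseteq\mathcal M$ be the set of all filtrations $F$ with $\dim F^p=\sum_{r\ge p,s}h^{r,s}$, $\dim F^pGr^W_k=\sum_{r\ge p}h^{r,k-r}$ and $\mathcal S_k(F^pGr^W_k,F^{k-p+1}Gr^W_k)=0$.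 The topology and complex structure of $\mathcal M$ are those induced from the flag variety $\{F\mid \dim F^p=\sum_{r\geq p,s}h^{r,s}\}$. Let $G_{\mathbb C}$ be the group of $g\in GL(V)$ that preserve $W$ and act on each $Gr^W_k$ by an isometry of $\mathcal S_k$. For $F\in\mathcal M$ put $$\mathfrak g^{r,s}=\{\alpha\in Lie(G_{\mathbb C})\mid \alpha(I^{p,q}_{(F,W)})\subseteq I^{p+r,q+s}_{(F,W)}\ \ \forall\,p,q\},\qquad q_F=\sum_{r<0,\,r+s\le 0}\mathfrak g^{r,s}.$$ Then, for every $F\in\mathcal M$: 1. The sum of the $\mathfrak g^{r,s}$ is direct (so $q_F=\bigoplus_{r<0,\,r+s\le0}\mathfrak g^{r,s}$), and $q_F$ is a nilpotent Lie subalgebra of $Lie(G_{\mathbb C})$. 2. The map $u\mapsto \exp(u).F$ sends $q_F$ into $\check{\mathcal M}$ and restricts to a biholomorphism from a neighborhood of $0$ in $q_F$ onto a neighborhood of $F$ in $\mathcal M$. 3. The map $q_F\to T_F(\mathcal M)$ that sends $u$ to the derivation $\zeta\mapsto \frac{d}{dt}\zeta(\exp(tu).F)|_{t=0}$ is a $\mathbb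 C$-linear isomorphism. 4. If $\Phi:S\to\mathcal M$ is a holomorphic map from a complex manifold that is horizontal (derivatives of local holomorphic sections of the bundle with fibers $\Phi(s)^p$ lie in $\Phi(s)^{p-1}$, for all $p$), and $\Phi(s)=F$, then under the isomorphism of part 3 the derivative $\Phi_*:T_s(S)\to T_F(\mathcal M)$ takes values in $\bigoplus_{k\le1}\mathfrak g^{-1,k}$. -/

import Mathlib

open scoped Topology Manifold ContDiff TensorProduct

noncomputable section

/-- A decreasing filtration `⋯ ⊇ F^p ⊇ F^{p+1} ⊇ ⋯` of `V` by complex subspaces. -/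
@[ext]
structure DecFiltration (V : Type*) [AddCommGroup V] [Module ℂ V] where
  toFun : ℤ → Submodule ℂ V
  antitone' : Antitone toFun

namespace DecFiltration

instance {V : Type*} [AddCommGroup V] [Module ℂ V] :
    CoeFun (DecFiltration V) (fun _ => ℤ → Submodule ℂ V) := ⟨toFun⟩

variable {V : Type*} [NormedAddCommGroup V] [NormedSpace ℂ V]

/-- The filtration `A.F`, with `(A.F)^p = A(F^p)`. For `A ∈ GL(V)` this is the usual action. -/
def map (A : V →L[ℂ] V) (F : DecFiltration V) : DecFiltration V where
  toFun p := (F p).map (A : V →ₗ[ℂ] V)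
  antitone' _ _ h := Submodule.map_mono (F.antitone' h)

/-- The set of filtrations of `V` is the disjoint union of the `GL(V)`-orbits, which are the flag
varieties `{F | dim F^p = f^p}`. Each of them gets the topology of the homogeneous space
`GL(V) / Stab(F)`: a set `O` is open iff `{g ∈ GL(V) | g.F ∈ O}` is open for every `F`. -/
instance : TopologicalSpace (DecFiltration V) :=
  ⨆ F : DecFiltration V,
    TopologicalSpace.coinduced (fun g : (V →L[ℂ] V)ˣ => F.map (g : V →L[ℂ] V)) inferInstance

/-- A function `ζ` defined near `F` on the flag variety `GL(V) / Stab(F)` is holomorphic near `F`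
iff its pullback `g ↦ ζ (g.F)` is holomorphic near `1 ∈ GL(V)` (an open subset of `End(V)`). -/
def HolomorphicAt {E : Type*} [NormedAddCommGroup E] [NormedSpace ℂ E]
    (ζ : DecFiltration V → E) (F : DecFiltration V) : Prop :=
  AnalyticAt ℂ (fun A : V →L[ℂ] V => ζ (F.map A)) 1

/-- Let `X` be a (locally closed) complex submanifold of the flag variety and `F ∈ X`. A function
`ζ` on `X` is holomorphic near `F` iff near `F` it is the restriction to `X` of a holomorphic
function on the flag variety. The values of `ζ` outside `X` are irrelevant. -/
def HolomorphicOnAt {E : Type*} [NormedAddCommGroup E] [NormedSpace ℂ E]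
    (X : Set (DecFiltration V)) (ζ : DecFiltration V → E) (F : DecFiltration V) : Prop :=
  ∃ ζ' : DecFiltration V → E, HolomorphicAt ζ' F ∧ ∀ᶠ F' in 𝓝[X] F, ζ F' = ζ' F'

/-- A map `Φ` from (an open subset of) a complex manifold `S` to `X` is holomorphic near `s`: it is
continuous at `s`, takes values in `X` near `s`, and pulls back holomorphic functions on `X` near
`Φ s` to holomorphic functions on `S` near `s`. -/
def HolomorphicMapAt (E : Type*) [NormedAddCommGroup E] [NormedSpace ℂ E]
    {S : Type*} [TopologicalSpace S] [ChartedSpace E S]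
    (X : Set (DecFiltration V)) (Φ : S → DecFiltration V) (s : S) : Prop :=
  ContinuousAt Φ s ∧ (∀ᶠ s' in 𝓝 s, Φ s' ∈ X) ∧
    ∀ ζ : DecFiltration V → ℂ, HolomorphicOnAt X ζ (Φ s) →
      ContMDiffAt 𝓘(ℂ, E) 𝓘(ℂ, ℂ) ω (fun s' => ζ (Φ s')) s

/-- `φ` restricts to a biholomorphism from the open subset `U` of the complex vector space `E`
onto the relatively open subset `N ∩ X` of `X` (with `N` open in the flag variety). -/
def IsBiholomorphicOn {E : Type*} [NormedAddCommGroup E] [NormedSpace ℂ E]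
    (X : Set (DecFiltration V)) (φ : E → DecFiltration V)
    (U : Set E) (N : Set (DecFiltration V)) : Prop :=
  IsOpen U ∧ IsOpen N ∧ Set.BijOn φ U (N ∩ X) ∧ (∀ u ∈ U, HolomorphicMapAt E X φ u) ∧
    ∃ ψ : DecFiltration V → E, Set.InvOn ψ φ U (N ∩ X) ∧ ContinuousOn ψ (N ∩ X) ∧
      ∀ F ∈ N ∩ X, HolomorphicOnAt X ψ F

/-- A map `Φ` from a complex manifold to a space of filtrations is horizontal iff
`∂F^p/∂s_j ⊆ F^{p-1}`: the derivatives at `s` of a local holomorphic section `σ` of the bundle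
`F^p(s') := (Φ s')^p` lie in `F^{p-1}(s)`. -/
def IsHorizontal (E : Type*) [NormedAddCommGroup E] [NormedSpace ℂ E]
    {S : Type*} [TopologicalSpace S] [ChartedSpace E S] (Φ : S → DecFiltration V) : Prop :=
  ∀ (s : S) (p : ℤ) (σ : S → V), ContMDiffAt 𝓘(ℂ, E) 𝓘(ℂ, V) ω σ s →
    (∀ᶠ s' in 𝓝 s, σ s' ∈ Φ s' p) →
      ∀ v : TangentSpace 𝓘(ℂ, E) s, (mfderiv 𝓘(ℂ, E) 𝓘(ℂ, V) σ s v : V) ∈ Φ s (p - 1)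

/-- The algebra of functions that are holomorphic on `X` near `F`. -/
def holomorphicFunctions (X : Set (DecFiltration V)) (F : DecFiltration V) :
    Subalgebra ℂ (DecFiltration V → ℂ) where
  carrier := {ζ | HolomorphicOnAt X ζ F}
  mul_mem' := by
    rintro a b ⟨a', ha, ha'⟩ ⟨b', hb, hb'⟩
    refine ⟨a' * b', AnalyticAt.mul ha hb, ?_⟩
    filter_upwards [ha', hb'] with x h1 h2
    simp [h1, h2]
  add_mem' := by
    rintro a b ⟨a', ha, ha'⟩ ⟨b', hb, hb'⟩
    refine ⟨a' + b', AnalyticAt.add ha hb, ?_⟩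
    filter_upwards [ha', hb'] with x h1 h2
    simp [h1, h2]
  algebraMap_mem' c := ⟨fun _ => c, analyticAt_const, Filter.Eventually.of_forall fun _ => rfl⟩

/-- The holomorphic tangent space `T_F(X)`: the `ℂ`-linear derivations at `F` of the holomorphic
functions on `X` near `F`. (The Leibniz rule, applied to a product of `ζ` with the indicator
function of a neighborhood, shows that a derivation depends on the germ of `ζ|_X` at `F` only.) -/
def tangentSpaceAt (X : Set (DecFiltration V)) (F : DecFiltration V) :
    Submodule ℂ (Module.Dual ℂ (holomorphicFunctions X F)) where
  carrier := {δ | ∀ ζ η : holomorphicFunctions X F,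
    δ (ζ * η) = ζ.1 F * δ η + η.1 F * δ ζ}
  add_mem' := by
    intro a b ha hb ζ η
    simp only [LinearMap.add_apply, ha ζ η, hb ζ η]
    ring
  zero_mem' := by
    intro ζ η
    simp
  smul_mem' := by
    intro c a ha ζ η
    simp only [LinearMap.smul_apply, ha ζ η, smul_eq_mul]
    ring

end DecFiltration

section Pure

variable {H : Type*} [AddCommGroup H] [Module ℂ H]

/-- A finite decreasing filtration `F` of a complex vector space `H` with conjugation `c` is a pure
Hodge structure of weight `k`: `H = F^p ⊕ conj(F^{k-p+1})` for all `p`. -/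
def IsPureHodge (c : H →ₛₗ[starRingEnd ℂ] H) (k : ℤ) (F : ℤ → Submodule ℂ H) : Prop :=
  Antitone F ∧ (∃ p, F p = ⊤) ∧ (∃ p, F p = ⊥) ∧ ∀ p, IsCompl (F p) ((F (k - p + 1)).map c)

/-- `H^{p,q} = F^p ∩ conj(F^q)` -/
def hodgePiece (c : H →ₛₗ[starRingEnd ℂ] H) (F : ℤ → Submodule ℂ H) (p q : ℤ) :
    Submodule ℂ H :=
  F p ⊓ (F q).map c

/-- The Riemann bilinear relations for a Hodge structure of weight `k`: `Q(F^p, F^{k-p+1}) = 0`, and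
`i^{p-q} Q(u, conj u) > 0` for all nonzero `u ∈ H^{p,q}`, `p + q = k`. -/
def IsPolarizedBy (c : H →ₛₗ[starRingEnd ℂ] H) (k : ℤ) (F : ℤ → Submodule ℂ H)
    (Q : LinearMap.BilinForm ℂ H) : Prop :=
  (∀ p, ∀ u ∈ F p, ∀ v ∈ F (k - p + 1), Q u v = 0) ∧
    ∀ p q, p + q = k → ∀ u ∈ hodgePiece c F p q, u ≠ 0 →
      (Complex.I ^ (p - q) * Q u (c u)).im = 0 ∧ 0 < (Complex.I ^ (p - q) * Q u (c u)).re

end Pure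

/-- The graded piece `Gr^W_k = W_k / W_{k-1}`. -/
abbrev GrW {V : Type*} [AddCommGroup V] [Module ℂ V] (W : ℤ → Submodule ℂ V) (k : ℤ) : Type _ :=
  ↥(W k) ⧸ (W (k - 1)).submoduleOf (W k)

/-- The class in `Gr^W_k` of an element of `W_k`. -/
abbrev GrW.mk {V : Type*} [AddCommGroup V] [Module ℂ V] (W : ℤ → Submodule ℂ V) (k : ℤ) :
    ↥(W k) →ₗ[ℂ] GrW W k :=
  ((W (k - 1)).submoduleOf (W k)).mkQ

/-- The data that define a classifying space of graded-polarized mixed Hodge structures on `V`. -/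
structure GradedPolarizationData (V : Type*) [AddCommGroup V] [Module ℂ V] [Module ℚ V] where
  /-- the rational structure `V_ℚ` of `V` -/
  VQ : Submodule ℚ V
  /-- `ℂ ⊗ V_ℚ → V` is an isomorphism -/
  isBaseChange : IsBaseChange ℂ VQ.subtype
  /-- the weight filtration: finite, increasing, and defined over `ℚ` -/
  W : ℤ → Submodule ℂ V
  W_mono : Monotone W
  W_bot : ∃ k, W k = ⊥
  W_top : ∃ k, W k = ⊤
  W_rational : ∀ k, Submodule.span ℂ {x | x ∈ VQ ∧ x ∈ W k} = W k
  /-- the rational, non-degenerate bilinear forms of parity `(-1)^k` on `Gr^W_k` -/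
  S : ∀ k, LinearMap.BilinForm ℂ (GrW W k)
  S_rational : ∀ k (x y : W k), (x : V) ∈ VQ → (y : V) ∈ VQ →
    ∃ r : ℚ, S k (GrW.mk W k x) (GrW.mk W k y) = r
  S_nondegenerate : ∀ k, (S k).Nondegenerate
  S_parity : ∀ k x y, S k x y = (-1 : ℂ) ^ k * S k y x
  /-- the Hodge numbers `h^{p,q}`, a partition of `dim V` -/
  h : (ℤ × ℤ) →₀ ℕ
  h_sum : (h.sum fun _ n => n) = Module.finrank ℂ V

namespace GradedPolarizationData

section Conj

variable {V : Type*} [AddCommGroup V] [Module ℂ V] [Module ℚ V] (D : GradedPolarizationData V)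

/-- Complex conjugation of the first factor of `ℂ ⊗ V_ℚ`. -/
def conjTensor : ℂ ⊗[ℚ] D.VQ →ₗ[ℚ] ℂ ⊗[ℚ] D.VQ :=
  LinearMap.rTensor D.VQ (Complex.conjAe.toLinearMap.restrictScalars ℚ)

/-- The complex conjugation of `V = ℂ ⊗ V_ℚ`. -/
def conj : V →ₛₗ[starRingEnd ℂ] V where
  toFun x := D.isBaseChange.equiv (D.conjTensor (D.isBaseChange.equiv.symm x))
  map_add' x y := by simp
  map_smul' c x := by
    have key : ∀ t : ℂ ⊗[ℚ] D.VQ,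
        D.conjTensor (c • t) = (starRingEnd ℂ) c • D.conjTensor t := by
      intro t
      induction t with
      | zero => simp
      | tmul a b => simp [conjTensor, TensorProduct.smul_tmul']
      | add a b ha hb => simp only [smul_add, map_add, ha, hb]
    simp only [map_smul, key]

theorem conj_smul_rational (c : ℂ) {x : V} (hx : x ∈ D.VQ) :
    D.conj (c • x) = (starRingEnd ℂ) c • x := by
  have e : D.isBaseChange.equiv.symm x = (1 : ℂ) ⊗ₜ ⟨x, hx⟩ := by
    simp [LinearEquiv.symm_apply_eq, IsBaseChange.equiv_tmul]
  rw [LinearMap.map_smulₛₗ]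
  congr 1
  change D.isBaseChange.equiv (D.conjTensor (D.isBaseChange.equiv.symm x)) = x
  simp [e, conjTensor, IsBaseChange.equiv_tmul]

theorem conj_mem_W (k : ℤ) : ∀ x ∈ D.W k, D.conj x ∈ D.W k := by
  intro x hx
  have h2 : Submodule.span ℂ {x | x ∈ D.VQ ∧ x ∈ D.W k} ≤ (D.W k).comap D.conj := by
    rw [Submodule.span_le]
    rintro y ⟨hy, hy'⟩
    have := D.conj_smul_rational 1 hy
    simp only [one_smul, map_one] at this
    simpa [this] using hy'
  rw [D.W_rational k] at h2
  exact h2 hx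

/-- The complex conjugation of `Gr^W_k`. -/
def grConj (k : ℤ) : GrW D.W k →ₛₗ[starRingEnd ℂ] GrW D.W k :=
  Submodule.mapQ _ _ (D.conj.restrict (D.conj_mem_W k)) (by
    intro x hx
    exact D.conj_mem_W (k - 1) _ hx)

/-- The filtration `F^p Gr^W_k = (F^p ∩ W_k + W_{k-1}) / W_{k-1}` induced by `F` on `Gr^W_k`. -/
def grF (F : DecFiltration V) (k p : ℤ) : Submodule ℂ (GrW D.W k) :=
  ((F p).submoduleOf (D.W k)).map (GrW.mk D.W k)

/-- `(F, W)` is a mixed Hodge structure. -/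
def IsMixedHodge (F : DecFiltration V) : Prop :=
  (∃ p, F p = ⊤) ∧ (∃ p, F p = ⊥) ∧ ∀ k, IsPureHodge (D.grConj k) k (D.grF F k)

/-- The direct sum decomposition `V = ⊕ I^{p,q}` is a bigrading of `(F, W)`, that is,
`F^p = ⊕_{r ≥ p} I^{r,s}` and `W_k = ⊕_{r+s ≤ k} I^{r,s}`, and has the additional property
`I^{p,q} = conj(I^{q,p})` modulo `⊕_{r<p,s<q} I^{r,s}`. -/
structure IsDeligneBigrading (F : DecFiltration V) (I : ℤ → ℤ → Submodule ℂ V) : Prop where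
  isInternal : DirectSum.IsInternal fun pq : ℤ × ℤ => I pq.1 pq.2
  hodge : ∀ p, F p = ⨆ (r : ℤ) (s : ℤ) (_ : p ≤ r), I r s
  weight : ∀ k, D.W k = ⨆ (r : ℤ) (s : ℤ) (_ : r + s ≤ k), I r s
  conj : ∀ p q, I p q ⊔ (⨆ (r : ℤ) (s : ℤ) (_ : r < p) (_ : s < q), I r s) =
    (I q p).map D.conj ⊔ ⨆ (r : ℤ) (s : ℤ) (_ : r < p) (_ : s < q), I r s

/-- Deligne's bigrading `I^{p,q}_{(F,W)}`, the unique one with the preceding properties (a mixed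
Hodge structure has exactly one). -/
def I (F : DecFiltration V) : ℤ → ℤ → Submodule ℂ V :=
  Classical.epsilon (D.IsDeligneBigrading F)

/-- The classifying space `M` of all mixed Hodge structures `(F, W)` that are graded-polarized by
`S` and satisfy `dim I^{p,q} = h^{p,q}`. -/
def M : Set (DecFiltration V) :=
  {F | D.IsMixedHodge F ∧ (∀ k, IsPolarizedBy (D.grConj k) k (D.grF F k) (D.S k)) ∧
    ∀ p q, Module.finrank ℂ (D.I F p q) = D.h (p, q)}

/-- The compact dual `M̌`: all filtrations with `dim F^p = f^p` and `dim F^p Gr^W_k = f^p_k` that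
satisfy the first Riemann bilinear relation. -/
def compactDual : Set (DecFiltration V) :=
  {F | (∀ p, Module.finrank ℂ (F p) = ∑ rs ∈ D.h.support with p ≤ rs.1, D.h rs) ∧
    (∀ k p, Module.finrank ℂ (D.grF F k p) =
      ∑ rs ∈ D.h.support with p ≤ rs.1 ∧ rs.1 + rs.2 = k, D.h rs) ∧
    ∀ k p, ∀ u ∈ D.grF F k p, ∀ v ∈ D.grF F k (k - p + 1), D.S k u v = 0}

end Conj

variable {V : Type*} [NormedAddCommGroup V] [NormedSpace ℂ V] [Module ℚ V]
  (D : GradedPolarizationData V)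

/-- The Lie algebra of `G_ℂ = {g ∈ GL(V)^W | Gr(g) ∈ Aut_ℂ(S)}`: the endomorphisms of `V` that
preserve `W` and act on each `Gr^W_k` by an infinitesimal isometry of `S_k`. -/
def lieGC : Submodule ℂ (V →L[ℂ] V) where
  carrier := {α | ∃ hα : ∀ k, ∀ x ∈ D.W k, α x ∈ D.W k, ∀ k (x y : D.W k),
    D.S k (GrW.mk D.W k ⟨α x, hα k x x.2⟩) (GrW.mk D.W k y) +
      D.S k (GrW.mk D.W k x) (GrW.mk D.W k ⟨α y, hα k y y.2⟩) = 0}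
  add_mem' := by
    rintro a b ⟨ha, ha'⟩ ⟨hb, hb'⟩
    refine ⟨fun k x hx => (D.W k).add_mem (ha k x hx) (hb k x hx), fun k x y => ?_⟩
    have e : ∀ z : D.W k, GrW.mk D.W k ⟨(a + b) z, (D.W k).add_mem (ha k z z.2) (hb k z z.2)⟩ =
        GrW.mk D.W k ⟨a z, ha k z z.2⟩ + GrW.mk D.W k ⟨b z, hb k z z.2⟩ := by
      intro z
      rw [← map_add]
      rfl
    rw [e, e]
    simp only [map_add, LinearMap.add_apply]
    linear_combination ha' k x y + hb' k x y
  zero_mem' := by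
    refine ⟨fun k x _ => by simp, fun k x y => ?_⟩
    have e : ∀ z : D.W k, GrW.mk D.W k ⟨(0 : V →L[ℂ] V) z, by simp⟩ = 0 := by
      intro z
      rw [← map_zero (GrW.mk D.W k)]
      rfl
    rw [e, e]
    simp
  smul_mem' := by
    rintro c a ⟨ha, ha'⟩
    refine ⟨fun k x hx => (D.W k).smul_mem c (ha k x hx), fun k x y => ?_⟩
    have e : ∀ z : D.W k, GrW.mk D.W k ⟨(c • a) z, (D.W k).smul_mem c (ha k z z.2)⟩ =
        c • GrW.mk D.W k ⟨a z, ha k z z.2⟩ := by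
      intro z
      rw [← map_smul]
      rfl
    rw [e, e]
    simp only [map_smul, LinearMap.smul_apply, smul_eq_mul]
    linear_combination c * ha' k x y

/-- `gl(V)^{r,s} = {α | α(I^{p,q}) ⊆ I^{p+r,q+s} for all p, q}` -/
def gl (F : DecFiltration V) (r s : ℤ) : Submodule ℂ (V →L[ℂ] V) where
  carrier := {α | ∀ p q, ∀ x ∈ D.I F p q, α x ∈ D.I F (p + r) (q + s)}
  add_mem' ha hb p q x hx := Submodule.add_mem _ (ha p q x hx) (hb p q x hx)
  zero_mem' p q x _ := by simp
  smul_mem' c _ ha p q x hx := Submodule.smul_mem _ c (ha p q x hx)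

/-- `𝔤^{r,s} = gl(V)^{r,s} ∩ Lie(G_ℂ)` -/
def g (F : DecFiltration V) (r s : ℤ) : Submodule ℂ (V →L[ℂ] V) :=
  D.gl F r s ⊓ D.lieGC

/-- `q_F = ⊕_{r < 0, r+s ≤ 0} 𝔤^{r,s}` -/
def q (F : DecFiltration V) : Submodule ℂ (V →L[ℂ] V) :=
  ⨆ (r : ℤ) (s : ℤ) (_ : r < 0) (_ : r + s ≤ 0), D.g F r s

/-- `T^horiz_F(M) = ⊕_{k ≤ 1} 𝔤^{-1,k}` -/
def horizontal (F : DecFiltration V) : Submodule ℂ (V →L[ℂ] V) :=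
  ⨆ (k : ℤ) (_ : k ≤ 1), D.g F (-1) k

end GradedPolarizationData

section Lie

attribute [local instance 100] LieRing.ofAssociativeRing

/-- A subspace of `gl(V)` is a nilpotent Lie subalgebra (for the commutator bracket). -/
def IsNilpotentLieSubalgebra {V : Type*} [NormedAddCommGroup V] [NormedSpace ℂ V]
    (q : Submodule ℂ (V →L[ℂ] V)) : Prop :=
  ∃ L : LieSubalgebra ℂ (V →L[ℂ] V), L.toSubmodule = q ∧ LieRing.IsNilpotent L

end Lie

end

/-! At a point `F` of the classifying space, Deligne's bigrading splits `End(V)` into the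
endomorphisms that lower the first index (`lowering`) and those that preserve `F` (`stabilizer`).
Hence `(a, b) ↦ exp(a)(1 + b)` has invertible derivative at the origin, and the inverse function
theorem shows that the exponentials of lowering endomorphisms parametrize the flag variety near `F`
(`exists_flag_chart`). The task is to recognize `M` in this chart.

Since `S_k` pairs `I^{p,q}` only with `I^{q,p}`, the bidegree components of an element of `Lie(G_ℂ)`
are again in `Lie(G_ℂ)` (`component_mem_lieGC`), so `q_F` is the intersection of `lowering` with
`Lie(G_ℂ)` (`q_eq`). This gives nilpotency by Engel's theorem. If `a` is lowering and `exp(a).F`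
lies in the compact dual, a dimension count and the first bilinear relation force `exp(a) ∈ G_ℂ`
(`isGradedIsometry_of_map_exp_mem`); as `a` is nilpotent, `exp(ta)` is polynomial in `t` and so `a ∈
Lie(G_ℂ)` (`mem_lieGC_of_exp`). Conversely, a compactness argument on unit spheres keeps `exp(u).F`
in `M` for small `u ∈ Lie(G_ℂ)` (`eventually_map_exp_mem_M`). Thus `M` corresponds near `F` to `q_F`
(`exists_isExpChart`).

Hadamard's lemma turns the chart into an isomorphism of `q_F` with the derivations at `F`. For a
horizontal map, differentiating the sections `exp(u(s)) x` with `x ∈ F^p` shows that the velocity `u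
∈ q_F` maps `F^p` to `F^{p-1}`. This kills every component of first degree below `-1`, and
preservation of `W` bounds the second degree by `1` (`mem_horizontal`).

The bigrading `D.I` is a choice among all bigradings, so its properties are available only after
Deligne's existence theorem, which is proved for two abstract opposed filtrations. -/

noncomputable section

/-! ### Partial sums of a direct sum decomposition. -/

namespace BigradedSum

variable {K ι V : Type*} [Field K] [AddCommGroup V] [Module K V]

/-- The sum of the pieces `J i` with `i ∈ A`. -/
def part (J : ι → Submodule K V) (A : Set ι) : Submodule K V := ⨆ i ∈ A, J i

theorem le_part {J : ι → Submodule K V} {A : Set ι} {i : ι} (hi : i ∈ A) : J i ≤ part J A :=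
  le_iSup₂_of_le i hi le_rfl

theorem part_mono {J : ι → Submodule K V} {A B : Set ι} (h : A ⊆ B) : part J A ≤ part J B :=
  biSup_mono fun _ hi => h hi

theorem part_le {J : ι → Submodule K V} {A : Set ι} {P : Submodule K V} (h : ∀ i ∈ A, J i ≤ P) :
    part J A ≤ P := iSup₂_le h

theorem part_sup (J : ι → Submodule K V) (A B : Set ι) :
    part J A ⊔ part J B = part J (A ∪ B) := by
  apply le_antisymm
  · exact sup_le (part_mono Set.subset_union_left) (part_mono Set.subset_union_right)
  · refine part_le fun i hi => ?_
    rcases hi with hi | hi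
    · exact (le_part hi).trans le_sup_left
    · exact (le_part hi).trans le_sup_right

theorem part_empty (J : ι → Submodule K V) : part J ∅ = ⊥ := by simp [part]

theorem part_singleton (J : ι → Submodule K V) (i : ι) : part J {i} = J i := by simp [part]

variable [DecidableEq ι] {J : ι → Submodule K V} (h : DirectSum.IsInternal J)

/-- The isomorphism of the external direct sum of the pieces with `V`. -/
def equiv : DirectSum ι (fun i => J i) ≃ₗ[K] V :=
  LinearEquiv.ofBijective (DirectSum.coeLinearMap J) h

theorem equiv_lof (i : ι) (x : J i) : equiv h (DirectSum.lof K ι (fun i => J i) i x) = x := by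
  exact DirectSum.coeLinearMap_lof J i x

/-- The projection onto the piece `J i` of a direct sum decomposition. -/
def proj (i : ι) : V →ₗ[K] V :=
  (J i).subtype ∘ₗ DirectSum.component K ι (fun i => J i) i ∘ₗ
    ((equiv h).symm : V →ₗ[K] _)

theorem proj_mem (i : ι) (x : V) : proj h i x ∈ J i := by simp [proj]

theorem symm_of_mem {i : ι} {x : V} (hx : x ∈ J i) :
    (equiv h).symm x = DirectSum.lof K ι (fun i => J i) i ⟨x, hx⟩ := by
  rw [LinearEquiv.symm_apply_eq, equiv_lof]

theorem proj_of_mem {i : ι} {x : V} (hx : x ∈ J i) : proj h i x = x := by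
  simp [proj, symm_of_mem h hx, DirectSum.component.lof_self]

theorem proj_of_mem_of_ne {i j : ι} (hij : i ≠ j) {x : V} (hx : x ∈ J j) : proj h i x = 0 := by
  simp [proj, symm_of_mem h hx, DirectSum.component.of, hij.symm]

theorem sum_proj {s : Finset ι} (hs : ∀ i, i ∉ s → J i = ⊥) (x : V) :
    ∑ i ∈ s, proj h i x = x := by
  have hx : x ∈ ⨆ i, J i := by rw [h.submodule_iSup_eq_top]; trivial
  induction hx using Submodule.iSup_induction' with
  | mem i x hx =>
    by_cases his : i ∈ s
    · rw [Finset.sum_eq_single i, proj_of_mem h hx]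
      · intro j _ hj
        exact proj_of_mem_of_ne h hj hx
      · exact fun h' => absurd his h'
    · have : x = 0 := by simpa [hs i his] using hx
      simp [this]
  | zero => simp
  | add x y _ _ hx hy => simp only [map_add, Finset.sum_add_distrib, hx, hy]

theorem proj_of_mem_part {A : Set ι} {x : V} (hx : x ∈ part J A) {i : ι} (hi : i ∉ A) :
    proj h i x = 0 := by
  have : part J A ≤ LinearMap.ker (proj h i) := part_le fun j hj y hy =>
    proj_of_mem_of_ne h (by rintro rfl; exact hi hj) hy
  exact this hx

theorem exists_finset (h : DirectSum.IsInternal J) [FiniteDimensional K V] : ∃ s :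
    Finset ι, ∀ i, i ∉ s → J i = ⊥ := by
  have hfin := WellFoundedGT.finite_ne_bot_of_iSupIndep h.submodule_iSupIndep
  refine ⟨hfin.toFinset, fun i hi => ?_⟩
  simpa using hi

theorem mem_part_iff [FiniteDimensional K V] {A : Set ι} {x : V} :
    x ∈ part J A ↔ ∀ i, i ∉ A → proj h i x = 0 := by
  refine ⟨fun hx i hi => proj_of_mem_part h hx hi, fun hx => ?_⟩
  obtain ⟨s, hs⟩ := exists_finset h
  rw [← sum_proj h hs x]
  refine Submodule.sum_mem _ fun i _ => ?_
  by_cases hi : i ∈ A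
  · exact le_part hi (proj_mem h i x)
  · rw [hx i hi]; exact Submodule.zero_mem _

/-- Membership in a partial sum is the vanishing of the other projections. Together with `part_sup`
this reduces identities between intersections and sums of `F^p` and `W_k` to identities between sets
of indices. -/
theorem part_inf (h : DirectSum.IsInternal J) [FiniteDimensional K V] (A B : Set ι) :
    part J A ⊓ part J B = part J (A ∩ B) := by
  ext x
  simp only [Submodule.mem_inf, mem_part_iff h, Set.mem_inter_iff, not_and_or]
  constructor
  · rintro ⟨h1, h2⟩ i (hi | hi)
    exacts [h1 i hi, h2 i hi]
  · exact fun h' => ⟨fun i hi => h' i (.inl hi), fun i hi => h' i (.inr hi)⟩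

theorem ext_of_pieces (h : DirectSum.IsInternal J) {M : Type*} [AddCommGroup M] [Module K M]
    {f g : V →ₗ[K] M}
    (H : ∀ i, ∀ x ∈ J i, f x = g x) : f = g := by
  ext x
  have hx : x ∈ ⨆ i, J i := by rw [h.submodule_iSup_eq_top]; trivial
  induction hx using Submodule.iSup_induction' with
  | mem i x hx => exact H i x hx
  | zero => simp
  | add x y _ _ hx hy => simp [hx, hy]

theorem finrank_part (h : DirectSum.IsInternal J) [FiniteDimensional K V] (A : Set ι)
    [DecidablePred (· ∈ A)] {s : Finset ι}
    (hs : ∀ i, i ∉ s → J i = ⊥) :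
    Module.finrank K (part J A) = ∑ i ∈ s with i ∈ A, Module.finrank K (J i) := by
  have key : ∀ t : Finset ι, Module.finrank K (part J (t : Set ι)) =
      ∑ i ∈ t, Module.finrank K (J i) := by
    intro t
    induction t using Finset.induction_on with
    | empty => simp [part_empty]
    | insert i t hi ih =>
      have e1 : part J ((insert i t : Finset ι) : Set ι) = J i ⊔ part J (t : Set ι) := by
        rw [← part_singleton J i, part_sup, Finset.coe_insert, Set.insert_eq]
      have e2 : J i ⊓ part J (t : Set ι) = ⊥ := by
        rw [← part_singleton J i, part_inf h, ← part_empty J]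
        congr 1
        ext j
        simp only [Set.mem_inter_iff, Set.mem_singleton_iff, Set.mem_empty_iff_false, iff_false]
        rintro ⟨rfl, hj⟩
        exact hi hj
      have e3 := Submodule.finrank_sup_add_finrank_inf_eq (J i) (part J (t : Set ι))
      rw [e2, finrank_bot, add_zero] at e3
      rw [e1, e3, ih, Finset.sum_insert hi]
  rw [← key]
  have : part J A = part J ((s.filter (· ∈ A) : Finset ι) : Set ι) := by
    apply le_antisymm
    · refine part_le fun i hi => ?_
      by_cases his : i ∈ s
      · exact le_part (by simp [his, hi])
      · rw [hs i his]; exact bot_le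
    · refine part_mono fun i hi => ?_
      simp only [Finset.coe_filter, Set.mem_ofPred_eq] at hi
      exact hi.2
  rw [this]

end BigradedSum


/-! ### Deligne's splitting for two opposed filtrations. -/

/-- A filtration `W` together with two filtrations `F`, `G` that are `m`-opposed on each `Gr^W_m`. -/
structure OpposedFiltrations {K V : Type*} [Field K] [AddCommGroup V] [Module K V]
    (F G W : ℤ → Submodule K V) : Prop where
  anti_left : Antitone F
  anti_right : Antitone G
  mono : Monotone W
  W_bot : ∃ k, W k = ⊥
  W_top : ∃ k, W k = ⊤
  left_bot : ∃ p, F p = ⊥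
  left_top : ∃ p, F p = ⊤
  disj : ∀ p b m, p + b = m + 1 → ∀ x ∈ F p, ∀ y ∈ G b, x ∈ W m → y ∈ W m → x - y ∈ W (m - 1) →
    x ∈ W (m - 1)
  codisj : ∀ p b m, p + b = m + 1 → ∀ x ∈ W m, ∃ f ∈ F p, ∃ g ∈ G b, f ∈ W m ∧ g ∈ W m ∧
    x - f - g ∈ W (m - 1)

namespace OpposedFiltrations

open BigradedSum

variable {K V : Type*} [Field K] [AddCommGroup V] [Module K V]

/-- The sum `∑_{i ≥ 0} G^{b-i} ∩ W_{m-i}`. -/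
def tail (G W : ℤ → Submodule K V) (m b : ℤ) : Submodule K V :=
  ⨆ i : ℕ, G (b - i) ⊓ W (m - i)

/-- Deligne's subspaces
`I^{p,q} = F^p ∩ W_{p+q} ∩ (G^q ∩ W_{p+q} + ∑_{i ≥ 0} G^{q-1-i} ∩ W_{p+q-2-i})`. -/
def deligne (F G W : ℤ → Submodule K V) (p q : ℤ) : Submodule K V :=
  F p ⊓ W (p + q) ⊓ (G q ⊓ W (p + q) ⊔ tail G W (p + q - 2) (q - 1))

/-- The recursion that lets arguments about tails descend along the weight. -/
theorem tail_eq (G W : ℤ → Submodule K V) (m b : ℤ) :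
    tail G W m b = G b ⊓ W m ⊔ tail G W (m - 1) (b - 1) := by
  unfold tail
  apply le_antisymm
  · refine iSup_le fun i => ?_
    cases i with
    | zero => simp
    | succ i =>
      refine le_sup_of_le_right (le_iSup_of_le i ?_)
      rw [show b - ((i + 1 : ℕ) : ℤ) = b - 1 - i by push_cast; ring,
        show m - ((i + 1 : ℕ) : ℤ) = m - 1 - i by push_cast; ring]
  · refine sup_le (le_iSup_of_le 0 (by simp)) (iSup_le fun i => le_iSup_of_le (i + 1) ?_)
    rw [show b - ((i + 1 : ℕ) : ℤ) = b - 1 - i by push_cast; ring,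
        show m - ((i + 1 : ℕ) : ℤ) = m - 1 - i by push_cast; ring]

variable {F G W : ℤ → Submodule K V}

theorem tail_le (hW : Monotone W) (m b : ℤ) : tail G W m b ≤ W m :=
  iSup_le fun i => inf_le_right.trans (hW (by omega))

theorem W_eq_bot_of_le (hW : Monotone W) {k₀ k : ℤ} (h₀ : W k₀ = ⊥) (h : k ≤ k₀) : W k = ⊥ :=
  le_bot_iff.1 (h₀ ▸ hW h)

/-- Opposedness splits `x` modulo `W_{m-1}`; the remainder is treated in the same way with `b` and
`m` lowered by one and `p` fixed, until `W` vanishes. With `eq_zero_of_mem_tail` this makes the tail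
a complement of `F^p ∩ W_m` in `W_m`. -/
theorem exists_decomp (H : OpposedFiltrations F G W) {p b m : ℤ} (h : p + b = m + 1) {x : V}
    (hx : x ∈ W m) :
    ∃ f ∈ F p, f ∈ W m ∧ x - f ∈ tail G W m b := by
  obtain ⟨k₀, hk₀⟩ := H.W_bot
  suffices ∀ n : ℕ, ∀ b m : ℤ, m ≤ k₀ + n → p + b = m + 1 → ∀ x ∈ W m,
      ∃ f ∈ F p, f ∈ W m ∧ x - f ∈ tail G W m b from
    this (m - k₀).toNat b m (by omega) h x hx
  intro n
  induction n with
  | zero =>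
    intro b m hm _ x hx
    rw [W_eq_bot_of_le H.mono hk₀ (by simpa using hm)] at hx
    have : x = 0 := by simpa using hx
    exact ⟨0, Submodule.zero_mem _, Submodule.zero_mem _, by simp [this]⟩
  | succ n ih =>
    intro b m hm hpb x hx
    obtain ⟨f, hf, g, hg, hfW, hgW, hfg⟩ := H.codisj p b m hpb x hx
    obtain ⟨f', hf', hf'W, hx'⟩ := ih (b - 1) (m - 1) (by push_cast at hm; omega) (by omega) _ hfg
    refine ⟨f + f', Submodule.add_mem _ hf hf', Submodule.add_mem _ hfW (H.mono (by omega) hf'W), ?_⟩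
    rw [tail_eq, show x - (f + f') = g + (x - f - g - f') by abel]
    exact Submodule.add_mem_sup ⟨hg, hgW⟩ hx'

/-- The leading term of the tail is congruent to `x ∈ F^p` modulo `W_{m-1}`, so opposedness moves
`x` into `W_{m-1}`, where it lies in the next tail. -/
theorem eq_zero_of_mem_tail (H : OpposedFiltrations F G W) {p b m : ℤ} (h : p + b = m + 1) {x : V}
    (hF : x ∈ F p)
    (hx : x ∈ tail G W m b) : x = 0 := by
  obtain ⟨k₀, hk₀⟩ := H.W_bot
  suffices ∀ n : ℕ, ∀ b m : ℤ, m ≤ k₀ + n → p + b = m + 1 → x ∈ tail G W m b → x = 0 from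
    this (m - k₀).toNat b m (by omega) h hx
  intro n
  induction n with
  | zero =>
    intro b m hm _ hx
    have := tail_le H.mono _ _ hx
    rw [W_eq_bot_of_le H.mono hk₀ (by simpa using hm)] at this
    simpa using this
  | succ n ih =>
    intro b m hm hpb hx
    have hxW := tail_le H.mono _ _ hx
    rw [tail_eq] at hx
    obtain ⟨v, ⟨hvG, hvW⟩, v', hv', rfl⟩ := Submodule.mem_sup.1 hx
    have hv'W := tail_le H.mono _ _ hv'
    have h1 := H.disj p b m hpb _ hF v hvG hxW hvW (by simpa using hv'W)
    refine ih (b - 1) (m - 1) (by push_cast at hm; omega) (by omega) (Submodule.add_mem _ ?_ hv')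
    rw [tail_eq]
    refine Submodule.mem_sup_left ⟨H.anti_right (by omega) hvG, ?_⟩
    simpa using Submodule.sub_mem _ h1 hv'W

theorem exists_mem_right {p q : ℤ} {x : V} (hx : x ∈ deligne F G W p q) :
    ∃ v ∈ G q, v ∈ W (p + q) ∧ x - v ∈ tail G W (p + q - 2) (q - 1) := by
  obtain ⟨v, ⟨hvG, hvW⟩, v', hv', e⟩ := Submodule.mem_sup.1 hx.2
  exact ⟨v, hvG, hvW, by simpa [← e] using hv'⟩

theorem eq_zero_of_mem_deligne (H : OpposedFiltrations F G W) {p q : ℤ} {x : V}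
    (hx : x ∈ deligne F G W p q)
    (hxW : x ∈ W (p + q - 1)) : x = 0 := by
  obtain ⟨v, hvG, hvW, hv⟩ := exists_mem_right hx
  refine H.eq_zero_of_mem_tail (p := p) (b := q) (m := p + q - 1) (by omega) hx.1.1 ?_
  rw [tail_eq, show x = v + (x - v) by abel]
  refine Submodule.add_mem_sup ⟨hvG, ?_⟩ (by convert hv using 2; omega)
  have := H.mono (show p + q - 2 ≤ p + q - 1 by omega) (tail_le H.mono _ _ hv)
  simpa using Submodule.sub_mem _ hxW this

/-- The sum in the hypothesis contains every piece of smaller weight, and every piece of the same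
weight with larger first index. This is the triangularity behind `iSupIndep_deligne`. -/
theorem eq_zero_of_mem_lower (H : OpposedFiltrations F G W) {p q : ℤ} {x : V}
    (hx : x ∈ deligne F G W p q)
    (hx' : x ∈ W (p + q - 1) ⊔ F (p + 1) ⊓ W (p + q)) : x = 0 := by
  obtain ⟨v, hvG, hvW, hv⟩ := exists_mem_right hx
  obtain ⟨w, hw, f, ⟨hf, hfW⟩, rfl⟩ := Submodule.mem_sup.1 hx'
  have hv1 := H.mono (show p + q - 2 ≤ p + q - 1 by omega) (tail_le H.mono _ _ hv)
  have := H.disj (p + 1) q (p + q) (by omega) f hf v hvG hfW hvW (by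
    have := Submodule.sub_mem _ hv1 hw
    rwa [show w + f - v - w = f - v by abel] at this)
  exact H.eq_zero_of_mem_deligne hx (Submodule.add_mem _ hw this)

/-- A class of type `(p,q)` in the graded quotient has representatives `u ∈ F^p` and `v ∈ G^q`.
Splitting `u - v` by `exists_decomp` gives the correction of `u` inside `F^p` that leaves only
`G`-terms and a tail. -/
theorem exists_lift (H : OpposedFiltrations F G W) {p q : ℤ} {u v : V} (hu : u ∈ F p)
    (huW : u ∈ W (p + q)) (hv : v ∈ G q)
    (hvW : v ∈ W (p + q)) (huv : u - v ∈ W (p + q - 1)) :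
    ∃ x ∈ deligne F G W p q, u - x ∈ F p ∧ u - x ∈ W (p + q - 1) := by
  obtain ⟨f, hf, hfW, hd⟩ := H.exists_decomp (p := p) (b := q) (m := p + q - 1) (by omega) huv
  refine ⟨u - f, ⟨⟨Submodule.sub_mem _ hu hf,
    Submodule.sub_mem _ huW (H.mono (by omega) hfW)⟩, ?_⟩, by simpa using hf, by simpa using hfW⟩
  rw [tail_eq] at hd
  obtain ⟨g, ⟨hg, hgW⟩, t, ht, e⟩ := Submodule.mem_sup.1 hd
  have : u - f = (v + g) + t := by rw [add_assoc, e]; abel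
  rw [this]
  refine Submodule.add_mem_sup ⟨Submodule.add_mem _ hv hg,
    Submodule.add_mem _ hvW (H.mono (by omega) hgW)⟩ ?_
  convert ht using 2; omega

theorem left_inf_le (H : OpposedFiltrations F G W) (p k : ℤ) :
    F p ⊓ W k ≤ (F (p + 1) ⊓ W k ⊔ F p ⊓ W (k - 1)) ⊔ deligne F G W p (k - p) := by
  rintro x ⟨hx, hxW⟩
  obtain ⟨f, hf, g, hg, hfW, hgW, hfg⟩ := H.codisj (p + 1) (k - p) k (by omega) x hxW
  have hfp := H.anti_left (show p ≤ p + 1 by omega) hf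
  have ek : p + (k - p) = k := by omega
  obtain ⟨y, hy, hy1, hy2⟩ := H.exists_lift (p := p) (q := k - p) (u := x - f) (v := g)
    (Submodule.sub_mem _ hx hfp) (by rw [ek]; exact Submodule.sub_mem _ hxW hfW) hg
    (by rwa [ek]) (by rwa [ek])
  rw [ek] at hy2
  rw [show x = (f + (x - f - y)) + y by abel]
  exact Submodule.add_mem_sup (Submodule.add_mem_sup ⟨hf, hfW⟩ ⟨hy1, hy2⟩) hy

/-- The pieces `I^{p,q}` indexed by pairs. -/
abbrev pieces (I : ℤ → ℤ → Submodule K V) (pq : ℤ × ℤ) : Submodule K V := I pq.1 pq.2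

theorem deligne_le_left (p q : ℤ) : deligne F G W p q ≤ F p := inf_le_left.trans inf_le_left

theorem deligne_le_W (p q : ℤ) : deligne F G W p q ≤ W (p + q) := inf_le_left.trans inf_le_right

theorem left_inf_eq (H : OpposedFiltrations F G W) (p k : ℤ) :
    F p ⊓ W k = part (pieces (deligne F G W)) {rs | p ≤ rs.1 ∧ rs.1 + rs.2 ≤ k} := by
  apply le_antisymm
  · obtain ⟨k₀, hk₀⟩ := H.W_bot
    obtain ⟨p₁, hp₁⟩ := H.left_bot
    -- Both smaller intersections in `left_inf_le` decrease this measure by one, and where it is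
    -- nonpositive either `W_k` or `F^p` is zero.
    suffices ∀ n : ℕ, ∀ p k : ℤ, (k - k₀) + (p₁ - p) ≤ n →
        F p ⊓ W k ≤ part (pieces (deligne F G W)) {rs | p ≤ rs.1 ∧ rs.1 + rs.2 ≤ k} from
      this ((k - k₀) + (p₁ - p)).toNat p k (by omega)
    intro n
    induction n with
    | zero =>
      intro p k h
      by_cases hk : k ≤ k₀
      · rw [W_eq_bot_of_le H.mono hk₀ hk]; simp
      · have : F p = ⊥ := le_bot_iff.1 (hp₁ ▸ H.anti_left (show p₁ ≤ p by push_cast at h; omega))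
        simp [this]
    | succ n ih =>
      intro p k h
      push_cast at h
      refine (H.left_inf_le p k).trans (sup_le (sup_le ?_ ?_) ?_)
      · exact (ih (p + 1) k (by omega)).trans (part_mono fun rs h => ⟨by have := h.1; omega, h.2⟩)
      · exact (ih p (k - 1) (by omega)).trans (part_mono fun rs h => ⟨h.1, by have := h.2; omega⟩)
      · exact le_part (J := pieces (deligne F G W)) (i := (p, k - p)) ⟨le_rfl, by simp⟩
  · exact part_le fun rs h => le_inf ((deligne_le_left _ _).trans (H.anti_left h.1))
      ((deligne_le_W _ _).trans (H.mono h.2))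

theorem left_eq (H : OpposedFiltrations F G W) (p : ℤ) : F p = part (pieces (deligne F G W))
    {rs | p ≤ rs.1} := by
  obtain ⟨k, hk⟩ := H.W_top
  apply le_antisymm
  · have := H.left_inf_eq p k
    rw [hk, inf_top_eq] at this
    exact this.le.trans (part_mono fun rs h => h.1)
  · exact part_le fun rs h => (deligne_le_left _ _).trans (H.anti_left h)

theorem W_eq (H : OpposedFiltrations F G W) (k : ℤ) : W k = part (pieces (deligne F G W))
    {rs | rs.1 + rs.2 ≤ k} := by
  obtain ⟨p, hp⟩ := H.left_top
  apply le_antisymm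
  · have := H.left_inf_eq p k
    rw [hp, top_inf_eq] at this
    exact this.le.trans (part_mono fun rs h => h.2)
  · exact part_le fun rs h => (deligne_le_W _ _).trans (H.mono h)

theorem iSupIndep_deligne (H : OpposedFiltrations F G W) : iSupIndep (pieces (deligne F G W)) := by
  rw [iSupIndep_iff_finsetSum_eq_zero_imp_eq_zero]
  intro s
  -- The order is by weight, then by decreasing first index, so the terms other than the maximal one
  -- lie in the subspace of `eq_zero_of_mem_lower`.
  induction s using Finset.induction_on_max_value
    (fun rs : ℤ × ℤ => toLex (rs.1 + rs.2, -rs.1)) with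
  | empty => simp
  | insert a s ha hmax ih =>
    intro v hv hsum
    rw [Finset.sum_insert ha] at hsum
    have hs : ∑ i ∈ s, v i ∈ W (a.1 + a.2 - 1) ⊔ F (a.1 + 1) ⊓ W (a.1 + a.2) := by
      refine Submodule.sum_mem _ fun j hj => ?_
      have hvj := hv j (Finset.mem_insert_of_mem hj)
      have hne : j ≠ a := by rintro rfl; exact ha hj
      have := hmax j hj
      rw [Prod.Lex.toLex_le_toLex] at this
      rcases this with hlt | ⟨heq, hle⟩
      · exact Submodule.mem_sup_left (H.mono (by simp only at hlt; omega) (deligne_le_W _ _ hvj))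
      · refine Submodule.mem_sup_right ⟨H.anti_left ?_ (deligne_le_left _ _ hvj),
          H.mono heq.le (deligne_le_W _ _ hvj)⟩
        have : j.1 ≠ a.1 := fun e => hne (Prod.ext e (by simp only at heq; omega))
        simp only at hle
        omega
    have h0 : v a = 0 := by
      refine H.eq_zero_of_mem_lower (hv a (Finset.mem_insert_self _ _)) ?_
      rw [eq_neg_of_add_eq_zero_left hsum]
      exact Submodule.neg_mem _ hs
    rw [h0, zero_add] at hsum
    intro i hi
    rcases Finset.mem_insert.1 hi with rfl | hi
    · exact h0
    · exact ih v (fun i hi => hv i (Finset.mem_insert_of_mem hi)) hsum i hi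

theorem isInternal_deligne (H : OpposedFiltrations F G W) : DirectSum.IsInternal
    (pieces (deligne F G W)) := by
  refine DirectSum.isInternal_submodule_of_iSupIndep_of_iSup_eq_top H.iSupIndep_deligne ?_
  obtain ⟨p, hp⟩ := H.left_top
  have := H.left_eq p
  rw [hp] at this
  rw [eq_top_iff, this]
  exact part_le fun i _ => le_iSup (pieces (deligne F G W)) i

/-- A piece of `F^{a-i} ∩ W_{m-i}` has `r ≥ a - i` and `r + s ≤ m - i`, and the shift `i` cancels in
`s ≤ m - a`. -/
theorem tail_left_le (H : OpposedFiltrations F G W) (m a : ℤ) :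
    tail F W m a ≤ part (pieces (deligne F G W)) {rs | rs.2 ≤ m - a ∧ rs.1 + rs.2 ≤ m} := by
  refine iSup_le fun i => ?_
  rw [H.left_inf_eq]
  exact part_mono fun rs h => ⟨by have := h.1; have := h.2; omega, by have := h.2; omega⟩

theorem le_tail_right (H : OpposedFiltrations F G W) (m b : ℤ) :
    part (pieces (deligne F G W)) {rs | rs.1 ≤ m - b ∧ rs.1 + rs.2 ≤ m} ≤ tail G W m b := by
  refine part_le ?_
  rintro ⟨r, s⟩ ⟨h1, h2⟩ x hx
  simp only at h1 h2
  obtain ⟨v, hvG, hvW, hv⟩ := exists_mem_right hx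
  have hle : ∀ b' m' : ℤ, m' ≤ m → b - (m - m') ≤ b' → G b' ⊓ W m' ≤ tail G W m b := by
    intro b' m' hm hb
    refine le_iSup_of_le (m - m').toNat ?_
    exact inf_le_inf (H.anti_right (by omega)) (H.mono (by omega))
  rw [show x = v + (x - v) by abel]
  refine Submodule.add_mem _ (hle s (r + s) h2 (by omega) ⟨hvG, hvW⟩) ?_
  refine (iSup_le fun i => ?_ : tail G W (r + s - 2) (s - 1) ≤ tail G W m b) hv
  exact hle _ _ (by omega) (by omega)

/-- For the upper bound, `W_m` lies in the sum of the right side and `F^{m+1-b}`, and the latter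
meets the tail only in zero. -/
theorem tail_right_eq (H : OpposedFiltrations F G W) (m b : ℤ) :
    tail G W m b = part (pieces (deligne F G W)) {rs | rs.1 ≤ m - b ∧ rs.1 + rs.2 ≤ m} := by
  refine le_antisymm (fun x hx => ?_) (H.le_tail_right m b)
  have hxW := tail_le H.mono _ _ hx
  rw [H.W_eq] at hxW
  have : part (pieces (deligne F G W)) {rs | rs.1 + rs.2 ≤ m} ≤
      part (pieces (deligne F G W)) {rs | rs.1 ≤ m - b ∧ rs.1 + rs.2 ≤ m} ⊔ F (m + 1 - b) := by
    rw [H.left_eq (m + 1 - b), part_sup]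
    refine part_mono fun rs h => ?_
    by_cases h' : rs.1 ≤ m - b
    · exact .inl ⟨h', h⟩
    · refine .inr ?_
      simp only [Set.mem_ofPred_eq]
      omega
  obtain ⟨y, hy, z, hz, rfl⟩ := Submodule.mem_sup.1 (this hxW)
  have hz' : z ∈ tail G W m b := by
    simpa using Submodule.sub_mem _ hx (H.le_tail_right m b hy)
  rw [H.eq_zero_of_mem_tail (by omega) hz hz', add_zero]
  exact hy

/-- Opposedness in weight `p + q - 1` improves the congruence of `x` and `y` to one modulo
`W_{p+q-2}`. The difference then lies in a tail of `G`, which bounds `r`, and in a tail of `F`,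
which bounds `s`. -/
theorem sub_mem_of_sub_mem_W [FiniteDimensional K V] (H : OpposedFiltrations F G W) {p q : ℤ}
    {x y : V}
    (hx : x ∈ deligne F G W p q) (hy : y ∈ deligne G F W q p) (hxy : x - y ∈ W (p + q - 1)) :
    x - y ∈ part (pieces (deligne F G W)) {rs | rs.1 < p ∧ rs.2 < q} := by
  obtain ⟨v, hvG, hvW, hv⟩ := exists_mem_right hx
  obtain ⟨w, hwF, hwW, hw⟩ := exists_mem_right hy
  rw [show q + p = p + q by omega] at hwW hw
  have hvW' := tail_le H.mono _ _ hv
  have hwW' := tail_le H.mono _ _ hw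
  have hmono := H.mono (show p + q - 2 ≤ p + q - 1 by omega)
  have hxw : x - w ∈ W (p + q - 1) := by
    have := Submodule.add_mem _ hxy (hmono hwW')
    rwa [show x - y + (y - w) = x - w by abel] at this
  have hvy : v - y ∈ W (p + q - 1) := by
    have := Submodule.sub_mem _ hxy (hmono hvW')
    rwa [show x - y - (x - v) = v - y by abel] at this
  have hyG : y ∈ G q := deligne_le_left _ _ hy
  have hxF : x ∈ F p := deligne_le_left _ _ hx
  have h2 : x - w ∈ W (p + q - 2) := by
    have := H.disj p q (p + q - 1) (by omega) (x - w) (Submodule.sub_mem _ hxF hwF) (v - y)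
      (Submodule.sub_mem _ hvG hyG) hxw hvy (by
        rw [show x - w - (v - y) = (x - v) + (y - w) by abel,
          show p + q - 1 - 1 = p + q - 2 by omega]
        exact Submodule.add_mem _ hvW' hwW')
    rwa [show p + q - 1 - 1 = p + q - 2 by omega] at this
  have h3 : v - y ∈ W (p + q - 2) := by
    have := Submodule.sub_mem _ (Submodule.sub_mem _ h2 hvW') hwW'
    rwa [show x - w - (x - v) - (y - w) = v - y by abel] at this
  have k1 : x - y ∈ tail G W (p + q - 2) (q - 1) := by
    rw [show x - y = (v - y) + (x - v) by abel]
    refine Submodule.add_mem _ ?_ hv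
    rw [tail_eq]
    exact Submodule.mem_sup_left ⟨H.anti_right (by omega) (Submodule.sub_mem _ hvG hyG), h3⟩
  have k2 : x - y ∈ tail F W (p + q - 2) (p - 1) := by
    rw [show x - y = (x - w) - (y - w) by abel]
    refine Submodule.sub_mem _ ?_ hw
    rw [tail_eq]
    exact Submodule.mem_sup_left ⟨H.anti_left (by omega) (Submodule.sub_mem _ hxF hwF), h2⟩
  rw [H.tail_right_eq] at k1
  have := part_inf H.isInternal_deligne _ _ ▸ Submodule.mem_inf.2 ⟨k1, H.tail_left_le _ _ k2⟩
  refine part_mono (fun rs h => ?_) this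
  have h1 := h.1.1
  have h2 := h.2.1
  exact ⟨by omega, by omega⟩

theorem swap (H : OpposedFiltrations F G W) (hb : ∃ p, G p = ⊥) (ht : ∃ p, G p = ⊤) :
    OpposedFiltrations G F W where
  anti_left := H.anti_right
  anti_right := H.anti_left
  mono := H.mono
  W_bot := H.W_bot
  W_top := H.W_top
  left_bot := hb
  left_top := ht
  disj p b m h x hx y hy hxW hyW hxy := by
    have h1 := (neg_sub x y ▸ Submodule.neg_mem _ hxy : y - x ∈ W (m - 1))
    have := H.disj b p m (by omega) y hy x hx hyW hxW h1
    simpa using Submodule.sub_mem _ this h1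
  codisj p b m h x hx := by
    obtain ⟨f, hf, g, hg, hfW, hgW, hfg⟩ := H.codisj b p m (by omega) x hx
    exact ⟨g, hg, f, hf, hgW, hfW, by rwa [sub_right_comm]⟩

/-- For `G = conj F` this is the conjugation property of the bigrading, because conjugation
exchanges the two constructions. Each element of one piece is matched with an element of the other
by `exists_lift`. -/
theorem deligne_sup_eq [FiniteDimensional K V] (H : OpposedFiltrations F G W) (hb : ∃ p, G p = ⊥)
    (ht : ∃ p, G p = ⊤) (p q : ℤ) :
    deligne F G W p q ⊔ part (pieces (deligne F G W)) {rs | rs.1 < p ∧ rs.2 < q} =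
      deligne G F W q p ⊔ part (pieces (deligne F G W)) {rs | rs.1 < p ∧ rs.2 < q} := by
  have H' := H.swap hb ht
  apply le_antisymm
  · refine sup_le (fun x hx => ?_) le_sup_right
    obtain ⟨v, hvG, hvW, hv⟩ := exists_mem_right hx
    have hvx : v - x ∈ W (p + q - 1) := by
      rw [← neg_sub x v]
      exact Submodule.neg_mem _ (H.mono (show p + q - 2 ≤ p + q - 1 by omega) (tail_le H.mono _ _ hv))
    have e : q + p = p + q := by omega
    obtain ⟨y, hy, -, hy2⟩ := H'.exists_lift (p := q) (q := p) (u := v) (v := x) hvG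
      (by rwa [e]) (deligne_le_left _ _ hx) (by rw [e]; exact deligne_le_W _ _ hx) (by rwa [e])
    have := H.sub_mem_of_sub_mem_W hx hy (by
      rw [e] at hy2
      have := Submodule.sub_mem _ hy2 hvx
      rwa [show v - y - (v - x) = x - y by abel] at this)
    rw [show x = y + (x - y) by abel]
    exact Submodule.add_mem_sup hy this
  · refine sup_le (fun y hy => ?_) le_sup_right
    obtain ⟨w, hwF, hwW, hw⟩ := exists_mem_right hy
    have e : q + p = p + q := by omega
    have hwy : w - y ∈ W (p + q - 1) := by
      rw [← neg_sub y w]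
      exact Submodule.neg_mem _ (H.mono (show q + p - 2 ≤ p + q - 1 by omega) (tail_le H.mono _ _ hw))
    obtain ⟨x, hx, -, hx2⟩ := H.exists_lift (p := p) (q := q) (u := w) (v := y) hwF
      (by rwa [← e]) (deligne_le_left _ _ hy) (by rw [← e]; exact deligne_le_W _ _ hy) hwy
    have := H.sub_mem_of_sub_mem_W hx hy (by
      have := Submodule.sub_mem _ hwy hx2
      rwa [show w - y - (w - x) = x - y by abel] at this)
    rw [show y = x - (x - y) by abel]
    exact Submodule.sub_mem _ (Submodule.mem_sup_left hx) (Submodule.mem_sup_right this)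

end OpposedFiltrations


/-! ### Conjugation and the bigrading of a mixed Hodge structure. -/

namespace GradedPolarizationData

open BigradedSum OpposedFiltrations

variable {V : Type*} [AddCommGroup V] [Module ℂ V] [Module ℚ V] (D : GradedPolarizationData V)

theorem conjTensor_conjTensor (t : ℂ ⊗[ℚ] D.VQ) : D.conjTensor (D.conjTensor t) = t := by
  induction t with
  | zero => simp
  | tmul a b => simp [conjTensor]
  | add a b ha hb => simp only [map_add, ha, hb]

@[simp]
theorem conj_conj (x : V) : D.conj (D.conj x) = x := by
  change D.isBaseChange.equiv (D.conjTensor (D.isBaseChange.equiv.symm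
    (D.isBaseChange.equiv (D.conjTensor (D.isBaseChange.equiv.symm x))))) = x
  rw [LinearEquiv.symm_apply_apply, conjTensor_conjTensor, LinearEquiv.apply_symm_apply]

theorem conj_rational {x : V} (hx : x ∈ D.VQ) : D.conj x = x := by
  simpa using D.conj_smul_rational 1 hx

theorem conj_mem_W_iff {k : ℤ} {x : V} : D.conj x ∈ D.W k ↔ x ∈ D.W k :=
  ⟨fun h => by simpa using D.conj_mem_W k _ h, D.conj_mem_W k x⟩

theorem mem_map_conj {P : Submodule ℂ V} {x : V} : x ∈ P.map D.conj ↔ D.conj x ∈ P := by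
  constructor
  · rintro ⟨y, hy, rfl⟩
    simpa using hy
  · exact fun h => ⟨_, h, by simp⟩

variable {D}

theorem mk_eq_zero_iff {k : ℤ} {x : D.W k} : GrW.mk D.W k x = 0 ↔ (x : V) ∈ D.W (k - 1) := by
  rw [GrW.mk, Submodule.mkQ_apply, Submodule.Quotient.mk_eq_zero]
  rfl

theorem mk_eq_mk_iff {k : ℤ} {x y : D.W k} :
    GrW.mk D.W k x = GrW.mk D.W k y ↔ (x : V) - y ∈ D.W (k - 1) := by
  rw [← sub_eq_zero, ← map_sub, mk_eq_zero_iff]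
  rfl

theorem mk_mem_grF {F : DecFiltration V} {k p : ℤ} {x : D.W k} :
    GrW.mk D.W k x ∈ D.grF F k p ↔ ∃ f ∈ F p, f ∈ D.W k ∧ (x : V) - f ∈ D.W (k - 1) := by
  constructor
  · rintro ⟨f, hf, e⟩
    exact ⟨f, hf, f.2, mk_eq_mk_iff.1 e.symm⟩
  · rintro ⟨f, hf, hfW, h⟩
    exact ⟨⟨f, hfW⟩, hf, (mk_eq_mk_iff.2 h).symm⟩

theorem grConj_mk {k : ℤ} (x : D.W k) :
    D.grConj k (GrW.mk D.W k x) = GrW.mk D.W k ⟨D.conj x, D.conj_mem_W k x x.2⟩ := rfl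

theorem grConj_grConj {k : ℤ} (x : GrW D.W k) : D.grConj k (D.grConj k x) = x := by
  obtain ⟨x, rfl⟩ := Submodule.mkQ_surjective _ x
  change D.grConj k (D.grConj k (GrW.mk D.W k x)) = GrW.mk D.W k x
  rw [grConj_mk, grConj_mk]
  congr 1
  ext
  simp

theorem mem_map_grConj {k : ℤ} {P : Submodule ℂ (GrW D.W k)} {x : GrW D.W k} :
    x ∈ P.map (D.grConj k) ↔ D.grConj k x ∈ P := by
  constructor
  · rintro ⟨y, hy, rfl⟩
    rwa [grConj_grConj]
  · exact fun h => ⟨_, h, grConj_grConj x⟩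

theorem mk_mem_map_grF {F : DecFiltration V} {k p : ℤ} {x : D.W k} :
    GrW.mk D.W k x ∈ (D.grF F k p).map (D.grConj k) ↔
      ∃ f ∈ F p, f ∈ D.W k ∧ (x : V) - D.conj f ∈ D.W (k - 1) := by
  rw [mem_map_grConj, grConj_mk, mk_mem_grF]
  refine exists_congr fun f => and_congr_right fun _ => and_congr_right fun _ => ?_
  rw [← D.conj_mem_W_iff (x := (x : V) - _)]
  simp

theorem exists_mk {k : ℤ} (x : GrW D.W k) : ∃ y : D.W k, GrW.mk D.W k y = x :=
  Submodule.mkQ_surjective _ x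

theorem disjoint_grF_iff {F : DecFiltration V} {k p b : ℤ} :
    Disjoint (D.grF F k p) ((D.grF F k b).map (D.grConj k)) ↔
      ∀ f ∈ F p, ∀ g ∈ F b, f ∈ D.W k → g ∈ D.W k → f - D.conj g ∈ D.W (k - 1) →
        f ∈ D.W (k - 1) := by
  rw [Submodule.disjoint_def]
  constructor
  · intro h f hf g hg hfW hgW hfg
    have := h (GrW.mk D.W k ⟨f, hfW⟩) (mk_mem_grF.2 ⟨f, hf, hfW, by simp⟩)
      (mk_mem_map_grF.2 ⟨g, hg, hgW, hfg⟩)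
    exact mk_eq_zero_iff.1 this
  · intro h x hx hx'
    obtain ⟨x, rfl⟩ := exists_mk x
    obtain ⟨f, hf, hfW, hxf⟩ := mk_mem_grF.1 hx
    obtain ⟨g, hg, hgW, hxg⟩ := mk_mem_map_grF.1 hx'
    rw [mk_eq_zero_iff]
    have := h f hf g hg hfW hgW (by
      have := Submodule.sub_mem _ hxg hxf
      rwa [sub_sub_sub_cancel_left] at this)
    simpa using Submodule.add_mem _ hxf this

theorem opposed_of_isMixedHodge {F : DecFiltration V} (h : D.IsMixedHodge F) :
    OpposedFiltrations F.toFun (fun q => (F q).map D.conj) D.W where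
  anti_left := F.antitone'
  anti_right := fun _ _ hab => Submodule.map_mono (F.antitone' hab)
  mono := D.W_mono
  W_bot := D.W_bot
  W_top := D.W_top
  left_bot := h.2.1
  left_top := h.1
  disj p b m hpb x hx y hy hxW hyW hxy := by
    have hc := ((h.2.2 m).2.2.2 p).disjoint
    rw [disjoint_grF_iff, show m - p + 1 = b by omega] at hc
    exact hc x hx (D.conj y) (D.mem_map_conj.1 hy) hxW (D.conj_mem_W_iff.2 hyW) (by simpa using hxy)
  codisj p b m hpb x hx := by
    have hc := ((h.2.2 m).2.2.2 p).sup_eq_top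
    rw [show m - p + 1 = b by omega] at hc
    obtain ⟨f, hf, g, hg, e⟩ := Submodule.mem_sup.1
      (hc ▸ Submodule.mem_top : GrW.mk D.W m ⟨x, hx⟩ ∈ D.grF F m p ⊔ (D.grF F m b).map (D.grConj m))
    obtain ⟨f, rfl⟩ := exists_mk f
    obtain ⟨g, rfl⟩ := exists_mk g
    obtain ⟨f', hf', hf'W, hff'⟩ := mk_mem_grF.1 hf
    obtain ⟨g', hg', hg'W, hgg'⟩ := mk_mem_map_grF.1 hg
    rw [← map_add, mk_eq_mk_iff] at e
    refine ⟨f', hf', D.conj g', ⟨g', hg', rfl⟩, hf'W, D.conj_mem_W _ _ hg'W, ?_⟩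
    have := Submodule.sub_mem _ (Submodule.add_mem _ hff' hgg') e
    convert this using 1
    simp
    abel

theorem iSup_eq_part (I : ℤ → ℤ → Submodule ℂ V) (P : ℤ × ℤ → Prop) :
    part (pieces I) {rs | P rs} = ⨆ (r : ℤ) (s : ℤ) (_ : P (r, s)), I r s := by
  rw [part, iSup_prod]
  rfl

theorem iSup_eq_part_lt (I : ℤ → ℤ → Submodule ℂ V) (p q : ℤ) :
    part (pieces I) {rs | rs.1 < p ∧ rs.2 < q} =
      ⨆ (r : ℤ) (s : ℤ) (_ : r < p) (_ : s < q), I r s := by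
  rw [iSup_eq_part I (fun rs => rs.1 < p ∧ rs.2 < q)]
  simp only [iSup_and]

/-- Deligne: a mixed Hodge structure has a bigrading. -/
theorem exists_isDeligneBigrading [FiniteDimensional ℂ V] {F : DecFiltration V}
    (h : D.IsMixedHodge F) : ∃ I, D.IsDeligneBigrading F I := by
  have H := opposed_of_isMixedHodge h
  refine ⟨deligne F.toFun (fun q => (F q).map D.conj) D.W, H.isInternal_deligne, fun p => ?_,
    fun k => ?_, fun p q => ?_⟩
  · exact (H.left_eq p).trans (iSup_eq_part _ (fun rs => p ≤ rs.1))
  · exact (H.W_eq k).trans (iSup_eq_part _ (fun rs => rs.1 + rs.2 ≤ k))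
  · rw [← iSup_eq_part_lt]
    have hb : ∃ p, (F p).map D.conj = ⊥ := h.2.1.imp fun p hp => by rw [hp, Submodule.map_bot]
    have ht : ∃ p, (F p).map D.conj = ⊤ := h.1.imp fun p hp => by
      rw [hp, eq_top_iff]
      exact fun x _ => D.mem_map_conj.2 trivial
    convert H.deligne_sup_eq hb ht p q using 2
    ext x
    rw [D.mem_map_conj]
    -- Conjugation preserves `W` and exchanges `F` with its conjugate, so it carries the pieces of
    -- `(F, conj F)` to those of `(conj F, F)`.
    have key : ∀ {P Q : ℤ → Submodule ℂ V} (m b : ℤ), (∀ q x, x ∈ P q → D.conj x ∈ Q q) →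
        ∀ x ∈ tail P D.W m b, D.conj x ∈ tail Q D.W m b := by
      intro P Q m b hPQ x hx
      refine (iSup_le fun i => ?_ : tail P D.W m b ≤ (tail Q D.W m b).comap D.conj) hx
      rintro y ⟨hy, hyW⟩
      exact Submodule.mem_iSup_of_mem i ⟨hPQ _ _ hy, D.conj_mem_W _ _ hyW⟩
    have key2 : ∀ {P Q P' Q' : ℤ → Submodule ℂ V} (p q : ℤ), (∀ q x, x ∈ P q → D.conj x ∈ P' q) →
        (∀ q x, x ∈ Q q → D.conj x ∈ Q' q) → ∀ x ∈ deligne P Q D.W p q,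
          D.conj x ∈ deligne P' Q' D.W p q := by
      intro P Q P' Q' p q hP hQ x hx
      refine ⟨⟨hP _ _ hx.1.1, D.conj_mem_W _ _ hx.1.2⟩, ?_⟩
      obtain ⟨v, hvQ, hvW, hv⟩ := exists_mem_right hx
      rw [show D.conj x = D.conj v + D.conj (x - v) by simp]
      exact Submodule.add_mem_sup ⟨hQ _ _ hvQ, D.conj_mem_W _ _ hvW⟩ (key _ _ hQ _ hv)
    have c1 : ∀ q x, x ∈ F.toFun q → D.conj x ∈ (F q).map D.conj := fun q x hx => ⟨x, hx, rfl⟩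
    have c2 : ∀ q x, x ∈ (F q).map D.conj → D.conj x ∈ F.toFun q := fun q x hx => D.mem_map_conj.1 hx
    constructor
    · intro hx
      simpa using key2 q p c1 c2 _ hx
    · exact key2 q p c2 c1 x

/-- Existence alone is enough here. Uniqueness plays no role, since the dimensions of the pieces do
not depend on the bigrading (`finrank_I_congr`). -/
theorem isDeligneBigrading_I [FiniteDimensional ℂ V] {F : DecFiltration V}
    (h : D.IsMixedHodge F) : D.IsDeligneBigrading F (D.I F) :=
  Classical.epsilon_spec (exists_isDeligneBigrading h)

namespace IsDeligneBigrading

variable {F : DecFiltration V} {I : ℤ → ℤ → Submodule ℂ V} (hI : D.IsDeligneBigrading F I)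

theorem internal (hI : D.IsDeligneBigrading F I) : DirectSum.IsInternal (pieces I) := hI.isInternal

theorem F_eq (hI : D.IsDeligneBigrading F I) (p : ℤ) : F p = part (pieces I) {rs | p ≤ rs.1} :=
  (hI.hodge p).trans (iSup_eq_part I (fun rs => p ≤ rs.1)).symm

theorem W_eq (hI : D.IsDeligneBigrading F I) (k : ℤ) :
    D.W k = part (pieces I) {rs | rs.1 + rs.2 ≤ k} :=
  (hI.weight k).trans (iSup_eq_part I (fun rs => rs.1 + rs.2 ≤ k)).symm

theorem F_inf_W_eq [FiniteDimensional ℂ V] (hI : D.IsDeligneBigrading F I) (p k : ℤ) :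
    F p ⊓ D.W k = part (pieces I) {rs | p ≤ rs.1 ∧ rs.1 + rs.2 ≤ k} := by
  rw [hI.F_eq, hI.W_eq, part_inf hI.internal]
  rfl

theorem le_F (hI : D.IsDeligneBigrading F I) (p q : ℤ) : I p q ≤ F p := by
  rw [hI.F_eq]
  exact le_part (J := pieces I) (i := (p, q)) (le_refl p)

theorem le_W (hI : D.IsDeligneBigrading F I) (p q : ℤ) : I p q ≤ D.W (p + q) := by
  rw [hI.W_eq]
  exact le_part (J := pieces I) (i := (p, q)) (le_refl (p + q))

/-- The error terms `I^{r,s}` with `r < p` and `s < q` have weight at most `p + q - 2`, so they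
vanish in the graded quotient. -/
theorem exists_conj_mem (hI : D.IsDeligneBigrading F I) {p q : ℤ} {x : V} (hx : x ∈ I p q) :
    ∃ y ∈ F q, y ∈ D.W (p + q) ∧ x - D.conj y ∈ D.W (p + q - 1) := by
  have h1 : x ∈ (I q p).map D.conj ⊔ ⨆ (r : ℤ) (s : ℤ) (_ : r < p) (_ : s < q), I r s := by
    rw [← hI.conj]
    exact Submodule.mem_sup_left hx
  obtain ⟨z, ⟨y, hy, rfl⟩, w, hw, rfl⟩ := Submodule.mem_sup.1 h1
  refine ⟨y, hI.le_F _ _ hy, by rw [add_comm]; exact hI.le_W _ _ hy, ?_⟩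
  rw [← iSup_eq_part_lt] at hw
  rw [add_sub_cancel_left, hI.W_eq]
  refine part_mono (fun rs h => ?_) hw
  have h1 := h.1
  have h2 := h.2
  change rs.1 + rs.2 ≤ _
  omega

end IsDeligneBigrading

end GradedPolarizationData


/-! ### The forms `S_k`, `Lie(G_ℂ)` and bidegree components. -/

namespace GradedPolarizationData

open BigradedSum OpposedFiltrations

section Form

variable {V : Type*} [AddCommGroup V] [Module ℂ V] [Module ℚ V] (D : GradedPolarizationData V)

/-- A linear projection of `V` onto `W_k`. -/
def projW (k : ℤ) : V →ₗ[ℂ] D.W k :=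
  (LinearMap.exists_leftInverse_of_injective (D.W k).subtype (Submodule.ker_subtype _)).choose

theorem projW_apply {k : ℤ} {x : V} (hx : x ∈ D.W k) : D.projW k x = ⟨x, hx⟩ :=
  LinearMap.congr_fun (LinearMap.exists_leftInverse_of_injective (D.W k).subtype
    (Submodule.ker_subtype _)).choose_spec ⟨x, hx⟩

/-- A bilinear form on `V` that lifts `S_k` on `W_k`. -/
def B (k : ℤ) : V →ₗ[ℂ] V →ₗ[ℂ] ℂ :=
  (D.S k).compl₁₂ (GrW.mk D.W k ∘ₗ D.projW k) (GrW.mk D.W k ∘ₗ D.projW k)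

theorem B_apply {k : ℤ} {x y : V} (hx : x ∈ D.W k) (hy : y ∈ D.W k) :
    D.B k x y = D.S k (GrW.mk D.W k ⟨x, hx⟩) (GrW.mk D.W k ⟨y, hy⟩) := by
  simp only [B, LinearMap.compl₁₂_apply, LinearMap.comp_apply, projW_apply D hx, projW_apply D hy]

variable {D}

theorem mk_eq_zero {k : ℤ} {x : V} (hx : x ∈ D.W (k - 1)) :
    GrW.mk D.W k ⟨x, D.W_mono (by omega) hx⟩ = 0 := mk_eq_zero_iff.2 hx

theorem B_left_eq_zero {k : ℤ} {x y : V} (hx : x ∈ D.W (k - 1)) (hy : y ∈ D.W k) :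
    D.B k x y = 0 := by
  rw [B_apply D (D.W_mono (by omega) hx) hy, mk_eq_zero hx]
  simp

theorem B_right_eq_zero {k : ℤ} {x y : V} (hx : x ∈ D.W k) (hy : y ∈ D.W (k - 1)) :
    D.B k x y = 0 := by
  rw [B_apply D hx (D.W_mono (by omega) hy), mk_eq_zero hy]
  simp

theorem B_symm {k : ℤ} {x y : V} (hx : x ∈ D.W k) (hy : y ∈ D.W k) :
    D.B k x y = (-1 : ℂ) ^ k * D.B k y x := by
  rw [B_apply D hx hy, B_apply D hy hx, D.S_parity]

/-- Rational vectors span `W_k`; they are fixed by conjugation and the form has rational values on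
them. -/
theorem B_conj_conj {k : ℤ} {x y : V} (hx : x ∈ D.W k) (hy : y ∈ D.W k) :
    D.B k (D.conj x) (D.conj y) = starRingEnd ℂ (D.B k x y) := by
  rw [← D.W_rational k] at hx hy
  induction hx using Submodule.span_induction with
  | mem x hx =>
    induction hy using Submodule.span_induction with
    | mem y hy =>
      obtain ⟨r, hr⟩ := D.S_rational k ⟨x, hx.2⟩ ⟨y, hy.2⟩ hx.1 hy.1
      rw [D.conj_rational hx.1, D.conj_rational hy.1, B_apply D hx.2 hy.2, hr]
      simp
    | zero => simp
    | add y z _ _ h1 h2 => simp only [map_add, h1, h2]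
    | smul c y _ h => simp only [LinearMap.map_smulₛₗ, map_smul, smul_eq_mul, map_mul, h]
  | zero => simp
  | add x z _ _ h1 h2 => simp only [map_add, LinearMap.add_apply, h1, h2]
  | smul c x _ h =>
    simp only [LinearMap.map_smulₛₗ, map_smul, LinearMap.smul_apply, smul_eq_mul, map_mul, h]

variable (D) in
/-- The first Riemann bilinear relation, in terms of `V`. -/
def FirstRelation (F : DecFiltration V) : Prop :=
  ∀ k p, ∀ x ∈ F p, ∀ y ∈ F (k - p + 1), x ∈ D.W k → y ∈ D.W k → D.B k x y = 0

theorem firstRelation_iff {F : DecFiltration V} : D.FirstRelation F ↔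
    ∀ k p, ∀ u ∈ D.grF F k p, ∀ v ∈ D.grF F k (k - p + 1), D.S k u v = 0 := by
  refine forall_congr' fun k => forall_congr' fun p => ?_
  constructor
  · rintro h u ⟨x, hx, rfl⟩ v ⟨y, hy, rfl⟩
    exact (B_apply D x.2 y.2).symm.trans (h x hx y hy x.2 y.2)
  · intro h x hx y hy hxW hyW
    rw [B_apply D hxW hyW]
    exact h _ ⟨⟨x, hxW⟩, hx, rfl⟩ _ ⟨⟨y, hyW⟩, hy, rfl⟩

namespace IsDeligneBigrading

variable {F : DecFiltration V} {I : ℤ → ℤ → Submodule ℂ V}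

/-- If `p + r > k`, this is the first bilinear relation. If `p + r < k`, then `q + s > k`, and the
relation applies to the conjugates, which agree modulo lower weight with elements of `F^q` and
`F^s`. -/
theorem B_eq_zero (hI : D.IsDeligneBigrading F I) (hS : D.FirstRelation F) {k p q r s : ℤ}
    (hpq : p + q = k) (hrs : r + s = k) (hne : p + r ≠ k) {x y : V} (hx : x ∈ I p q)
    (hy : y ∈ I r s) : D.B k x y = 0 := by
  have hxW := hI.le_W _ _ hx
  have hyW := hI.le_W _ _ hy
  rw [hpq] at hxW
  rw [hrs] at hyW
  rcases lt_or_gt_of_ne hne with h | h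
  · obtain ⟨x', hx', hx'W, hxx'⟩ := hI.exists_conj_mem hx
    obtain ⟨y', hy', hy'W, hyy'⟩ := hI.exists_conj_mem hy
    rw [hpq] at hx'W hxx'
    rw [hrs] at hy'W hyy'
    have hcx := D.conj_mem_W _ _ hx'W
    have hcy := D.conj_mem_W _ _ hy'W
    rw [show x = D.conj x' + (x - D.conj x') by abel, show y = D.conj y' + (y - D.conj y') by abel,
      LinearMap.map_add₂, map_add, B_right_eq_zero hcx hyy', B_left_eq_zero hxx',
      B_conj_conj hx'W hy'W, hS k q x' hx' y' (F.antitone' (by omega) hy') hx'W hy'W]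
    · simp
    · rwa [add_sub_cancel]
  · exact hS k p x (hI.le_F _ _ hx) y (F.antitone' (by omega) (hI.le_F _ _ hy)) hxW hyW

theorem B_proj_eq_zero [FiniteDimensional ℂ V] (hI : D.IsDeligneBigrading F I)
    (hS : D.FirstRelation F) {k r s : ℤ} (hrs : r + s = k) {v y : V} (hv : v ∈ D.W k)
    (hy : y ∈ I r s) {l : ℤ × ℤ} (hl : l ≠ (s, r)) :
    D.B k (proj hI.internal l v) y = 0 := by
  have hyW := hI.le_W _ _ hy
  rw [hrs] at hyW
  rcases lt_trichotomy (l.1 + l.2) k with h | h | h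
  · exact B_left_eq_zero (D.W_mono (by omega) (hI.le_W _ _ (proj_mem hI.internal l v))) hyW
  · refine hI.B_eq_zero hS h hrs (fun e => hl (Prod.ext ?_ ?_)) (proj_mem hI.internal l v) hy
    · simp only; omega
    · simp only; omega
  · rw [hI.W_eq] at hv
    rw [proj_of_mem_part hI.internal hv (by simpa using h)]
    simp

theorem B_proj [FiniteDimensional ℂ V] (hI : D.IsDeligneBigrading F I)
    (hS : D.FirstRelation F) {k r s : ℤ} (hrs : r + s = k) {v y : V} (hv : v ∈ D.W k)
    (hy : y ∈ I r s) (l : ℤ × ℤ) :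
    D.B k (proj hI.internal l v) y = if l = (s, r) then D.B k v y else 0 := by
  split_ifs with hl
  · obtain ⟨t, ht⟩ := exists_finset hI.internal
    conv_rhs => rw [← sum_proj hI.internal (s := insert l t) (x := v)
      (fun i hi => ht i fun h => hi (Finset.mem_insert_of_mem h))]
    rw [map_sum, LinearMap.sum_apply, Finset.sum_eq_single l]
    · exact fun j _ hj => hI.B_proj_eq_zero hS hrs hv hy (hl ▸ hj)
    · simp
  · exact hI.B_proj_eq_zero hS hrs hv hy hl

end IsDeligneBigrading

end Form

section LieAlgebra

variable {V : Type*} [NormedAddCommGroup V] [NormedSpace ℂ V] [Module ℚ V]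
  {D : GradedPolarizationData V}

theorem mem_lieGC_iff {α : V →L[ℂ] V} : α ∈ D.lieGC ↔ (∀ k, ∀ x ∈ D.W k, α x ∈ D.W k) ∧
    ∀ k, ∀ x ∈ D.W k, ∀ y ∈ D.W k, D.B k (α x) y + D.B k x (α y) = 0 := by
  constructor
  · rintro ⟨h1, h2⟩
    refine ⟨h1, fun k x hx y hy => ?_⟩
    rw [B_apply D (h1 k x hx) hy, B_apply D hx (h1 k y hy)]
    exact h2 k ⟨x, hx⟩ ⟨y, hy⟩
  · rintro ⟨h1, h2⟩
    refine ⟨h1, fun k x y => ?_⟩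
    have := h2 k x x.2 y y.2
    rwa [B_apply D (h1 k x x.2) y.2, B_apply D x.2 (h1 k y y.2)] at this

theorem lieGC_bracket {α β : V →L[ℂ] V} (hα : α ∈ D.lieGC) (hβ : β ∈ D.lieGC) :
    α * β - β * α ∈ D.lieGC := by
  rw [mem_lieGC_iff] at *
  refine ⟨fun k x hx => Submodule.sub_mem _ (hα.1 k _ (hβ.1 k x hx)) (hβ.1 k _ (hα.1 k x hx)),
    fun k x hx y hy => ?_⟩
  have h1 := hα.2 k _ (hβ.1 k x hx) y hy
  have h2 := hα.2 k x hx _ (hβ.1 k y hy)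
  have h3 := hβ.2 k _ (hα.1 k x hx) y hy
  have h4 := hβ.2 k x hx _ (hα.1 k y hy)
  simp only [sub_apply, mul_apply_eq_comp, map_sub,
    LinearMap.sub_apply]
  linear_combination h1 - h3 + h2 - h4

/-- The endomorphisms that lower the first index of the bigrading `I`. -/
def lowering (I : ℤ → ℤ → Submodule ℂ V) : Submodule ℂ (V →L[ℂ] V) where
  carrier := {α | ∀ p q, ∀ x ∈ I p q, α x ∈ part (pieces I) {rs | rs.1 < p}}
  add_mem' ha hb p q x hx := Submodule.add_mem _ (ha p q x hx) (hb p q x hx)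
  zero_mem' p q x _ := by simp
  smul_mem' c _ ha p q x hx := Submodule.smul_mem _ c (ha p q x hx)

/-- `Fil_p = ⊕_{r < p} I^{r,s}` is mapped to `Fil_{p-1}` by the lowering endomorphisms. -/
theorem lowering_apply_mem {I : ℤ → ℤ → Submodule ℂ V} {α : V →L[ℂ] V} (hα : α ∈ lowering I)
    {p : ℤ} {x : V} (hx : x ∈ part (pieces I) {rs | rs.1 < p}) :
    α x ∈ part (pieces I) {rs | rs.1 < p - 1} := by
  refine (part_le fun rs hrs y hy => ?_ : _ ≤ (part (pieces I) {rs | rs.1 < p - 1}).comap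
    (α : V →ₗ[ℂ] V)) hx
  refine part_mono (fun l hl => ?_) (hα rs.1 rs.2 y hy)
  simp only [Set.mem_ofPred_eq] at *
  omega

theorem mul_mem_lowering {I : ℤ → ℤ → Submodule ℂ V} {α β : V →L[ℂ] V} (hα : α ∈ lowering I)
    (hβ : β ∈ lowering I) : α * β ∈ lowering I := fun p q x hx =>
  part_mono (fun l hl => by simp only [Set.mem_ofPred_eq] at *; omega)
    (lowering_apply_mem hα (hβ p q x hx))

variable [FiniteDimensional ℂ V] {F : DecFiltration V} {I : ℤ → ℤ → Submodule ℂ V}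

/-- Each application lowers the first index by at least one, and only finitely many pieces are
nonzero. -/
theorem isNilpotent_of_mem_lowering (hI : D.IsDeligneBigrading F I) {α : V →L[ℂ] V}
    (hα : α ∈ lowering I) : IsNilpotent α := by
  obtain ⟨t, ht⟩ := exists_finset hI.internal
  obtain ⟨b, hb⟩ := (t.image Prod.fst).bddAbove
  obtain ⟨a, ha⟩ := (t.image Prod.fst).bddBelow
  have hb' : ∀ x : V, x ∈ part (pieces I) {rs | rs.1 < b + 1} := by
    intro x
    rw [mem_part_iff hI.internal]
    intro i hi
    have : i ∉ t := fun h => hi (by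
      have := hb (Finset.mem_image_of_mem Prod.fst h)
      simp only [Set.mem_ofPred_eq]
      omega)
    simpa [ht i this] using proj_mem hI.internal i x
  have ha' : part (pieces I) {rs | rs.1 < a} = ⊥ := by
    rw [eq_bot_iff]
    refine part_le fun i hi => ?_
    have : i ∉ t := fun h => by
      have := ha (Finset.mem_image_of_mem Prod.fst h)
      simp only [Set.mem_ofPred_eq] at hi
      omega
    rw [ht i this]
  have hn : ∀ n : ℕ, ∀ x : V, (α ^ n) x ∈ part (pieces I) {rs | rs.1 < b + 1 - n} := by
    intro n
    induction n with
    | zero => simpa using hb'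
    | succ n ih =>
      intro x
      rw [pow_succ', show b + 1 - ((n + 1 : ℕ) : ℤ) = b + 1 - n - 1 by push_cast; ring]
      exact lowering_apply_mem hα (ih x)
  -- The first indices of nonzero pieces lie between `a` and `b`, so this many steps push everything
  -- below `a`.
  refine ⟨(b + 1 - a).toNat, ?_⟩
  ext x
  have := part_mono (B := {rs | rs.1 < a}) (fun l hl => by
    simp only [Set.mem_ofPred_eq] at *; omega) (hn (b + 1 - a).toNat x)
  rw [ha'] at this
  simpa using this

/-- The component of bidegree `d` of an endomorphism. -/
def component (hI : D.IsDeligneBigrading F I) (d : ℤ × ℤ) (α : V →L[ℂ] V) : V →L[ℂ] V :=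
  LinearMap.toContinuousLinearMap (∑ i ∈ (exists_finset hI.internal).choose,
    proj hI.internal (i + d) ∘ₗ (α : V →ₗ[ℂ] V) ∘ₗ proj hI.internal i)

theorem component_apply (hI : D.IsDeligneBigrading F I) (d : ℤ × ℤ) (α : V →L[ℂ] V)
    {i : ℤ × ℤ} {x : V} (hx : x ∈ I i.1 i.2) :
    component hI d α x = proj hI.internal (i + d) (α x) := by
  have ht := (exists_finset hI.internal).choose_spec
  rw [component]
  simp only [LinearMap.coe_toContinuousLinearMap', LinearMap.sum_apply, LinearMap.comp_apply]
  by_cases hi : i ∈ (exists_finset hI.internal).choose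
  · rw [Finset.sum_eq_single i]
    · rw [proj_of_mem hI.internal hx]
      rfl
    · intro j _ hj
      rw [proj_of_mem_of_ne hI.internal hj hx]
      simp
    · exact fun h => absurd hi h
  · have h0 : x = 0 := by
      have := ht i hi
      simp only [pieces] at this
      simpa [this] using hx
    simp [h0]

theorem component_eq_zero (hI : D.IsDeligneBigrading F I) {d : ℤ × ℤ} {α : V →L[ℂ] V}
    (h : ∀ i : ℤ × ℤ, ∀ x ∈ I i.1 i.2, proj hI.internal (i + d) (α x) = 0) :
    component hI d α = 0 := by
  apply ContinuousLinearMap.coe_injective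
  exact ext_of_pieces hI.internal fun i x hx => (component_apply hI d α hx).trans (h i x hx)

/-- The infinitesimal isometry relation is homogeneous. In weight `k`, the term with `α x` sees the
component of bidegree `d` exactly when the term with `α y` does, because `S_k` pairs `(p,q)` only
with `(q,p)`. -/
theorem component_mem_lieGC (hI : D.IsDeligneBigrading F I) (hS : D.FirstRelation F)
    (d : ℤ × ℤ) {α : V →L[ℂ] V} (hα : α ∈ D.lieGC) : component hI d α ∈ D.lieGC := by
  rw [mem_lieGC_iff] at hα ⊢
  have hW : ∀ k, ∀ x ∈ D.W k, component hI d α x ∈ D.W k := by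
    intro k x hx
    rw [hI.W_eq] at hx
    refine (part_le fun i hi y hy => ?_ : _ ≤ (D.W k).comap
      (component hI d α : V →ₗ[ℂ] V)) hx
    change component hI d α y ∈ D.W k
    rw [component_apply hI d α hy]
    have h1 := hα.1 _ y (hI.le_W _ _ hy)
    refine D.W_mono (show i.1 + i.2 ≤ k from hi) ?_
    -- A component that raises the weight is zero, because `α` preserves `W`.
    by_cases hd : d.1 + d.2 ≤ 0
    · refine D.W_mono ?_ (hI.le_W _ _ (proj_mem hI.internal (i + d) (α y)))
      simp only [Prod.fst_add, Prod.snd_add]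
      omega
    · rw [hI.W_eq] at h1
      rw [proj_of_mem_part hI.internal h1]
      · exact Submodule.zero_mem _
      · simp only [Prod.fst_add, Prod.snd_add, Set.mem_ofPred_eq]
        omega
  refine ⟨hW, fun k x hx y hy => ?_⟩
  have hx' := hx
  have hy' := hy
  rw [hI.W_eq] at hx' hy'
  revert y
  suffices D.W k ≤ LinearMap.ker
      (((D.B k (component hI d α x)) : V →ₗ[ℂ] ℂ) + (D.B k x) ∘ₗ
        (component hI d α : V →ₗ[ℂ] V)) from fun y hy _ => this hy
  conv_lhs => rw [hI.W_eq]
  refine part_le fun j hj y hy => ?_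
  have hyW := D.W_mono (show j.1 + j.2 ≤ k from hj) (hI.le_W _ _ hy)
  change D.B k (component hI d α x) y + D.B k x (component hI d α y) = 0
  suffices part (pieces I) {rs | rs.1 + rs.2 ≤ k} ≤ LinearMap.ker
      (((D.B k).flip y : V →ₗ[ℂ] ℂ) ∘ₗ (component hI d α : V →ₗ[ℂ] V) +
        (D.B k).flip (component hI d α y)) from this hx'
  refine part_le fun i hi x hx => ?_
  have hxW := D.W_mono (show i.1 + i.2 ≤ k from hi) (hI.le_W _ _ hx)
  change D.B k (component hI d α x) y + D.B k x (component hI d α y) = 0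
  simp only [Set.mem_ofPred_eq] at hi hj
  rcases hi.lt_or_eq with hi | hi
  · have h1 := D.W_mono (show i.1 + i.2 ≤ k - 1 by omega) (hI.le_W _ _ hx)
    rw [B_left_eq_zero (hW _ _ h1) hyW, B_left_eq_zero h1 (hW _ _ hyW), add_zero]
  rcases hj.lt_or_eq with hj | hj
  · have h1 := D.W_mono (show j.1 + j.2 ≤ k - 1 by omega) (hI.le_W _ _ hy)
    rw [B_right_eq_zero (hW _ _ hxW) h1, B_right_eq_zero hxW (hW _ _ h1), add_zero]
  have hαx := hα.1 _ _ hxW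
  have hαy := hα.1 _ _ hyW
  rw [B_symm hxW (hW _ _ hyW), component_apply hI d α hx, component_apply hI d α hy,
    hI.B_proj hS hj hαx hy, hI.B_proj hS hi hαy hx]
  have hiff : i + d = (j.2, j.1) ↔ j + d = (i.2, i.1) := by
    simp only [Prod.ext_iff, Prod.fst_add, Prod.snd_add]
    omega
  simp only [hiff]
  split_ifs
  · rw [← B_symm hxW hαy]
    exact hα.2 k x hxW y hyW
  · simp

theorem mem_of_component_mem (hI : D.IsDeligneBigrading F I) {P : Submodule ℂ (V →L[ℂ] V)}
    {α : V →L[ℂ] V} (h : ∀ d, component hI d α ∈ P) : α ∈ P := by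
  have ht := (exists_finset hI.internal).choose_spec
  set t := (exists_finset hI.internal).choose
  -- The differences between indices of nonzero pieces are the only bidegrees that can occur.
  set Δ : Finset (ℤ × ℤ) := (t ×ˢ t).image fun ij => ij.2 - ij.1
  suffices α = ∑ d ∈ Δ, component hI d α by
    rw [this]
    exact Submodule.sum_mem _ fun d _ => h d
  apply ContinuousLinearMap.coe_injective
  refine ext_of_pieces hI.internal fun i x hx => ?_
  simp only [ContinuousLinearMap.coe_coe, sum_apply]
  simp only [component_apply hI _ α hx]
  by_cases hi : i ∈ t
  · conv_lhs => rw [← sum_proj hI.internal (s := Δ.image (i + ·)) (x := α x)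
      (fun j hj => ht j fun hjt => hj (Finset.mem_image.2 ⟨j - i, Finset.mem_image.2
        ⟨(i, j), by simp [hi, hjt], rfl⟩, by simp⟩))]
    rw [Finset.sum_image (fun a _ b _ e => add_left_cancel e)]
  · have h0 : x = 0 := by
      have := ht i hi
      simp only [pieces] at this hx
      simpa [this] using hx
    simp [h0]

end LieAlgebra

end GradedPolarizationData


/-! ### The structure of `q_F` and a complement of the stabilizer of `F`. -/

namespace GradedPolarizationData

open BigradedSum OpposedFiltrations

variable {V : Type*} [NormedAddCommGroup V] [NormedSpace ℂ V] [Module ℚ V]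
  {D : GradedPolarizationData V} [FiniteDimensional ℂ V] {F : DecFiltration V}

/-- Lowering allows only components with `r < 0`, preservation of `W` only those with `r + s ≤ 0`,
and these components stay in `Lie(G_ℂ)`. This description replaces the sum of pieces in all later
arguments. -/
theorem q_eq (hI : D.IsDeligneBigrading F (D.I F)) (hS : D.FirstRelation F) :
    D.q F = lowering (D.I F) ⊓ D.lieGC := by
  apply le_antisymm
  · refine iSup₂_le fun r s => iSup₂_le fun hr _ => inf_le_inf_right _ ?_
    refine fun α hα p q x hx => ?_
    refine le_part (J := pieces (D.I F)) (i := (p + r, q + s)) ?_ (hα p q x hx)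
    simp only [Set.mem_ofPred_eq]
    omega
  · rintro α ⟨hα, hαL⟩
    refine mem_of_component_mem hI fun d => ?_
    by_cases h1 : d.1 < 0
    · by_cases h2 : d.1 + d.2 ≤ 0
      · refine Submodule.mem_iSup_of_mem d.1 (Submodule.mem_iSup_of_mem d.2
          (Submodule.mem_iSup_of_mem h1 (Submodule.mem_iSup_of_mem h2
            ⟨fun p q x hx => ?_, component_mem_lieGC hI hS d hαL⟩)))
        rw [component_apply hI d α (i := (p, q)) hx]
        exact proj_mem hI.internal ((p, q) + d) _
      · rw [component_eq_zero hI fun i x hx => ?_]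
        · exact Submodule.zero_mem _
        · have := (mem_lieGC_iff.1 hαL).1 _ _ (hI.le_W _ _ hx)
          rw [hI.W_eq] at this
          refine proj_of_mem_part hI.internal this ?_
          simp only [Set.mem_ofPred_eq, Prod.fst_add, Prod.snd_add]
          omega
    · rw [component_eq_zero hI fun i x hx => ?_]
      · exact Submodule.zero_mem _
      · refine proj_of_mem_part hI.internal (hα _ _ x hx) ?_
        simp only [Set.mem_ofPred_eq, Prod.fst_add]
        omega

/-- The hypothesis on `F` excludes `r < -1` and membership in `q_F` excludes `r ≥ 0`; for `r = -1`,
the condition `r + s ≤ 0` reads `s ≤ 1`. -/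
theorem mem_horizontal (hI : D.IsDeligneBigrading F (D.I F)) (hS : D.FirstRelation F)
    {α : V →L[ℂ] V} (hα : α ∈ D.q F) (hF : ∀ p, ∀ x ∈ F p, α x ∈ F (p - 1)) :
    α ∈ D.horizontal F := by
  rw [q_eq hI hS] at hα
  refine mem_of_component_mem hI fun d => ?_
  by_cases h : d.1 = -1 ∧ d.2 ≤ 1
  · refine Submodule.mem_iSup_of_mem d.2 (Submodule.mem_iSup_of_mem h.2
      ⟨fun p q x hx => ?_, component_mem_lieGC hI hS d hα.2⟩)
    rw [component_apply hI d α (i := (p, q)) hx]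
    have := proj_mem hI.internal ((p, q) + d) (α x)
    simpa [pieces, h.1] using this
  · rw [component_eq_zero hI fun i x hx => ?_]
    · exact Submodule.zero_mem _
    · by_cases h1 : d.1 < 0
      · by_cases h2 : d.1 < -1
        · have := hF _ _ (hI.le_F _ _ hx)
          rw [hI.F_eq] at this
          refine proj_of_mem_part hI.internal this ?_
          simp only [Set.mem_ofPred_eq, Prod.fst_add]
          omega
        · have := (mem_lieGC_iff.1 hα.2).1 _ _ (hI.le_W _ _ hx)
          rw [hI.W_eq] at this
          refine proj_of_mem_part hI.internal this ?_
          simp only [Set.mem_ofPred_eq, Prod.fst_add, Prod.snd_add]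
          omega
      · refine proj_of_mem_part hI.internal (hα.1 _ _ x hx) ?_
        simp only [Set.mem_ofPred_eq, Prod.fst_add]
        omega

theorem iSupIndep_g (hI : D.IsDeligneBigrading F (D.I F)) :
    iSupIndep (fun rs : ℤ × ℤ => D.g F rs.1 rs.2) := by
  rw [iSupIndep_def]
  intro d
  rw [Submodule.disjoint_def]
  intro α hα hα'
  apply ContinuousLinearMap.coe_injective
  refine ext_of_pieces hI.internal fun i x hx => ?_
  have h1 : α x ∈ part (pieces (D.I F)) {i + d} := by
    rw [part_singleton]
    exact hα.1 _ _ x hx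
  have h2 : α x ∈ part (pieces (D.I F)) {i + d}ᶜ := by
    refine (iSup₂_le fun e he β hβ => ?_ : (⨆ (e : ℤ × ℤ) (_ : e ≠ d), D.g F e.1 e.2) ≤
      (part (pieces (D.I F)) {i + d}ᶜ).comap
        (ContinuousLinearMap.apply ℂ V x : (V →L[ℂ] V) →ₗ[ℂ] V)) hα'
    refine le_part (J := pieces (D.I F)) (i := i + e) ?_ (hβ.1 _ _ x hx)
    simpa using he
  have := part_inf hI.internal {i + d} {i + d}ᶜ ▸ Submodule.mem_inf.2 ⟨h1, h2⟩
  rw [Set.inter_compl_self, part_empty] at this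
  simpa using this

attribute [local instance 100] LieRing.ofAssociativeRing

theorem isNilpotentLieSubalgebra_q (hI : D.IsDeligneBigrading F (D.I F))
    (hS : D.FirstRelation F) : IsNilpotentLieSubalgebra (D.q F) := by
  let L : LieSubalgebra ℂ (V →L[ℂ] V) :=
    { D.q F with
      lie_mem' := by
        intro α β hα hβ
        change α ∈ D.q F at hα
        change β ∈ D.q F at hβ
        change ⁅α, β⁆ ∈ D.q F
        rw [q_eq hI hS] at *
        rw [Ring.lie_def]
        exact ⟨Submodule.sub_mem _ (mul_mem_lowering hα.1 hβ.1) (mul_mem_lowering hβ.1 hα.1),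
          lieGC_bracket hα.2 hβ.2⟩ }
  refine ⟨L, rfl, ?_⟩
  have : LieRing.IsNilpotent L := by
    -- Engel's theorem: it is enough that each `ad x` is nilpotent, which follows from the
    -- nilpotency of the endomorphism `x`.
    rw [LieAlgebra.isNilpotent_iff_forall (R := ℂ)]
    intro x
    refine LieAlgebra.isNilpotent_ad_of_isNilpotent (L := L) ?_
    have hx : (x : V →L[ℂ] V) ∈ D.q F := x.2
    rw [q_eq hI hS] at hx
    exact isNilpotent_of_mem_lowering hI hx.1
  exact this

/-- The endomorphisms that preserve the filtration `F`. -/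
def stabilizer (F : DecFiltration V) : Submodule ℂ (V →L[ℂ] V) where
  carrier := {α | ∀ p, ∀ x ∈ F p, α x ∈ F p}
  add_mem' ha hb p x hx := Submodule.add_mem _ (ha p x hx) (hb p x hx)
  zero_mem' p x _ := by simp
  smul_mem' c _ ha p x hx := Submodule.smul_mem _ c (ha p x hx)

variable {I : ℤ → ℤ → Submodule ℂ V}

theorem F_inf_part_eq_bot (hI : D.IsDeligneBigrading F I) (p : ℤ) :
    F p ⊓ part (pieces I) {rs | rs.1 < p} = ⊥ := by
  rw [hI.F_eq, part_inf hI.internal, ← part_empty (pieces I)]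
  congr 1
  ext i
  simp only [Set.mem_inter_iff, Set.mem_ofPred_eq, Set.mem_empty_iff_false, iff_false, not_and,
    not_lt]
  exact id

theorem eq_zero_of_mem_lowering_of_mem_stabilizer (hI : D.IsDeligneBigrading F I)
    {α : V →L[ℂ] V} (h1 : α ∈ lowering I) (h2 : α ∈ stabilizer F) : α = 0 := by
  apply ContinuousLinearMap.coe_injective
  refine ext_of_pieces hI.internal fun i x hx => ?_
  have : α x ∈ F i.1 ⊓ part (pieces I) {rs | rs.1 < i.1} :=
    ⟨h2 _ _ (hI.le_F _ _ hx), h1 _ _ _ hx⟩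
  rw [F_inf_part_eq_bot hI] at this
  simpa using this

/-- Components with `r < 0` are lowering and those with `r ≥ 0` preserve `F`. So `lowering I` models
the tangent space at `F` of the flag variety. -/
theorem isCompl_lowering_stabilizer (hI : D.IsDeligneBigrading F I) :
    IsCompl (lowering I) (stabilizer F) := by
  constructor
  · rw [Submodule.disjoint_def]
    exact fun α h1 h2 => eq_zero_of_mem_lowering_of_mem_stabilizer hI h1 h2
  · rw [codisjoint_iff, eq_top_iff]
    intro α _
    refine mem_of_component_mem hI fun d => ?_
    by_cases hd : d.1 < 0
    · refine Submodule.mem_sup_left fun p q x hx => ?_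
      rw [component_apply hI d α (i := (p, q)) hx]
      refine le_part (J := pieces I) (i := (p, q) + d) ?_ (proj_mem hI.internal ((p, q) + d) (α x))
      simp only [Set.mem_ofPred_eq, Prod.fst_add]
      omega
    · refine Submodule.mem_sup_right fun p x hx => ?_
      rw [hI.F_eq] at hx ⊢
      refine (part_le fun i hi y hy => ?_ : _ ≤ (part (pieces I) {rs | p ≤ rs.1}).comap
        (component hI d α : V →ₗ[ℂ] V)) hx
      change component hI d α y ∈ part (pieces I) {rs | p ≤ rs.1}
      rw [component_apply hI d α hy]
      refine le_part (J := pieces I) (i := i + d) ?_ (proj_mem hI.internal (i + d) (α y))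
      simp only [Set.mem_ofPred_eq, Prod.fst_add] at hi ⊢
      omega

end GradedPolarizationData


/-! ### Exponentials of endomorphisms. -/

namespace EndExp

variable {V : Type*} [NormedAddCommGroup V] [NormedSpace ℂ V] [FiniteDimensional ℂ V]

theorem exp_add {u v : V →L[ℂ] V} (h : Commute u v) :
    NormedSpace.exp (u + v) = NormedSpace.exp u * NormedSpace.exp v := by
  let _ : NormedAlgebra ℚ (V →L[ℂ] V) := NormedAlgebra.restrictScalars ℚ ℂ _
  exact NormedSpace.exp_add_of_commute h

theorem exp_neg_mul (u : V →L[ℂ] V) : NormedSpace.exp (-u) * NormedSpace.exp u = 1 := by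
  rw [← exp_add (Commute.neg_left (Commute.refl u)), neg_add_cancel, NormedSpace.exp_zero]

theorem exp_mul_neg (u : V →L[ℂ] V) : NormedSpace.exp u * NormedSpace.exp (-u) = 1 := by
  rw [← exp_add (Commute.neg_right (Commute.refl u)), add_neg_cancel, NormedSpace.exp_zero]

theorem exp_neg_apply (u : V →L[ℂ] V) (x : V) :
    NormedSpace.exp (-u) (NormedSpace.exp u x) = x :=
  DFunLike.congr_fun (exp_neg_mul u) x

theorem exp_apply_neg (u : V →L[ℂ] V) (x : V) :
    NormedSpace.exp u (NormedSpace.exp (-u) x) = x :=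
  DFunLike.congr_fun (exp_mul_neg u) x

theorem exp_natCast_smul (n : ℕ) (u : V →L[ℂ] V) :
    NormedSpace.exp ((n : ℂ) • u) = NormedSpace.exp u ^ n := by
  let _ : NormedAlgebra ℚ (V →L[ℂ] V) := NormedAlgebra.restrictScalars ℚ ℂ _
  rw [Nat.cast_smul_eq_nsmul, NormedSpace.exp_nsmul]

/-- `exp u` as a unit. -/
def expUnit (u : V →L[ℂ] V) : (V →L[ℂ] V)ˣ :=
  ⟨NormedSpace.exp u, NormedSpace.exp (-u), exp_mul_neg u, exp_neg_mul u⟩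

/-- `exp u` as a linear automorphism. -/
def expEquiv (u : V →L[ℂ] V) : V ≃ₗ[ℂ] V :=
  LinearEquiv.ofLinearMap (NormedSpace.exp u : V →L[ℂ] V) (NormedSpace.exp (-u) : V →L[ℂ] V)
    (LinearMap.ext (exp_apply_neg u)) (LinearMap.ext (exp_neg_apply u))

theorem hasSum_exp_apply (u : V →L[ℂ] V) (x : V) :
    HasSum (fun n : ℕ => ((n.factorial : ℂ))⁻¹ • (u ^ n) x) (NormedSpace.exp u x) :=
  (NormedSpace.exp_series_hasSum_exp' (𝕂 := ℂ) u).mapL (ContinuousLinearMap.apply ℂ V x)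

theorem pow_apply_mem {u : V →L[ℂ] V} {P : Submodule ℂ V} (hu : ∀ x ∈ P, u x ∈ P) (n : ℕ) {x : V}
    (hx : x ∈ P) : (u ^ n) x ∈ P := by
  induction n with
  | zero => simpa using hx
  | succ n ih => rw [pow_succ']; exact hu _ ih

/-- After removal of the constant term, the exponential series has all its terms in the closed
subspace `P`, even if `x` itself is outside `P`. -/
theorem exp_apply_sub_mem {u : V →L[ℂ] V} {P : Submodule ℂ V} (hu : ∀ x ∈ P, u x ∈ P) {x : V}
    (hx : u x ∈ P) : NormedSpace.exp u x - x ∈ P := by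
  have h := (hasSum_nat_add_iff' 1).2 (hasSum_exp_apply u x)
  simp only [Finset.sum_range_one, Nat.factorial_zero, Nat.cast_one, inv_one, pow_zero, one_smul,
    one_apply_eq_self] at h
  refine (Submodule.closed_of_finiteDimensional P).mem_of_tendsto h
    (Filter.Eventually.of_forall fun s => Submodule.sum_mem _ fun n _ => Submodule.smul_mem _ _ ?_)
  rw [pow_succ]
  exact pow_apply_mem hu n hx

theorem exp_apply_mem {u : V →L[ℂ] V} {P : Submodule ℂ V} (hu : ∀ x ∈ P, u x ∈ P) {x : V}
    (hx : x ∈ P) : NormedSpace.exp u x ∈ P := by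
  simpa using Submodule.add_mem _ (exp_apply_sub_mem hu (hu x hx)) hx

theorem hasDerivAt_exp_smul_apply (u : V →L[ℂ] V) (x : V) (t : ℂ) :
    HasDerivAt (fun t : ℂ => NormedSpace.exp (t • u) x) (u (NormedSpace.exp (t • u) x)) t := by
  have := (ContinuousLinearMap.apply ℂ V x).hasFDerivAt.comp_hasDerivAt t
    (hasDerivAt_exp_smul_const' (𝕂 := ℂ) u t)
  exact this

theorem hasDerivAt_bilin (β : V →ₗ[ℂ] V →ₗ[ℂ] ℂ) (u : V →L[ℂ] V) (x y : V) (t : ℂ) :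
    HasDerivAt (fun t : ℂ => β (NormedSpace.exp (t • u) x) (NormedSpace.exp (t • u) y))
      (β (u (NormedSpace.exp (t • u) x)) (NormedSpace.exp (t • u) y) +
        β (NormedSpace.exp (t • u) x) (u (NormedSpace.exp (t • u) y))) t := by
  have h := (LinearMap.toContinuousBilinearMap β).hasFDerivAt_of_bilinear
    (hasDerivAt_exp_smul_apply u x t).hasFDerivAt (hasDerivAt_exp_smul_apply u y t).hasFDerivAt
  have h' := h.hasDerivAt
  refine h'.congr_deriv ?_
  simp [add_comm]

/-- If `u` is nilpotent, then `exp (t u)` is polynomial in `t`. -/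
theorem exists_exp_smul_eq_sum {u : V →L[ℂ] V} (hu : IsNilpotent u) :
    ∃ N : ℕ, ∃ a : ℕ → V →L[ℂ] V, ∀ t : ℂ,
      NormedSpace.exp (t • u) = ∑ n ∈ Finset.range N, t ^ n • a n := by
  obtain ⟨N, hN⟩ := hu
  refine ⟨N, fun n => ((n.factorial : ℂ))⁻¹ • u ^ n, fun t => ?_⟩
  refine (NormedSpace.exp_series_hasSum_exp' (𝕂 := ℂ) (t • u)).unique ?_
  have : (fun n : ℕ => ((n.factorial : ℂ))⁻¹ • (t • u) ^ n) =
      fun n => t ^ n • ((n.factorial : ℂ))⁻¹ • u ^ n := by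
    funext n
    rw [smul_pow, smul_comm]
  rw [this]
  refine hasSum_sum_of_ne_finset_zero fun n hn => ?_
  have : u ^ n = 0 := pow_eq_zero_of_le (by simpa using hn) hN
  simp [this]

theorem const_of_polynomial (P : Polynomial ℂ) (c : ℂ) (h : ∀ n : ℕ, P.eval (n : ℂ) = c) (t : ℂ) :
    P.eval t = c := by
  have : P - Polynomial.C c = 0 := by
    refine Polynomial.eq_zero_of_infinite_isRoot _ ((Set.infinite_range_of_injective
      (Nat.cast_injective (R := ℂ))).mono ?_)
    rintro _ ⟨n, rfl⟩
    simp [h n]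
  rw [sub_eq_zero.1 this, Polynomial.eval_C]

/-- The powers of `exp u` preserve `P`, so a functional that kills `P` gives a polynomial in `t`
that vanishes at all natural numbers. It is then zero, and its derivative at `t = 0` is the claim.
-/
theorem apply_mem_of_exp_apply_mem {u : V →L[ℂ] V} (hu : IsNilpotent u) {P : Submodule ℂ V}
    (h : ∀ x ∈ P, NormedSpace.exp u x ∈ P) : ∀ x ∈ P, u x ∈ P := by
  intro x hx
  obtain ⟨N, a, ha⟩ := exists_exp_smul_eq_sum hu
  rw [← Submodule.Quotient.mk_eq_zero, ← Module.forall_dual_apply_eq_zero_iff ℂ]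
  intro φ
  set ℓ : V →L[ℂ] ℂ := LinearMap.toContinuousLinearMap (φ ∘ₗ P.mkQ) with hℓ
  have hpoly : ∀ t : ℂ, ℓ (NormedSpace.exp (t • u) x) =
      (∑ n ∈ Finset.range N, Polynomial.C (ℓ (a n x)) * Polynomial.X ^ n).eval t := by
    intro t
    simp only [ha t, sum_apply, map_sum, Polynomial.eval_finsetSum, smul_apply, map_smul,
      smul_eq_mul, Polynomial.eval_mul, Polynomial.eval_C, Polynomial.eval_pow, Polynomial.eval_X]
    exact Finset.sum_congr rfl fun n _ => mul_comm _ _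
  have hz : ∀ t : ℂ, ℓ (NormedSpace.exp (t • u) x) = 0 := by
    intro t
    rw [hpoly]
    refine const_of_polynomial _ 0 (fun n => ?_) t
    rw [← hpoly, exp_natCast_smul]
    have : (NormedSpace.exp u ^ n) x ∈ P := pow_apply_mem h n hx
    have : P.mkQ ((NormedSpace.exp u ^ n) x) = 0 := (Submodule.Quotient.mk_eq_zero P).2 this
    simp only [hℓ, LinearMap.coe_toContinuousLinearMap', LinearMap.comp_apply, this, map_zero]
  have hd := ℓ.hasFDerivAt.comp_hasDerivAt 0 (hasDerivAt_exp_smul_apply u x 0)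
  have hd' : HasDerivAt (⇑ℓ ∘ fun t : ℂ => NormedSpace.exp (t • u) x) 0 0 := by
    have : (⇑ℓ ∘ fun t : ℂ => NormedSpace.exp (t • u) x) = fun _ => 0 := funext hz
    rw [this]
    exact hasDerivAt_const _ _
  have := hd.unique hd'
  rw [zero_smul, NormedSpace.exp_zero] at this
  exact this

/-- As in `apply_mem_of_exp_apply_mem`: invariance under the powers of `exp u` extends to all
`exp(tu)` by polynomiality, and is then differentiated. -/
theorem bilin_of_exp {u : V →L[ℂ] V} (hu : IsNilpotent u) (β : V →ₗ[ℂ] V →ₗ[ℂ] ℂ)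
    {P : Submodule ℂ V} (hP : ∀ x ∈ P, NormedSpace.exp u x ∈ P)
    (h : ∀ x ∈ P, ∀ y ∈ P, β (NormedSpace.exp u x) (NormedSpace.exp u y) = β x y) :
    ∀ x ∈ P, ∀ y ∈ P, β (u x) y + β x (u y) = 0 := by
  intro x hx y hy
  obtain ⟨N, a, ha⟩ := exists_exp_smul_eq_sum hu
  have hpoly : ∀ t : ℂ, β (NormedSpace.exp (t • u) x) (NormedSpace.exp (t • u) y) =
      (∑ n ∈ Finset.range N, ∑ m ∈ Finset.range N,
        Polynomial.C (β (a n x) (a m y)) * Polynomial.X ^ (n + m)).eval t := by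
    intro t
    simp only [ha t, sum_apply, map_sum, LinearMap.sum_apply, Polynomial.eval_finsetSum,
      smul_apply, map_smul, LinearMap.smul_apply, smul_eq_mul,
      Polynomial.eval_mul, Polynomial.eval_C, Polynomial.eval_pow, Polynomial.eval_X, pow_add]
    simp only [Finset.mul_sum]
    rw [Finset.sum_comm]
    exact Finset.sum_congr rfl fun n _ => Finset.sum_congr rfl fun m _ => by ring
  have hz : ∀ t : ℂ, β (NormedSpace.exp (t • u) x) (NormedSpace.exp (t • u) y) = β x y := by
    intro t
    rw [hpoly]
    refine const_of_polynomial _ _ (fun n => ?_) t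
    rw [← hpoly, exp_natCast_smul]
    induction n with
    | zero => simp
    | succ n ih =>
      rw [← ih, pow_succ']
      exact h _ (pow_apply_mem hP n hx) _ (pow_apply_mem hP n hy)
  have hd := hasDerivAt_bilin β u x y 0
  have hd' : HasDerivAt (fun t : ℂ => β (NormedSpace.exp (t • u) x) (NormedSpace.exp (t • u) y))
      0 0 := by
    rw [funext hz]
    exact hasDerivAt_const _ _
  have := hd.unique hd'
  simpa [NormedSpace.exp_zero] using this

theorem bilin_exp (β : V →ₗ[ℂ] V →ₗ[ℂ] ℂ) {u : V →L[ℂ] V} {P : Submodule ℂ V}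
    (hP : ∀ x ∈ P, u x ∈ P) (h : ∀ x ∈ P, ∀ y ∈ P, β (u x) y + β x (u y) = 0) :
    ∀ x ∈ P, ∀ y ∈ P, β (NormedSpace.exp u x) (NormedSpace.exp u y) = β x y := by
  intro x hx y hy
  have hd := hasDerivAt_bilin β u x y
  have hmem : ∀ t : ℂ, ∀ z ∈ P, NormedSpace.exp (t • u) z ∈ P := fun t z hz =>
    exp_apply_mem (fun w hw => Submodule.smul_mem _ t (hP w hw)) hz
  have := is_const_of_deriv_eq_zero (fun t => (hd t).differentiableAt)
    (fun t => (hd t).deriv.trans (h _ (hmem t x hx) _ (hmem t y hy))) 1 0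
  simpa [NormedSpace.exp_zero] using this

end EndExp

/-! ### Dimension formulas and the compact dual. -/

namespace GradedPolarizationData

open BigradedSum OpposedFiltrations EndExp

section Dim

variable {V : Type*} [AddCommGroup V] [Module ℂ V] [Module ℚ V] {D : GradedPolarizationData V}
  [FiniteDimensional ℂ V] {F : DecFiltration V} {I : ℤ → ℤ → Submodule ℂ V}

/-- Rank and nullity of the map from `F^p ∩ W_k` to `Gr^W_k`. It makes the dimensions of `F^p
Gr^W_k` and those of `F^p ∩ W_k` determine each other. -/
theorem finrank_F_inf_W (F : DecFiltration V) (p k : ℤ) :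
    Module.finrank ℂ ↥(F p ⊓ D.W k) =
      Module.finrank ℂ (D.grF F k p) + Module.finrank ℂ ↥(F p ⊓ D.W (k - 1)) := by
  set φ : ↥(F p ⊓ D.W k) →ₗ[ℂ] GrW D.W k :=
    GrW.mk D.W k ∘ₗ Submodule.inclusion inf_le_right with hφ
  rw [← φ.finrank_range_add_finrank_ker]
  have h1 : LinearMap.range φ = D.grF F k p := by
    ext x
    constructor
    · rintro ⟨y, rfl⟩
      exact ⟨Submodule.inclusion inf_le_right y, y.2.1, rfl⟩
    · rintro ⟨y, hy, rfl⟩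
      exact ⟨⟨y, hy, y.2⟩, rfl⟩
  have h2 : (LinearMap.ker φ).map (F p ⊓ D.W k).subtype = F p ⊓ D.W (k - 1) := by
    ext x
    constructor
    · rintro ⟨y, hy, rfl⟩
      exact ⟨y.2.1, mk_eq_zero_iff.1 hy⟩
    · rintro ⟨hx, hxW⟩
      exact ⟨⟨x, hx, D.W_mono (by omega) hxW⟩, mk_eq_zero_iff.2 hxW, rfl⟩
  rw [h1, ← Submodule.finrank_map_subtype_eq _ (LinearMap.ker φ), h2]

theorem finrank_grF_congr {F F' : DecFiltration V}
    (h : ∀ p k, Module.finrank ℂ ↥(F p ⊓ D.W k) = Module.finrank ℂ ↥(F' p ⊓ D.W k)) (p k : ℤ) :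
    Module.finrank ℂ (D.grF F k p) = Module.finrank ℂ (D.grF F' k p) := by
  have h1 := finrank_F_inf_W (D := D) F p k
  have h2 := finrank_F_inf_W (D := D) F' p k
  rw [h, h p (k - 1)] at h1
  omega

theorem finrank_F_inf_W_congr {F F' : DecFiltration V}
    (h : ∀ p k, Module.finrank ℂ (D.grF F k p) = Module.finrank ℂ (D.grF F' k p)) (p k : ℤ) :
    Module.finrank ℂ ↥(F p ⊓ D.W k) = Module.finrank ℂ ↥(F' p ⊓ D.W k) := by
  obtain ⟨k₀, hk₀⟩ := D.W_bot
  suffices ∀ n : ℕ, ∀ k, k ≤ k₀ + n →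
      Module.finrank ℂ ↥(F p ⊓ D.W k) = Module.finrank ℂ ↥(F' p ⊓ D.W k) from
    this (k - k₀).toNat k (by omega)
  intro n
  induction n with
  | zero =>
    intro k hk
    rw [W_eq_bot_of_le D.W_mono hk₀ (by simpa using hk), inf_bot_eq, inf_bot_eq]
  | succ n ih =>
    intro k hk
    rw [finrank_F_inf_W, finrank_F_inf_W F', h, ih (k - 1) (by push_cast at hk; omega)]

namespace IsDeligneBigrading

/-- Inclusion and exclusion: the indices of `F^p ∩ W_{p+q}` are `(p,q)` together with those of
`F^{p+1} ∩ W_{p+q}` and of `F^p ∩ W_{p+q-1}`. -/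
theorem finrank_I (hI : D.IsDeligneBigrading F I) (p q : ℤ) :
    Module.finrank ℂ (I p q) + Module.finrank ℂ ↥(F (p + 1) ⊓ D.W (p + q)) +
        Module.finrank ℂ ↥(F p ⊓ D.W (p + q - 1)) =
      Module.finrank ℂ ↥(F p ⊓ D.W (p + q)) +
        Module.finrank ℂ ↥(F (p + 1) ⊓ D.W (p + q - 1)) := by
  rw [hI.F_inf_W_eq, hI.F_inf_W_eq, hI.F_inf_W_eq, hI.F_inf_W_eq]
  set A : Set (ℤ × ℤ) := {rs | p + 1 ≤ rs.1 ∧ rs.1 + rs.2 ≤ p + q}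
  set A' : Set (ℤ × ℤ) := {rs | p ≤ rs.1 ∧ rs.1 + rs.2 ≤ p + q - 1}
  have h1 := Submodule.finrank_sup_add_finrank_inf_eq (part (pieces I) A) (part (pieces I) A')
  have h2 := Submodule.finrank_sup_add_finrank_inf_eq (part (pieces I) {(p, q)})
    (part (pieces I) (A ∪ A'))
  rw [part_sup, part_inf hI.internal] at h1 h2
  rw [show ({(p, q)} : Set (ℤ × ℤ)) ∩ (A ∪ A') = ∅ by
    ext i
    simp only [A, A', Set.mem_inter_iff, Set.mem_singleton_iff, Set.mem_union, Set.mem_ofPred_eq,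
      Set.mem_empty_iff_false, iff_false, Prod.ext_iff]
    omega,
    show ({(p, q)} : Set (ℤ × ℤ)) ∪ (A ∪ A') = {rs | p ≤ rs.1 ∧ rs.1 + rs.2 ≤ p + q} by
    ext i
    simp only [A, A', Set.mem_singleton_iff, Set.mem_union, Set.mem_ofPred_eq, Prod.ext_iff]
    omega, part_empty, finrank_bot, part_singleton] at h2
  rw [show A ∩ A' = {rs | p + 1 ≤ rs.1 ∧ rs.1 + rs.2 ≤ p + q - 1} by
    ext i
    simp only [A, A', Set.mem_inter_iff, Set.mem_ofPred_eq]
    omega] at h1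
  change _ = Module.finrank ℂ (I p q) + _ at h2
  omega

theorem finrank_I_congr {F' : DecFiltration V} {I' : ℤ → ℤ → Submodule ℂ V}
    (hI : D.IsDeligneBigrading F I) (hI' : D.IsDeligneBigrading F' I')
    (h : ∀ p k, Module.finrank ℂ ↥(F p ⊓ D.W k) = Module.finrank ℂ ↥(F' p ⊓ D.W k)) (p q : ℤ) :
    Module.finrank ℂ (I p q) = Module.finrank ℂ (I' p q) := by
  have h1 := hI.finrank_I p q
  have h2 := hI'.finrank_I p q
  rw [h, h, h, h] at h1
  omega

end IsDeligneBigrading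

/-- A point with a bigrading of the right dimensions lies in the compact dual if it satisfies the
first Riemann bilinear relation. -/
theorem mem_compactDual (hI : D.IsDeligneBigrading F I) (hS : D.FirstRelation F)
    (hh : ∀ p q, Module.finrank ℂ (I p q) = D.h (p, q)) : F ∈ D.compactDual := by
  have hs : ∀ i : ℤ × ℤ, i ∉ D.h.support → pieces I i = ⊥ := by
    intro i hi
    rw [Finsupp.notMem_support_iff] at hi
    exact Submodule.finrank_eq_zero.1 ((hh i.1 i.2).trans hi)
  have hsum : ∀ (P : ℤ × ℤ → Prop) [DecidablePred P],
      Module.finrank ℂ (part (pieces I) {rs | P rs}) = ∑ rs ∈ D.h.support with P rs, D.h rs := by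
    intro P _
    classical
    rw [finrank_part hI.internal {rs | P rs} hs]
    refine Finset.sum_congr (Finset.filter_congr fun i _ => Iff.rfl) fun i _ => hh i.1 i.2
  refine ⟨fun p => ?_, fun k p => ?_, firstRelation_iff.1 hS⟩
  · rw [hI.F_eq, hsum (fun rs => p ≤ rs.1)]
  · have h1 := finrank_F_inf_W (D := D) F p k
    rw [hI.F_inf_W_eq, hI.F_inf_W_eq, hsum (fun rs => p ≤ rs.1 ∧ rs.1 + rs.2 ≤ k),
      hsum (fun rs => p ≤ rs.1 ∧ rs.1 + rs.2 ≤ k - 1)] at h1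
    have h2 : ∑ rs ∈ D.h.support with (p ≤ rs.1 ∧ rs.1 + rs.2 ≤ k), D.h rs =
        ∑ rs ∈ D.h.support with (p ≤ rs.1 ∧ rs.1 + rs.2 = k), D.h rs +
          ∑ rs ∈ D.h.support with (p ≤ rs.1 ∧ rs.1 + rs.2 ≤ k - 1), D.h rs := by
      rw [← Finset.sum_union]
      · congr 1
        ext i
        simp only [Finset.mem_union, Finset.mem_filter]
        by_cases hi : i ∈ D.h.support
        · simp only [hi, true_and]
          omega
        · simp [hi]
      · rw [Finset.disjoint_filter]
        intro i _ h1 h2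
        omega
    omega

theorem firstRelation_of_mem_M {F : DecFiltration V} (hF : F ∈ D.M) : D.FirstRelation F :=
  firstRelation_iff.2 fun k => (hF.2.1 k).1

theorem M_subset_compactDual : D.M ⊆ D.compactDual := fun _ hF =>
  mem_compactDual (isDeligneBigrading_I hF.1) (firstRelation_of_mem_M hF) hF.2.2

end Dim

end GradedPolarizationData


/-! ### Exponentials that lie in `G_ℂ`. -/

namespace GradedPolarizationData

open BigradedSum OpposedFiltrations EndExp

variable {V : Type*} [NormedAddCommGroup V] [NormedSpace ℂ V] [Module ℚ V]
  {D : GradedPolarizationData V}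

variable (D) in
/-- `g` preserves `W` and acts on each `Gr^W_k` by an isometry of `S_k`. -/
structure IsGradedIsometry (g : V →L[ℂ] V) : Prop where
  mem_W : ∀ k, ∀ x ∈ D.W k, g x ∈ D.W k
  form : ∀ k, ∀ x ∈ D.W k, ∀ y ∈ D.W k, D.B k (g x) (g y) = D.B k x y

variable [FiniteDimensional ℂ V] {F : DecFiltration V} {I : ℤ → ℤ → Submodule ℂ V}

theorem isGradedIsometry_exp {u : V →L[ℂ] V} (hu : u ∈ D.lieGC) :
    D.IsGradedIsometry (NormedSpace.exp u) := by
  rw [mem_lieGC_iff] at hu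
  exact ⟨fun k x hx => exp_apply_mem (hu.1 k) hx, fun k => bilin_exp (D.B k) (hu.1 k) (hu.2 k)⟩

theorem mem_lieGC_of_exp {u : V →L[ℂ] V} (hu : IsNilpotent u)
    (h : D.IsGradedIsometry (NormedSpace.exp u)) : u ∈ D.lieGC :=
  mem_lieGC_iff.2 ⟨fun k => apply_mem_of_exp_apply_mem hu (h.mem_W k),
    fun k => bilin_of_exp hu (D.B k) (h.mem_W k) (h.form k)⟩

theorem mem_map_exp {u : V →L[ℂ] V} {p : ℤ} {y : V} :
    y ∈ F.map (NormedSpace.exp u) p ↔ NormedSpace.exp (-u) y ∈ F p := by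
  constructor
  · rintro ⟨x, hx, rfl⟩
    rw [ContinuousLinearMap.coe_coe, exp_neg_apply]
    exact hx
  · exact fun h => ⟨_, h, exp_apply_neg u y⟩

theorem map_exp_inf_W {u : V →L[ℂ] V} (hu : u ∈ D.lieGC) (p k : ℤ) :
    F.map (NormedSpace.exp u) p ⊓ D.W k =
      (F p ⊓ D.W k).map (expEquiv u : V →ₗ[ℂ] V) := by
  ext y
  constructor
  · rintro ⟨hy, hyW⟩
    exact ⟨NormedSpace.exp (-u) y, ⟨mem_map_exp.1 hy,
      (isGradedIsometry_exp (Submodule.neg_mem _ hu)).mem_W k y hyW⟩, exp_apply_neg u y⟩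
  · rintro ⟨x, ⟨hx, hxW⟩, rfl⟩
    exact ⟨⟨x, hx, rfl⟩, (isGradedIsometry_exp hu).mem_W k x hxW⟩

theorem finrank_map_exp_inf_W {u : V →L[ℂ] V} (hu : u ∈ D.lieGC) (p k : ℤ) :
    Module.finrank ℂ ↥(F.map (NormedSpace.exp u) p ⊓ D.W k) =
      Module.finrank ℂ ↥(F p ⊓ D.W k) := by
  rw [map_exp_inf_W hu, LinearEquiv.finrank_map_eq]

theorem firstRelation_map_exp (hS : D.FirstRelation F) {u : V →L[ℂ] V} (hu : u ∈ D.lieGC) :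
    D.FirstRelation (F.map (NormedSpace.exp u)) := by
  intro k p x hx y hy hxW hyW
  have h := isGradedIsometry_exp (Submodule.neg_mem _ hu)
  rw [← h.form k x hxW y hyW]
  exact hS k p _ (mem_map_exp.1 hx) _ (mem_map_exp.1 hy) (h.mem_W k x hxW) (h.mem_W k y hyW)

theorem map_exp_mem_compactDual (hF : F ∈ D.compactDual) {u : V →L[ℂ] V} (hu : u ∈ D.lieGC) :
    F.map (NormedSpace.exp u) ∈ D.compactDual := by
  refine ⟨fun p => ?_, fun k p => ?_,
    firstRelation_iff.1 (firstRelation_map_exp (firstRelation_iff.2 hF.2.2) hu)⟩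
  · rw [← hF.1 p]
    exact LinearEquiv.finrank_map_eq (expEquiv u) (F p)
  · rw [← hF.2.1 k p]
    exact finrank_grF_congr (fun p k => finrank_map_exp_inf_W hu p k) p k

theorem exp_apply_mem_part {u : V →L[ℂ] V} (hu : u ∈ lowering I) {p : ℤ} {x : V}
    (hx : x ∈ part (pieces I) {rs | rs.1 < p}) :
    NormedSpace.exp u x ∈ part (pieces I) {rs | rs.1 < p} := by
  refine exp_apply_mem (fun y hy => ?_) hx
  refine part_mono (fun l hl => ?_) (lowering_apply_mem hu hy)
  simp only [Set.mem_ofPred_eq] at *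
  omega

theorem exp_sub_one_mem_lowering {u : V →L[ℂ] V} (hu : u ∈ lowering I) :
    NormedSpace.exp u - 1 ∈ lowering I := by
  intro p q x hx
  refine exp_apply_sub_mem (fun y hy => ?_) (hu p q x hx)
  refine part_mono (fun l hl => ?_) (lowering_apply_mem hu hy)
  simp only [Set.mem_ofPred_eq] at *
  omega

/-- Pieces of weight `k` with nonzero pairing have first indices that add up to `k`. -/
theorem B_part_eq_zero (hI : D.IsDeligneBigrading F I) (hS : D.FirstRelation F) {k a b : ℤ}
    (hab : a + b < k) {x y : V} (hx : x ∈ part (pieces I) {rs | rs.1 ≤ a ∧ rs.1 + rs.2 ≤ k})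
    (hy : y ∈ part (pieces I) {rs | rs.1 ≤ b ∧ rs.1 + rs.2 ≤ k}) : D.B k x y = 0 := by
  refine (part_le fun j hj y hy => ?_ : _ ≤ LinearMap.ker (D.B k x)) hy
  change (D.B k).flip y x = 0
  refine (part_le fun i hi x hx => ?_ : _ ≤ LinearMap.ker ((D.B k).flip y)) hx
  change D.B k x y = 0
  simp only [Set.mem_ofPred_eq] at hi hj
  have hxW := hI.le_W _ _ hx
  have hyW := hI.le_W _ _ hy
  by_cases h1 : i.1 + i.2 = k
  · by_cases h2 : j.1 + j.2 = k
    · exact hI.B_eq_zero hS h1 h2 (by omega) hx hy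
    · exact B_right_eq_zero (D.W_mono hi.2 hxW) (D.W_mono (by omega) hyW)
  · exact B_left_eq_zero (D.W_mono (by omega) hxW) (D.W_mono hj.2 hyW)

theorem map_exp_inf_part_eq_bot (hI : D.IsDeligneBigrading F I) {u : V →L[ℂ] V}
    (hu : u ∈ lowering I) {p : ℤ} {x : V} (hx : x ∈ F.map (NormedSpace.exp u) p)
    (hx' : x ∈ part (pieces I) {rs | rs.1 < p}) : x = 0 := by
  have h1 : NormedSpace.exp (-u) x ∈ F p ⊓ part (pieces I) {rs | rs.1 < p} :=
    ⟨mem_map_exp.1 hx, exp_apply_mem_part (Submodule.neg_mem _ hu) hx'⟩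
  rw [F_inf_part_eq_bot hI, Submodule.mem_bot] at h1
  rw [← exp_apply_neg u x, h1, map_zero]

/-- If `u` lowers the first index and `exp(u).F` lies in the compact dual, then
`exp(u) ∈ G_ℂ`. -/
theorem isGradedIsometry_of_map_exp_mem (hI : D.IsDeligneBigrading F I) (hF : F ∈ D.compactDual)
    {u : V →L[ℂ] V} (hu : u ∈ lowering I) (hF' : F.map (NormedSpace.exp u) ∈ D.compactDual) :
    D.IsGradedIsometry (NormedSpace.exp u) := by
  have hS := firstRelation_iff.2 hF.2.2
  have hS' := firstRelation_iff.2 hF'.2.2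
  have hdim : ∀ p k, Module.finrank ℂ ↥(F p ⊓ D.W k) =
      Module.finrank ℂ ↥(F.map (NormedSpace.exp u) p ⊓ D.W k) :=
    finrank_F_inf_W_congr fun p k => (hF.2.1 k p).trans (hF'.2.1 k p).symm
  have hsub : ∀ p q, ∀ x ∈ I p q, NormedSpace.exp u x - x ∈ part (pieces I) {rs | rs.1 < p} :=
    fun p q x hx => exp_sub_one_mem_lowering hu p q x hx
  -- `P` is a complement of `F^p ∩ W_k` in `W_k`. The translated filtration also meets `P` trivially
  -- and has the same dimension, so it gives another complement. The part of `x` in that complement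
  -- must be `exp(u) x`, since both lie in the translate of `F^p` and differ by terms of smaller
  -- first index.
  have hpiece : ∀ k p q, p + q ≤ k → ∀ x ∈ I p q, NormedSpace.exp u x ∈ D.W k := by
    intro k p q hk x hx
    set P := part (pieces I) {rs | rs.1 < p ∧ rs.1 + rs.2 ≤ k}
    have hPW : P ≤ D.W k := by
      rw [hI.W_eq]
      exact part_mono fun i hi => hi.2
    have h1 := Submodule.finrank_sup_add_finrank_inf_eq (F p ⊓ D.W k) P
    have h2 := Submodule.finrank_sup_add_finrank_inf_eq
      (F.map (NormedSpace.exp u) p ⊓ D.W k) P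
    have e1 : (F p ⊓ D.W k) ⊓ P = ⊥ := by
      rw [eq_bot_iff, ← F_inf_part_eq_bot hI p]
      exact inf_le_inf inf_le_left (part_mono fun i hi => hi.1)
    have e2 : (F.map (NormedSpace.exp u) p ⊓ D.W k) ⊓ P = ⊥ := by
      rw [eq_bot_iff]
      rintro y ⟨⟨hy, -⟩, hyP⟩
      exact map_exp_inf_part_eq_bot hI hu hy (part_mono (fun i hi => hi.1) hyP)
    have e3 : (F p ⊓ D.W k) ⊔ P = D.W k := by
      rw [hI.F_inf_W_eq, part_sup, hI.W_eq]
      congr 1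
      ext i
      simp only [Set.mem_union, Set.mem_ofPred_eq]
      omega
    rw [e1, e3] at h1
    rw [e2] at h2
    have e4 : (F.map (NormedSpace.exp u) p ⊓ D.W k) ⊔ P = D.W k := by
      refine Submodule.eq_of_le_of_finrank_le (sup_le inf_le_right hPW) ?_
      have := hdim p k
      omega
    have hxW : x ∈ (F.map (NormedSpace.exp u) p ⊓ D.W k) ⊔ P := by
      rw [e4]
      exact D.W_mono hk (hI.le_W _ _ hx)
    obtain ⟨y, ⟨hyF, hyW⟩, c, hc, hyc⟩ := Submodule.mem_sup.1 hxW
    have : NormedSpace.exp u x - y = 0 := by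
      refine map_exp_inf_part_eq_bot hI hu (p := p) (Submodule.sub_mem _ ?_ hyF) ?_
      · exact ⟨x, hI.le_F _ _ hx, rfl⟩
      · rw [show NormedSpace.exp u x - y = (NormedSpace.exp u x - x) + c by rw [← hyc]; abel]
        exact Submodule.add_mem _ (hsub p q x hx) (part_mono (fun i hi => hi.1) hc)
    rwa [sub_eq_zero.1 this]
  have hW : ∀ k, ∀ x ∈ D.W k, NormedSpace.exp u x ∈ D.W k := by
    intro k x hx
    rw [hI.W_eq] at hx
    exact (part_le fun i hi y hy => hpiece k i.1 i.2 hi y hy : _ ≤ (D.W k).comap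
      ((NormedSpace.exp u : V →L[ℂ] V) : V →ₗ[ℂ] V)) hx
  refine ⟨hW, fun k x hx y hy => ?_⟩
  have hx' := hx
  have hy' := hy
  rw [hI.W_eq] at hx' hy'
  rw [← sub_eq_zero]
  refine (part_le fun j hj y hy => ?_ : _ ≤ LinearMap.ker
    (D.B k (NormedSpace.exp u x) ∘ₗ ((NormedSpace.exp u : V →L[ℂ] V) : V →ₗ[ℂ] V) - D.B k x)) hy'
  refine (part_le fun i hi x hx => ?_ : _ ≤ LinearMap.ker
    ((D.B k).flip (NormedSpace.exp u y) ∘ₗ ((NormedSpace.exp u : V →L[ℂ] V) : V →ₗ[ℂ] V) - (D.B k).flip y)) hx'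
  change D.B k (NormedSpace.exp u x) (NormedSpace.exp u y) - D.B k x y = 0
  simp only [Set.mem_ofPred_eq] at hi hj
  have hxW := D.W_mono hi (hI.le_W _ _ hx)
  have hyW := D.W_mono hj (hI.le_W _ _ hy)
  -- If the first indices add up to at most `k`, every term with a correction `exp(u) z - z` has a
  -- smaller sum and pairs to zero. Otherwise both pairings vanish, by the first relation for the
  -- translate and for `F`.
  by_cases hij : i.1 + j.1 ≤ k
  · have hd : ∀ l : ℤ × ℤ, l.1 + l.2 ≤ k → ∀ z ∈ I l.1 l.2, NormedSpace.exp u z - z ∈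
        part (pieces I) {rs | rs.1 ≤ l.1 - 1 ∧ rs.1 + rs.2 ≤ k} := by
      intro l hl z hz
      have h1 := hsub _ _ z hz
      have h2 := Submodule.sub_mem _ (hpiece k _ _ hl z hz) (D.W_mono hl (hI.le_W _ _ hz))
      rw [hI.W_eq] at h2
      refine part_mono (fun m hm => ?_)
        ((part_inf hI.internal {rs | rs.1 < l.1} {rs | rs.1 + rs.2 ≤ k}).le ⟨h1, h2⟩)
      obtain ⟨hm1, hm2⟩ := hm
      simp only [Set.mem_ofPred_eq] at hm1 hm2 ⊢
      omega
    have hz : ∀ l : ℤ × ℤ, l.1 + l.2 ≤ k → ∀ z ∈ I l.1 l.2, z ∈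
        part (pieces I) {rs | rs.1 ≤ l.1 ∧ rs.1 + rs.2 ≤ k} := fun l hl z hz =>
      le_part (J := pieces I) (A := {rs | rs.1 ≤ l.1 ∧ rs.1 + rs.2 ≤ k}) (i := l) ⟨le_refl l.1, hl⟩ hz
    have b1 := B_part_eq_zero hI hS (by omega) (hd i hi x hx) (hz j hj y hy)
    have b2 := B_part_eq_zero hI hS (by omega) (hz i hi x hx) (hd j hj y hy)
    have b3 := B_part_eq_zero hI hS (by omega) (hd i hi x hx) (hd j hj y hy)
    simp only [map_sub, LinearMap.sub_apply] at b1 b2 b3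
    linear_combination b1 + b2 + b3
  · have b1 : D.B k (NormedSpace.exp u x) (NormedSpace.exp u y) = 0 :=
      hS' k i.1 _ ⟨x, hI.le_F _ _ hx, rfl⟩ _
        ((F.map (NormedSpace.exp u)).antitone' (show k - i.1 + 1 ≤ j.1 by omega)
          ⟨y, hI.le_F _ _ hy, rfl⟩) (hpiece k _ _ hi x hx) (hpiece k _ _ hj y hy)
    rw [b1, hS k i.1 x (hI.le_F _ _ hx) y (F.antitone' (by omega) (hI.le_F _ _ hy)) hxW hyW,
      sub_zero]

end GradedPolarizationData


/-! ### Openness of `M` in the orbit of `G_ℂ`. -/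

namespace GradedPolarizationData

open BigradedSum OpposedFiltrations EndExp

section Algebraic

variable {V : Type*} [AddCommGroup V] [Module ℂ V] [Module ℚ V] {D : GradedPolarizationData V}

theorem antitone_grF (F : DecFiltration V) (k : ℤ) : Antitone (D.grF F k) := fun _ _ h =>
  Submodule.map_mono (Submodule.comap_mono (F.antitone' h))

theorem grF_eq_top {F : DecFiltration V} {p : ℤ} (h : F p = ⊤) (k : ℤ) : D.grF F k p = ⊤ := by
  rw [eq_top_iff]
  intro x _
  obtain ⟨x, rfl⟩ := exists_mk x
  exact ⟨x, by simp [h, Submodule.submoduleOf], rfl⟩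

theorem grF_eq_bot {F : DecFiltration V} {p : ℤ} (h : F p = ⊥) (k : ℤ) : D.grF F k p = ⊥ := by
  rw [eq_bot_iff]
  rintro _ ⟨x, hx, rfl⟩
  have : (x : V) ∈ F p := hx
  rw [h, Submodule.mem_bot, Submodule.coe_eq_zero] at this
  simp [this]

/-- Conjugation is only semilinear, so ranks are compared along the conjugation automorphism of `ℂ`.
-/
theorem finrank_map_grConj {k : ℤ} (P : Submodule ℂ (GrW D.W k)) :
    Module.finrank ℂ (P.map (D.grConj k)) = Module.finrank ℂ P := by
  let j : P ≃+ P.map (D.grConj k) :=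
    { toFun := fun x => ⟨D.grConj k x, x, x.2, rfl⟩
      invFun := fun x => ⟨D.grConj k x, mem_map_grConj.1 x.2⟩
      left_inv := fun x => by ext; exact grConj_grConj _
      right_inv := fun x => by ext; exact grConj_grConj _
      map_add' := fun x y => by ext; simp }
  have := rank_eq_of_equiv_equiv (starRingEnd ℂ) j (Function.Involutive.bijective Complex.conj_conj) (fun r m => by
    ext
    simp [j])
  rw [Module.finrank, Module.finrank, this]

/-- `i^{p-q} S_k(z, conj z)` is real if `p + q = k`. -/
theorem im_B_conj_eq_zero {p q k : ℤ} (hk : p + q = k) {z : V} (hz : z ∈ D.W k) :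
    (Complex.I ^ (p - q) * D.B k z (D.conj z)).im = 0 := by
  rw [← Complex.conj_eq_iff_im, map_mul, ← B_conj_conj hz (D.conj_mem_W k z hz), conj_conj,
    B_symm (D.conj_mem_W k z hz) hz, map_zpow₀, Complex.conj_I, ← mul_assoc]
  congr 1
  -- With `-1 = i^2` and `-i = i^3`, both sides are powers of `i` whose exponents differ by `4p`.
  have h1 : (-1 : ℂ) = Complex.I ^ (2 : ℤ) := by
    rw [zpow_ofNat, Complex.I_sq]
  have h2 : -Complex.I = Complex.I ^ (3 : ℤ) := by
    rw [zpow_ofNat, Complex.I_pow_three]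
  have h4 : Complex.I ^ (4 : ℤ) = 1 := by rw [zpow_ofNat, Complex.I_pow_four]
  rw [h1, h2, ← zpow_mul, ← zpow_mul, ← zpow_add₀ Complex.I_ne_zero,
    show 3 * (p - q) + 2 * k = 4 * p + (p - q) by omega, zpow_add₀ Complex.I_ne_zero, zpow_mul, h4,
    one_zpow, one_mul]

variable [FiniteDimensional ℂ V] {F : DecFiltration V} {I : ℤ → ℤ → Submodule ℂ V}

/-- The lift `⊕_{r+s=k} I^{r,s}` of `Gr^W_k`. -/
def grLift (I : ℤ → ℤ → Submodule ℂ V) (k : ℤ) : Submodule ℂ V :=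
  part (pieces I) {rs | rs.1 + rs.2 = k}

theorem grLift_le (hI : D.IsDeligneBigrading F I) (k : ℤ) : grLift I k ≤ D.W k := by
  rw [hI.W_eq]
  exact part_mono fun i hi => le_of_eq hi

theorem eq_zero_of_mem_grLift (hI : D.IsDeligneBigrading F I) {k : ℤ} {z : V}
    (hz : z ∈ grLift I k) (hz' : z ∈ D.W (k - 1)) : z = 0 := by
  rw [hI.W_eq] at hz'
  have := (part_inf hI.internal {rs | rs.1 + rs.2 = k} {rs | rs.1 + rs.2 ≤ k - 1}).le ⟨hz, hz'⟩
  rw [show ({rs | rs.1 + rs.2 = k} ∩ {rs | rs.1 + rs.2 ≤ k - 1} : Set (ℤ × ℤ)) = ∅ by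
    ext i
    simp only [Set.mem_inter_iff, Set.mem_ofPred_eq, Set.mem_empty_iff_false, iff_false]
    omega, part_empty] at this
  simpa using this

theorem exists_grLift (hI : D.IsDeligneBigrading F I) {k : ℤ} {x : V} (hx : x ∈ D.W k) :
    ∃ z ∈ grLift I k, x - z ∈ D.W (k - 1) := by
  have h : D.W k ≤ grLift I k ⊔ D.W (k - 1) := by
    rw [hI.W_eq, hI.W_eq, grLift, part_sup]
    refine part_mono fun i hi => ?_
    simp only [Set.mem_union, Set.mem_ofPred_eq] at *
    omega
  obtain ⟨z, hz, w, hw, rfl⟩ := Submodule.mem_sup.1 (h hx)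
  exact ⟨z, hz, by simpa using hw⟩

/-- The preimage of `F^p Gr^W_k` in `W_k`. -/
def grPre (D : GradedPolarizationData V) (F : DecFiltration V) (k p : ℤ) : Submodule ℂ V :=
  F p ⊓ D.W k ⊔ D.W (k - 1)

theorem mem_grPre_of_sub_mem {k p : ℤ} {x f : V} (hf : f ∈ F p)
    (hfW : f ∈ D.W k) (h : x - f ∈ D.W (k - 1)) : x ∈ grPre D F k p := by
  rw [show x = f + (x - f) by abel]
  exact Submodule.add_mem_sup ⟨hf, hfW⟩ h

theorem mk_mem_grF_iff {k p : ℤ} {x : V} (hx : x ∈ D.W k) :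
    GrW.mk D.W k ⟨x, hx⟩ ∈ D.grF F k p ↔ x ∈ grPre D F k p := by
  rw [mk_mem_grF]
  constructor
  · rintro ⟨f, hf, hfW, h⟩
    exact mem_grPre_of_sub_mem hf hfW h
  · intro h
    obtain ⟨f, hf, w, hw, rfl⟩ := Submodule.mem_sup.1 h
    exact ⟨f, hf.1, hf.2, by simpa using hw⟩

theorem mk_mem_map_grF_iff {k p : ℤ} {x : V} (hx : x ∈ D.W k) :
    GrW.mk D.W k ⟨x, hx⟩ ∈ (D.grF F k p).map (D.grConj k) ↔ D.conj x ∈ grPre D F k p := by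
  rw [mem_map_grConj, grConj_mk]
  exact mk_mem_grF_iff (D.conj_mem_W k x hx)

theorem eq_zero_of_mem_grPre (hF : D.IsMixedHodge F) (hI : D.IsDeligneBigrading F I) {k p b : ℤ}
    (hpb : p + b = k + 1) {z : V} (hz : z ∈ grLift I k) (h1 : z ∈ grPre D F k p)
    (h2 : D.conj z ∈ grPre D F k b) : z = 0 := by
  have hzW := grLift_le hI k hz
  have hd := ((hF.2.2 k).2.2.2 p).disjoint
  rw [show k - p + 1 = b by omega, Submodule.disjoint_def] at hd
  exact eq_zero_of_mem_grLift hI hz (mk_eq_zero_iff.1 (hd (GrW.mk D.W k ⟨z, hzW⟩)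
    ((mk_mem_grF_iff hzW).2 h1) ((mk_mem_map_grF_iff hzW).2 h2)))

/-- Purity forces `F^b Gr^W_k` to vanish as soon as the opposite step is everything. Hence the
conditions near `F` have to be checked for finitely many indices only. -/
theorem grPre_eq_bot (hF : D.IsMixedHodge F) {k p b : ℤ} (hpb : p + b = k + 1)
    (hp : F p = ⊤ ∨ F b = ⊥) :
    grPre D F k b = D.W (k - 1) := by
  rcases hp with hp | hb
  · refine le_antisymm (sup_le ?_ le_rfl) le_sup_right
    rintro x ⟨hx, hxW⟩
    have hd := ((hF.2.2 k).2.2.2 p).disjoint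
    rw [disjoint_grF_iff, show k - p + 1 = b by omega] at hd
    have := hd (D.conj x) (by simp [hp]) x hx (D.conj_mem_W k x hxW) hxW (by simp)
    exact D.conj_mem_W_iff.1 this
  · simp [grPre, hb]

end Algebraic

variable {V : Type*} [NormedAddCommGroup V] [NormedSpace ℂ V] [Module ℚ V]
  {D : GradedPolarizationData V} [FiniteDimensional ℂ V] {F : DecFiltration V}
  {I : ℤ → ℤ → Submodule ℂ V}

theorem continuous_conj : Continuous D.conj := by
  let c : V →ₗ[ℝ] V :=
    { toFun := D.conj
      map_add' := map_add D.conj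
      map_smul' := fun r x => by
        rw [← Complex.coe_smul, LinearMap.map_smulₛₗ, Complex.conj_ofReal, Complex.coe_smul]
        rfl }
  have := FiniteDimensional.complexToReal V
  exact c.continuous_of_finiteDimensional

theorem continuous_exp : Continuous (NormedSpace.exp : (V →L[ℂ] V) → (V →L[ℂ] V)) := by
  let _ : NormedAlgebra ℚ (V →L[ℂ] V) := NormedAlgebra.restrictScalars ℚ ℂ _
  exact NormedSpace.exp_continuous

/-- The premises are closed conditions on `(u, z)` and the conclusion is open, so the implication
persists near each `(0, z)`; compactness of `K` makes the neighborhood of `0` uniform in `z`. -/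
theorem eventually_exp_neg {K : Set V} (hK : IsCompact K) (P P' : Submodule ℂ V) {O : Set V}
    (hO : IsOpen O) (h : ∀ z ∈ K, z ∈ P → D.conj z ∈ P' → z ∈ O) :
    ∀ᶠ u : V →L[ℂ] V in 𝓝 0, ∀ z ∈ K, NormedSpace.exp (-u) z ∈ P →
      NormedSpace.exp (-u) (D.conj z) ∈ P' → z ∈ O := by
  refine hK.eventually_forall_of_forall_eventually fun z hz => ?_
  have c1 : Continuous fun uz : (V →L[ℂ] V) × V => NormedSpace.exp (-uz.1) uz.2 :=
    (continuous_exp.comp continuous_fst.neg).clm_apply continuous_snd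
  have c2 : Continuous fun uz : (V →L[ℂ] V) × V => NormedSpace.exp (-uz.1) (D.conj uz.2) :=
    (continuous_exp.comp continuous_fst.neg).clm_apply (continuous_conj.comp continuous_snd)
  by_cases h1 : z ∈ P
  · by_cases h2 : D.conj z ∈ P'
    · have : ∀ᶠ uz : (V →L[ℂ] V) × V in 𝓝 (0, z), uz.2 ∈ O :=
        continuous_snd.continuousAt.eventually_mem (hO.mem_nhds (h z hz h1 h2))
      filter_upwards [this] with uz h _ _ using h
    · have : ∀ᶠ uz : (V →L[ℂ] V) × V in 𝓝 (0, z), NormedSpace.exp (-uz.1) (D.conj uz.2) ∈ (P' : Set V)ᶜ :=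
        c2.continuousAt.eventually_mem
          ((Submodule.closed_of_finiteDimensional P').isOpen_compl.mem_nhds
            (by simpa [NormedSpace.exp_zero] using h2))
      filter_upwards [this] with uz h _ h' using absurd h' h
  · have : ∀ᶠ uz : (V →L[ℂ] V) × V in 𝓝 (0, z), NormedSpace.exp (-uz.1) uz.2 ∈ (P : Set V)ᶜ :=
      c1.continuousAt.eventually_mem
        ((Submodule.closed_of_finiteDimensional P).isOpen_compl.mem_nhds
          (by simpa [NormedSpace.exp_zero] using h1))
    filter_upwards [this] with uz h h' _ using absurd h' h

/-- All the conditions are stable under real scaling, so the compact unit sphere of `L` suffices. -/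
theorem eventually_exp_neg_of_scaling (L P P' : Submodule ℂ V) {O : Set V} (hO : IsOpen O)
    (hscale : ∀ z : V, ∀ r : ℝ, r ≠ 0 → (r : ℂ) • z ∈ O → z ∈ O)
    (h : ∀ z ∈ L, z ∈ P → D.conj z ∈ P' → z ≠ 0 → z ∈ O) :
    ∀ᶠ u : V →L[ℂ] V in 𝓝 0, ∀ z ∈ L, NormedSpace.exp (-u) z ∈ P →
      NormedSpace.exp (-u) (D.conj z) ∈ P' → z ≠ 0 → z ∈ O := by
  have := FiniteDimensional.proper ℂ V
  have hK : IsCompact (Metric.sphere (0 : V) 1 ∩ L) :=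
    (isCompact_sphere 0 1).inter_right (Submodule.closed_of_finiteDimensional L)
  have hev := eventually_exp_neg hK P P' hO (fun z hz h1 h2 => h z hz.2 h1 h2 (by
    rintro rfl
    simpa using hz.1))
  filter_upwards [hev] with u hu z hz h1 h2 hz0
  have hr : ‖z‖⁻¹ ≠ 0 := inv_ne_zero (norm_ne_zero_iff.2 hz0)
  refine hscale z ‖z‖⁻¹ hr (hu _ ⟨?_, Submodule.smul_mem _ _ hz⟩ ?_ ?_)
  · rw [mem_sphere_zero_iff_norm, norm_smul]
    simp [norm_ne_zero_iff.2 hz0]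
  · rw [map_smul]
    exact Submodule.smul_mem _ _ h1
  · rw [LinearMap.map_smulₛₗ, map_smul]
    exact Submodule.smul_mem _ _ h2

theorem exp_neg_mem_grPre {u : V →L[ℂ] V} (hu : u ∈ D.lieGC) {k p : ℤ} {z : V}
    (hz : z ∈ grPre D (F.map (NormedSpace.exp u)) k p) : NormedSpace.exp (-u) z ∈ grPre D F k p := by
  have h := isGradedIsometry_exp (Submodule.neg_mem _ hu)
  obtain ⟨f, ⟨hf, hfW⟩, w, hw, rfl⟩ := Submodule.mem_sup.1 hz
  rw [map_add]
  exact Submodule.add_mem_sup ⟨mem_map_exp.1 hf, h.mem_W k f hfW⟩ (h.mem_W _ w hw)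

theorem exp_neg_mem_W_iff {u : V →L[ℂ] V} (hu : u ∈ D.lieGC) {k : ℤ} {z : V} :
    NormedSpace.exp (-u) z ∈ D.W k ↔ z ∈ D.W k := by
  refine ⟨fun h => ?_, fun h => (isGradedIsometry_exp (Submodule.neg_mem _ hu)).mem_W k z h⟩
  rw [← exp_apply_neg u z]
  exact (isGradedIsometry_exp hu).mem_W k _ h

/-- The classifying space is open in the orbit of `G_ℂ`. -/
theorem eventually_map_exp_mem_M (hF : F ∈ D.M) :
    ∀ᶠ u : V →L[ℂ] V in 𝓝 0, u ∈ D.lieGC → F.map (NormedSpace.exp u) ∈ D.M := by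
  have hI := isDeligneBigrading_I hF.1
  have hS := firstRelation_of_mem_M hF
  obtain ⟨a, ha⟩ := hF.1.1
  obtain ⟨b, hb⟩ := hF.1.2.1
  have hlow : ∀ p, p ≤ a → F p = ⊤ := fun p hp => top_le_iff.1 (ha ▸ F.antitone' hp)
  have hhigh : ∀ p, b ≤ p → F p = ⊥ := fun p hp => le_bot_iff.1 (hb ▸ F.antitone' hp)
  -- The conclusion `z ∈ ∅` encodes that the two steps of the translated filtration stay opposed.
  -- The lift `grLift` of `Gr^W_k` is fixed, and the dependence on `u` sits in `exp(-u)`.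
  have ev1 : ∀ᶠ u : V →L[ℂ] V in 𝓝 0, ∀ pr ∈ Finset.Icc a b ×ˢ Finset.Icc a b,
      ∀ z ∈ grLift (D.I F) (pr.1 + pr.2 - 1),
        NormedSpace.exp (-u) z ∈ grPre D F (pr.1 + pr.2 - 1) pr.1 →
        NormedSpace.exp (-u) (D.conj z) ∈ grPre D F (pr.1 + pr.2 - 1) pr.2 → z ≠ 0 →
          z ∈ (∅ : Set V) := by
    rw [Filter.eventually_all_finset]
    intro pr _
    refine eventually_exp_neg_of_scaling _ _ _ isOpen_empty (fun z r _ h => h) ?_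
    exact fun z hz h1 h2 h0 => absurd (eq_zero_of_mem_grPre hF.1 hI (by omega) hz h1 h2) h0
  have ev2 : ∀ᶠ u : V →L[ℂ] V in 𝓝 0, ∀ pq ∈ Finset.Icc a b ×ˢ Finset.Icc a b,
      ∀ z ∈ grLift (D.I F) (pq.1 + pq.2),
        NormedSpace.exp (-u) z ∈ grPre D F (pq.1 + pq.2) pq.1 →
        NormedSpace.exp (-u) (D.conj z) ∈ grPre D F (pq.1 + pq.2) pq.2 → z ≠ 0 →
          z ∈ {z : V | 0 < (Complex.I ^ (pq.1 - pq.2) * D.B (pq.1 + pq.2) z (D.conj z)).re} := by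
    rw [Filter.eventually_all_finset]
    rintro ⟨p, q⟩ _
    refine eventually_exp_neg_of_scaling _ _ _ ?_ ?_ ?_
    · refine isOpen_lt continuous_const (Complex.continuous_re.comp (continuous_const.mul ?_))
      exact ((LinearMap.toContinuousBilinearMap (D.B (p + q))).continuous).clm_apply
        continuous_conj
    · intro z r hr h
      simp only [Set.mem_ofPred_eq, LinearMap.map_smulₛₗ, map_smul, LinearMap.smul_apply,
        smul_eq_mul, Complex.conj_ofReal] at h ⊢
      rw [show ∀ A C : ℂ, A * ((r : ℂ) * ((r : ℂ) * C)) = ((r * r : ℝ) : ℂ) * (A * C) by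
        intro A C; push_cast; ring, Complex.re_ofReal_mul] at h
      exact pos_of_mul_pos_right h (mul_self_nonneg r)
    · intro z hz h1 h2 h0
      have hzW := grLift_le hI _ hz
      have := (hF.2.1 (p + q)).2 p q rfl (GrW.mk D.W _ ⟨z, hzW⟩)
        ⟨(mk_mem_grF_iff hzW).2 h1, (mk_mem_map_grF_iff hzW).2 h2⟩
        (fun h => h0 (eq_zero_of_mem_grLift hI hz (mk_eq_zero_iff.1 h)))
      rw [grConj_mk, ← B_apply D hzW (D.conj_mem_W _ z hzW)] at this
      exact this.2
  filter_upwards [ev1, ev2] with u h1 h2 hu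
  set F' := F.map (NormedSpace.exp u) with hF'
  have hdim : ∀ p k, Module.finrank ℂ ↥(F p ⊓ D.W k) = Module.finrank ℂ ↥(F' p ⊓ D.W k) :=
    fun p k => (finrank_map_exp_inf_W hu p k).symm
  have hdisj : ∀ p r k, p + r = k + 1 → ∀ z ∈ grLift (D.I F) k, z ∈ grPre D F' k p →
      D.conj z ∈ grPre D F' k r → z = 0 := by
    intro p r k hk z hz hz1 hz2
    replace hz1 := exp_neg_mem_grPre hu hz1
    replace hz2 := exp_neg_mem_grPre hu hz2
    -- In these extreme cases a preimage collapses to `W_{k-1}`; otherwise both indices lie strictly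
    -- between `a` and `b`, where `ev1` applies.
    by_cases hp : F r = ⊤ ∨ F p = ⊥
    · rw [grPre_eq_bot hF.1 (by omega) hp, exp_neg_mem_W_iff hu] at hz1
      exact eq_zero_of_mem_grLift hI hz hz1
    by_cases hr : F p = ⊤ ∨ F r = ⊥
    · rw [grPre_eq_bot hF.1 hk hr, exp_neg_mem_W_iff hu, conj_mem_W_iff] at hz2
      exact eq_zero_of_mem_grLift hI hz hz2
    push Not at hp hr
    by_contra h0
    have e : k = p + r - 1 := by omega
    subst e
    refine h1 (p, r) ?_ z hz hz1 hz2 h0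
    simp only [Finset.mem_product, Finset.mem_Icc]
    have m1 := mt (hlow p) hr.1
    have m2 := mt (hlow r) hp.1
    have m3 := mt (hhigh p) hp.2
    have m4 := mt (hhigh r) hr.2
    omega
  have hMHS : D.IsMixedHodge F' := by
    have htop : F' a = ⊤ := by
      rw [eq_top_iff]
      exact fun x _ => mem_map_exp.2 (by rw [ha]; trivial)
    have hbot : F' b = ⊥ := by
      change (F b).map _ = ⊥
      rw [hb, Submodule.map_bot]
    refine ⟨⟨a, htop⟩, ⟨b, hbot⟩, fun k => ⟨antitone_grF F' k, ⟨a, grF_eq_top htop k⟩,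
      ⟨b, grF_eq_bot hbot k⟩, fun p => ?_⟩⟩
    have hd : Disjoint (D.grF F' k p) ((D.grF F' k (k - p + 1)).map (D.grConj k)) := by
      rw [Submodule.disjoint_def]
      intro x hx hx'
      obtain ⟨⟨x, hxW⟩, rfl⟩ := exists_mk x
      obtain ⟨z, hz, hxz⟩ := exists_grLift hI hxW
      have e : GrW.mk D.W k ⟨x, hxW⟩ = GrW.mk D.W k ⟨z, grLift_le hI k hz⟩ := mk_eq_mk_iff.2 hxz
      rw [e] at hx hx' ⊢
      have := hdisj p (k - p + 1) k (by omega) z hz ((mk_mem_grF_iff _).1 hx)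
        ((mk_mem_map_grF_iff _).1 hx')
      rw [mk_eq_zero_iff]
      simp [this]
    refine ⟨hd, codisjoint_iff.2 (Submodule.eq_top_of_disjoint _ _ ?_ hd)⟩
    -- Dimensions are unchanged by the translation, so disjointness already implies complementarity.
    rw [finrank_map_grConj, ← finrank_grF_congr hdim, ← finrank_grF_congr hdim,
      ← finrank_map_grConj (D.grF F k (k - p + 1))]
    exact (Submodule.finrank_add_eq_of_isCompl ((hF.1.2.2 k).2.2.2 p)).ge
  refine ⟨hMHS, fun k => ⟨firstRelation_iff.1 (firstRelation_map_exp hS hu) k, ?_⟩, fun p q => ?_⟩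
  · rintro p q rfl v ⟨hv1, hv2⟩ hv0
    obtain ⟨⟨x, hxW⟩, rfl⟩ := exists_mk v
    obtain ⟨z, hz, hxz⟩ := exists_grLift hI hxW
    have hzW := grLift_le hI _ hz
    have e : GrW.mk D.W (p + q) ⟨x, hxW⟩ = GrW.mk D.W (p + q) ⟨z, hzW⟩ := mk_eq_mk_iff.2 hxz
    rw [e] at hv1 hv2 hv0 ⊢
    rw [grConj_mk, ← B_apply D hzW (D.conj_mem_W _ z hzW)]
    refine ⟨im_B_conj_eq_zero rfl hzW, ?_⟩
    have hz1 := exp_neg_mem_grPre hu ((mk_mem_grF_iff _).1 hv1)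
    have hz2 := exp_neg_mem_grPre hu ((mk_mem_map_grF_iff _).1 hv2)
    have hz0 : z ∉ D.W (p + q - 1) := fun h => hv0 (mk_eq_zero_iff.2 h)
    have hp : ¬ (F (q + 1) = ⊤ ∨ F p = ⊥) := fun hp => by
      rw [grPre_eq_bot hF.1 (by omega) hp, exp_neg_mem_W_iff hu] at hz1
      exact hz0 hz1
    have hq : ¬ (F (p + 1) = ⊤ ∨ F q = ⊥) := fun hq => by
      rw [grPre_eq_bot hF.1 (by omega) hq, exp_neg_mem_W_iff hu, conj_mem_W_iff] at hz2
      exact hz0 hz2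
    push Not at hp hq
    refine h2 (p, q) ?_ z hz hz1 hz2 (by rintro rfl; exact hz0 (Submodule.zero_mem _))
    simp only [Finset.mem_product, Finset.mem_Icc]
    have m1 := mt (hlow (p + 1)) hq.1
    have m2 := mt (hlow (q + 1)) hp.1
    have m3 := mt (hhigh p) hp.2
    have m4 := mt (hhigh q) hq.2
    omega
  · rw [← hF.2.2 p q]
    exact (hI.finrank_I_congr (isDeligneBigrading_I hMHS) hdim p q).symm

end GradedPolarizationData


/-! ### The topology of the flag variety. -/

namespace DecFiltration

variable {V : Type*} [NormedAddCommGroup V] [NormedSpace ℂ V]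

theorem map_map (F : DecFiltration V) (A B : V →L[ℂ] V) : (F.map A).map B = F.map (B * A) := by
  ext p x
  simp only [map, Submodule.mem_map]
  constructor
  · rintro ⟨_, ⟨y, hy, rfl⟩, rfl⟩
    exact ⟨y, hy, rfl⟩
  · rintro ⟨y, hy, rfl⟩
    exact ⟨_, ⟨y, hy, rfl⟩, rfl⟩

theorem map_one (F : DecFiltration V) : F.map 1 = F := by
  ext p x
  simp [map, Submodule.mem_map]

theorem isOpen_iff {N : Set (DecFiltration V)} :
    IsOpen N ↔ ∀ F : DecFiltration V, IsOpen {g : (V →L[ℂ] V)ˣ | F.map (g : V →L[ℂ] V) ∈ N} := by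
  rw [isOpen_iSup_iff]
  rfl

/-- If `g₀.F₁ = t₀.F`, then `g.F₁ = (g g₀⁻¹ t₀).F`, and the factor remains in `T` for `g` near `g₀`.
The elements of `T` need not be invertible. -/
theorem isOpen_orbit (F : DecFiltration V) {T : Set (V →L[ℂ] V)} (hT : IsOpen T) :
    IsOpen {F' : DecFiltration V | ∃ t ∈ T, F.map t = F'} := by
  rw [isOpen_iff]
  intro F₁
  rw [isOpen_iff_mem_nhds]
  rintro g₀ ⟨t₀, ht₀, h₀⟩
  have hc : Continuous fun g : (V →L[ℂ] V)ˣ => (g : V →L[ℂ] V) * (↑g₀⁻¹ * t₀) :=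
    Units.continuous_val.mul continuous_const
  have : ∀ᶠ g : (V →L[ℂ] V)ˣ in 𝓝 g₀, (g : V →L[ℂ] V) * (↑g₀⁻¹ * t₀) ∈ T :=
    hc.continuousAt.eventually_mem (hT.mem_nhds (by simpa using ht₀))
  filter_upwards [this] with g hg
  refine ⟨_, hg, ?_⟩
  rw [← mul_assoc, ← map_map, h₀, map_map, mul_assoc, Units.inv_mul, mul_one]

theorem continuousAt_map [CompleteSpace V] (F : DecFiltration V) (g : (V →L[ℂ] V)ˣ) :
    ContinuousAt (fun A : V →L[ℂ] V => F.map A) g := by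
  rw [← Units.isOpenEmbedding_val.continuousAt_iff]
  refine Continuous.continuousAt ?_
  rw [continuous_def]
  exact fun N hN => isOpen_iff.1 hN F

theorem map_eq_self_of_injective [FiniteDimensional ℂ V] {F : DecFiltration V} {A : V →L[ℂ] V}
    (hA : ∀ p, ∀ x ∈ F p, A x ∈ F p) (hinj : Function.Injective A) : F.map A = F := by
  ext1
  funext p
  refine Submodule.eq_of_le_of_finrank_eq (Submodule.map_le_iff_le_comap.2 (hA p)) ?_
  exact (Submodule.equivMapOfInjective (A : V →ₗ[ℂ] V) hinj (F p)).finrank_eq.symm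

end DecFiltration

/-! ### A holomorphic chart of the flag variety. -/

namespace GradedPolarizationData

open BigradedSum OpposedFiltrations EndExp DecFiltration

variable {V : Type*} [NormedAddCommGroup V] [NormedSpace ℂ V] [Module ℚ V]
  {D : GradedPolarizationData V} [FiniteDimensional ℂ V] {F : DecFiltration V}
  {I : ℤ → ℤ → Submodule ℂ V}

/-- The map `(a, b) ↦ exp(a) (1 + b)`, where `a` lowers the first index of the bigrading and `b`
preserves `F`. -/
def flagParam (I : ℤ → ℤ → Submodule ℂ V) (F : DecFiltration V)
    (ab : lowering I × stabilizer F) : V →L[ℂ] V :=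
  NormedSpace.exp (ab.1 : V →L[ℂ] V) * (1 + (ab.2 : V →L[ℂ] V))

theorem analyticAt_flagParam : AnalyticAt ℂ (flagParam I F) 0 := by
  set L₁ : lowering I × stabilizer F →L[ℂ] (V →L[ℂ] V) :=
    (lowering I).subtypeL ∘L ContinuousLinearMap.fst ℂ (lowering I) (stabilizer F) with hL₁
  set L₂ : lowering I × stabilizer F →L[ℂ] (V →L[ℂ] V) :=
    (stabilizer F).subtypeL ∘L ContinuousLinearMap.snd ℂ (lowering I) (stabilizer F) with hL₂
  have hL₁a : AnalyticAt ℂ L₁ 0 :=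
    ContinuousLinearMap.analyticAt (𝕜 := ℂ) (E := lowering I × stabilizer F) (F := V →L[ℂ] V) L₁ 0
  have hL₂a : AnalyticAt ℂ L₂ 0 :=
    ContinuousLinearMap.analyticAt (𝕜 := ℂ) (E := lowering I × stabilizer F) (F := V →L[ℂ] V) L₂ 0
  exact (AnalyticAt.comp (f := L₁) (NormedSpace.exp_analytic _) hL₁a).mul
    (AnalyticAt.add (f := fun _ => (1 : V →L[ℂ] V)) (g := L₂) analyticAt_const hL₂a)

/-- The decomposition of `End(V)` into lowering endomorphisms and endomorphisms that preserve
`F`. -/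
def flagSplit (hI : D.IsDeligneBigrading F I) :
    (lowering I × stabilizer F) ≃L[ℂ] (V →L[ℂ] V) :=
  (Submodule.prodEquivOfIsCompl _ _ (isCompl_lowering_stabilizer hI)).toContinuousLinearEquiv

theorem flagSplit_apply (hI : D.IsDeligneBigrading F I) (ab : lowering I × stabilizer F) :
    flagSplit hI ab = (ab.1 : V →L[ℂ] V) + ab.2 := rfl

/-- To first order `exp(a)(1 + b)` is `1 + a + b`, so the derivative is the splitting isomorphism
and the inverse function theorem applies. -/
theorem hasStrictFDerivAt_flagParam (hI : D.IsDeligneBigrading F I) :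
    HasStrictFDerivAt (flagParam I F)
      (flagSplit hI : lowering I × stabilizer F →L[ℂ] (V →L[ℂ] V)) 0 := by
  set L₁ : lowering I × stabilizer F →L[ℂ] (V →L[ℂ] V) :=
    (lowering I).subtypeL ∘L ContinuousLinearMap.fst ℂ (lowering I) (stabilizer F) with hL₁
  set L₂ : lowering I × stabilizer F →L[ℂ] (V →L[ℂ] V) :=
    (stabilizer F).subtypeL ∘L ContinuousLinearMap.snd ℂ (lowering I) (stabilizer F) with hL₂
  have h3 : HasStrictFDerivAt (NormedSpace.exp : (V →L[ℂ] V) → _)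
      (1 : (V →L[ℂ] V) →L[ℂ] (V →L[ℂ] V)) (L₁ 0) := by
    rw [map_zero]
    exact hasStrictFDerivAt_exp_zero
  have h4 := (HasStrictFDerivAt.comp (f := L₁) 0 h3 L₁.hasStrictFDerivAt).mul'
    (L₂.hasStrictFDerivAt.const_add 1)
  refine h4.congr_fderiv ?_
  refine ContinuousLinearMap.ext fun ab => ?_
  have e1 : L₁ ab = (ab.1 : V →L[ℂ] V) := rfl
  have e2 : L₂ ab = (ab.2 : V →L[ℂ] V) := rfl
  change NormedSpace.exp (L₁ 0) * L₂ ab + L₁ ab * (1 + L₂ 0) = flagSplit hI ab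
  rw [map_zero, map_zero, NormedSpace.exp_zero, one_mul, add_zero, mul_one, flagSplit_apply, e1, e2,
    add_comm]

/-- The flag variety near `F` is parametrized by the exponentials of lowering endomorphisms. -/
theorem exists_flag_chart (hI : D.IsDeligneBigrading F I) {O₀ : Set (lowering I)}
    (hO₀ : O₀ ∈ 𝓝 0) :
    ∃ (O : Set (lowering I)) (T : Set (V →L[ℂ] V)) (l : (V →L[ℂ] V) → lowering I),
      IsOpen O ∧ 0 ∈ O ∧ O ⊆ O₀ ∧ IsOpen T ∧
      (∀ a ∈ O, NormedSpace.exp (a : V →L[ℂ] V) ∈ T ∧ l (NormedSpace.exp (a : V →L[ℂ] V)) = a) ∧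
      ∀ t ∈ T, l t ∈ O ∧ F.map t = F.map (NormedSpace.exp (l t : V →L[ℂ] V)) ∧
        AnalyticAt ℂ l t := by
  have := FiniteDimensional.complete ℂ (lowering I × stabilizer F)
  have hΨd := hasStrictFDerivAt_flagParam hI
  let f := HasStrictFDerivAt.toOpenPartialHomeomorph (𝕜 := ℂ) (E := lowering I × stabilizer F)
    (F := V →L[ℂ] V) (flagParam I F) (f' := flagSplit hI) (a := 0) hΨd
  have hf : ∀ x, f x = flagParam I F x := fun x => rfl
  have h0 : (0 : lowering I × stabilizer F) ∈ f.source := hΨd.mem_toOpenPartialHomeomorph_source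
  have hΨ0 : flagParam I F 0 = 1 := by
    simp [flagParam, NormedSpace.exp_zero]
  have hsymm1 : f.symm 1 = 0 := by
    rw [← hΨ0, ← hf]
    exact f.left_inv h0
  have h1 : (1 : V →L[ℂ] V) ∈ f.target := by
    rw [← hΨ0, ← hf]
    exact f.map_source h0
  -- This bound makes `1 + b` invertible. Since `b` preserves `F`, the factor `1 + b` then fixes
  -- `F`, and only `exp(a)` acts.
  set S : Set (lowering I × stabilizer F) := {ab | ‖ab.2‖ < 1} with hS
  have hSo : IsOpen S := isOpen_lt continuous_snd.norm continuous_const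
  set T₀ : Set (V →L[ℂ] V) := (f.target ∩ f.symm ⁻¹' S) ∩ {t | AnalyticAt ℂ f.symm t} with hT₀
  have hT₀o : IsOpen T₀ :=
    (f.symm.isOpen_inter_preimage hSo).inter (isOpen_analyticAt ℂ f.symm)
  have h1T₀ : (1 : V →L[ℂ] V) ∈ T₀ := by
    refine ⟨⟨h1, ?_⟩, ?_⟩
    · simp [hsymm1, hS]
    · refine f.analyticAt_symm h1 (i := flagSplit hI) ?_ ?_
      · rw [hsymm1]
        exact analyticAt_flagParam
      · rw [hsymm1]
        exact hΨd.hasFDerivAt.fderiv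
  have hcexp : Continuous fun a : lowering I => NormedSpace.exp (a : V →L[ℂ] V) :=
    continuous_exp.comp continuous_subtype_val
  set O : Set (lowering I) := interior O₀ ∩ ((fun a => (a, (0 : stabilizer F))) ⁻¹' f.source ∩
    (fun a : lowering I => NormedSpace.exp (a : V →L[ℂ] V)) ⁻¹' T₀) with hO
  have hOo : IsOpen O := isOpen_interior.inter
    ((f.open_source.preimage (by fun_prop)).inter (hT₀o.preimage hcexp))
  set T : Set (V →L[ℂ] V) := T₀ ∩ (f.target ∩ f.symm ⁻¹' (Prod.fst ⁻¹' O)) with hT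
  have hTo : IsOpen T := hT₀o.inter (f.symm.isOpen_inter_preimage (hOo.preimage continuous_fst))
  have hexpa : ∀ a : lowering I, flagParam I F (a, 0) = NormedSpace.exp (a : V →L[ℂ] V) := by
    intro a
    simp [flagParam]
  have hinv : ∀ a ∈ O, f.symm (NormedSpace.exp (a : V →L[ℂ] V)) = (a, 0) := by
    intro a ha
    rw [← hexpa, ← hf]
    exact f.left_inv ha.2.1
  refine ⟨O, T, fun t => (f.symm t).1, hOo, ⟨mem_interior_iff_mem_nhds.2 hO₀, h0, ?_⟩,
    fun a ha => interior_subset ha.1, hTo, fun a ha => ⟨⟨ha.2.2, ha.2.2.1.1, ?_⟩, ?_⟩,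
    fun t ht => ⟨ht.2.2, ?_, ?_⟩⟩
  · simpa [NormedSpace.exp_zero] using h1T₀
  · simpa [hinv a ha] using ha
  · change (f.symm _).1 = a
    rw [hinv a ha]
  · obtain ⟨⟨⟨htt, htS⟩, -⟩, -⟩ := ht
    have e1 : flagParam I F (f.symm t) = t := f.right_inv htt
    have hunit : IsUnit (1 + ((f.symm t).2 : V →L[ℂ] V)) := by
      have := isUnit_one_sub_of_norm_lt_one (x := -((f.symm t).2 : V →L[ℂ] V))
        (by rw [norm_neg]; exact htS)
      rwa [sub_neg_eq_add] at this
    have e2 : F.map (1 + ((f.symm t).2 : V →L[ℂ] V)) = F := by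
      refine map_eq_self_of_injective (fun p x hx => ?_) ?_
      · exact Submodule.add_mem _ hx ((f.symm t).2.2 p x hx)
      · obtain ⟨g, hg⟩ := hunit
        rw [← hg]
        refine Function.LeftInverse.injective (g := (↑g⁻¹ : V →L[ℂ] V)) fun x => ?_
        exact DFunLike.congr_fun (Units.inv_mul g) x
    conv_lhs => rw [← e1, flagParam, ← map_map, e2]
  · exact (ContinuousLinearMap.analyticAt (𝕜 := ℂ) (E := lowering I × stabilizer F)
      (F := lowering I) (ContinuousLinearMap.fst ℂ (lowering I) (stabilizer F)) _).comp ht.1.2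

end GradedPolarizationData


/-! ### The exponential chart of `M`. -/

namespace GradedPolarizationData

open BigradedSum OpposedFiltrations EndExp DecFiltration

variable {V : Type*} [NormedAddCommGroup V] [NormedSpace ℂ V] [Module ℚ V]
  {D : GradedPolarizationData V} [FiniteDimensional ℂ V] {F : DecFiltration V}
  {I : ℤ → ℤ → Submodule ℂ V}

/-- The endomorphism `exp(-b) exp(a) - 1` is lowering and preserves `F`, so it is zero. -/
theorem exp_eq_of_map_exp_eq (hI : D.IsDeligneBigrading F I) {a b : V →L[ℂ] V}
    (ha : a ∈ lowering I) (hb : b ∈ lowering I)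
    (h : F.map (NormedSpace.exp a) = F.map (NormedSpace.exp b)) :
    NormedSpace.exp a = NormedSpace.exp b := by
  have h1 := exp_sub_one_mem_lowering ha
  have h2 := exp_sub_one_mem_lowering (Submodule.neg_mem _ hb)
  have h3 : NormedSpace.exp (-b) * NormedSpace.exp a - 1 ∈ lowering I := by
    have := Submodule.add_mem _ (mul_mem_lowering h2 h1) (Submodule.add_mem _ h2 h1)
    convert this using 1
    noncomm_ring
  have h4 : NormedSpace.exp (-b) * NormedSpace.exp a - 1 ∈ stabilizer F := by
    intro p x hx
    refine Submodule.sub_mem _ ?_ hx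
    change NormedSpace.exp (-b) (NormedSpace.exp a x) ∈ F p
    rw [← mem_map_exp, ← h]
    exact ⟨x, hx, rfl⟩
  have h5 := sub_eq_zero.1 (eq_zero_of_mem_lowering_of_mem_stabilizer hI h3 h4)
  calc NormedSpace.exp a = NormedSpace.exp b * (NormedSpace.exp (-b) * NormedSpace.exp a) := by
        rw [← mul_assoc, exp_mul_neg, one_mul]
    _ = NormedSpace.exp b := by rw [h5, mul_one]

variable (D F) in
/-- The map `u ↦ exp(u).F` on `q_F`. -/
abbrev expMap (u : D.q F) : DecFiltration V := F.map (NormedSpace.exp (u : V →L[ℂ] V))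

theorem expMap_zero : expMap D F 0 = F := by
  simp [expMap, NormedSpace.exp_zero, DecFiltration.map_one]

variable (D F) in
/-- `ψ : N ∩ M → U` is inverse to `u ↦ exp(u).F`, and holomorphic. -/
structure IsExpChart (U : Set (D.q F)) (N : Set (DecFiltration V)) (ψ : DecFiltration V → D.q F) :
    Prop where
  isOpen_source : IsOpen U
  isOpen_target : IsOpen N
  zero_mem : 0 ∈ U
  map_mem : ∀ u ∈ U, expMap D F u ∈ N ∩ D.M
  left_inv : ∀ u ∈ U, ψ (expMap D F u) = u
  symm_mem : ∀ F' ∈ N ∩ D.M, ψ F' ∈ U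
  right_inv : ∀ F' ∈ N ∩ D.M, expMap D F (ψ F') = F'
  continuousOn : ContinuousOn ψ N
  holomorphicAt : ∀ F' ∈ N, HolomorphicAt ψ F'

theorem exists_isExpChart (hF : F ∈ D.M) : ∃ U N ψ, IsExpChart D F U N ψ := by
  have hI := isDeligneBigrading_I hF.1
  have hq : D.q F = lowering (D.I F) ⊓ D.lieGC := q_eq hI (firstRelation_of_mem_M hF)
  -- Shrinking the flag chart into this set keeps `exp(u).F` in `M` for `u ∈ q_F`.
  set O₀ : Set (lowering (D.I F)) := {a | (a : V →L[ℂ] V) ∈ D.lieGC →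
    F.map (NormedSpace.exp (a : V →L[ℂ] V)) ∈ D.M} with hO₀
  have hO₀n : O₀ ∈ 𝓝 0 :=
    (continuous_subtype_val.continuousAt (x := (0 : lowering (D.I F)))).eventually
      (eventually_map_exp_mem_M hF)
  obtain ⟨O, T, l, hO, h0, hOO, hT, hl, hTl⟩ := exists_flag_chart hI hO₀n
  have hwd : ∀ t ∈ T, ∀ t' ∈ T, F.map t = F.map t' → l t = l t' := by
    intro t ht t' ht' h
    rw [(hTl t ht).2.1, (hTl t' ht').2.1] at h
    rw [← (hl _ (hTl t ht).1).2, ← (hl _ (hTl t' ht').1).2,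
      exp_eq_of_map_exp_eq hI (l t).2 (l t').2 h]
  set inc : D.q F →ₗ[ℂ] lowering (D.I F) := Submodule.inclusion (hq.le.trans inf_le_left)
  -- A linear retraction onto `q_F` extends the inverse chart from `M` to an open set of the flag
  -- variety, as holomorphy on `M` is defined by such extensions.
  obtain ⟨P₀, hP₀⟩ := inc.exists_leftInverse_of_injective
    (LinearMap.ker_eq_bot.2 (Submodule.inclusion_injective _))
  let P : lowering (D.I F) →L[ℂ] D.q F := P₀.toContinuousLinearMap
  have hP : ∀ u : D.q F, P (inc u) = u := fun u => DFunLike.congr_fun hP₀ u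
  have hinc : Continuous inc := inc.continuous_of_finiteDimensional
  set N : Set (DecFiltration V) := {F' | ∃ t ∈ T, F.map t = F'} with hN
  set ψ : DecFiltration V → D.q F := fun F' =>
    P (l (Classical.epsilon fun t => t ∈ T ∧ F.map t = F')) with hψ
  have hψt : ∀ t ∈ T, ψ (F.map t) = P (l t) := by
    intro t ht
    have := Classical.epsilon_spec (p := fun t' => t' ∈ T ∧ F.map t' = F.map t) ⟨t, ht, rfl⟩
    simp only [hψ]
    rw [hwd _ this.1 _ ht this.2]
  have hexp : ∀ u : D.q F, NormedSpace.exp ((inc u : lowering (D.I F)) : V →L[ℂ] V) =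
    NormedSpace.exp (u : V →L[ℂ] V) := fun u => rfl
  -- A chart point that lands in `M` has `exp(l t) ∈ G_ℂ`, and nilpotency of `l t` brings `l t`
  -- itself into `Lie(G_ℂ)`.
  have hmem : ∀ t ∈ T, F.map t ∈ D.M → ∃ u : D.q F, l t = inc u := by
    intro t ht h
    rw [(hTl t ht).2.1] at h
    have h1 := isGradedIsometry_of_map_exp_mem hI (M_subset_compactDual hF) (l t).2
      (M_subset_compactDual h)
    have h2 := mem_lieGC_of_exp (isNilpotent_of_mem_lowering hI (l t).2) h1
    exact ⟨⟨l t, hq ▸ ⟨(l t).2, h2⟩⟩, rfl⟩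
  refine ⟨inc ⁻¹' O, N, ψ, hO.preimage hinc, isOpen_orbit F hT, ?_, fun u hu => ⟨?_, ?_⟩,
    fun u hu => ?_, ?_, ?_, ?_, ?_⟩
  · simpa using h0
  · exact ⟨_, (hl _ hu).1, rfl⟩
  · exact hOO hu (hq.le u.2).2
  · rw [expMap, ← hexp, hψt _ (hl _ hu).1, (hl _ hu).2, hP]
  · rintro _ ⟨⟨t, ht, rfl⟩, h⟩
    obtain ⟨u, hu⟩ := hmem t ht h
    rw [hψt t ht, hu, hP]
    change inc u ∈ O
    rw [← hu]
    exact (hTl t ht).1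
  · rintro _ ⟨⟨t, ht, rfl⟩, h⟩
    obtain ⟨u, hu⟩ := hmem t ht h
    rw [hψt t ht, hu, hP, (hTl t ht).2.1, hu]
    rfl
  · rintro _ ⟨t, ht, rfl⟩
    refine ContinuousAt.continuousWithinAt ?_
    rw [ContinuousAt, hψt t ht]
    refine fun A hA => ?_
    obtain ⟨A', hA', hA'o, htA⟩ := mem_nhds_iff.1 hA
    have hlc : ContinuousOn (fun t => P (l t)) T := fun t ht =>
      (P.continuous.continuousAt.comp (hTl t ht).2.2.continuousAt).continuousWithinAt
    have hopen := isOpen_orbit F (hlc.isOpen_inter_preimage hT hA'o)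
    refine Filter.mem_map.2 (Filter.mem_of_superset (hopen.mem_nhds ⟨t, ⟨ht, htA⟩, rfl⟩) ?_)
    rintro _ ⟨t', ⟨ht', htA'⟩, rfl⟩
    change ψ _ ∈ A
    rw [hψt t' ht']
    exact hA' htA'
  · rintro _ ⟨t, ht, rfl⟩
    have hm : AnalyticAt ℂ (fun A : V →L[ℂ] V => A * t) 1 := analyticAt_id.mul analyticAt_const
    have h1 : AnalyticAt ℂ (fun A : V →L[ℂ] V => P (l (A * t))) 1 := by
      refine (ContinuousLinearMap.analyticAt (𝕜 := ℂ) (E := lowering (D.I F)) (F := D.q F) P _).comp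
        (AnalyticAt.comp (g := l) ?_ hm)
      rw [one_mul]
      exact (hTl t ht).2.2
    refine h1.congr ?_
    have h2 : ∀ᶠ A : V →L[ℂ] V in 𝓝 1, A * t ∈ T :=
      hm.continuousAt.eventually_mem (hT.mem_nhds (by rwa [one_mul]))
    filter_upwards [h2] with A hA
    rw [map_map, hψt _ hA]

theorem continuous_expMap : Continuous (expMap D F) := by
  rw [continuous_iff_continuousAt]
  intro u
  exact ContinuousAt.comp (f := fun u : D.q F => NormedSpace.exp (u : V →L[ℂ] V))
    (continuousAt_map F (expUnit (u : V →L[ℂ] V)))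
    (continuous_exp.comp continuous_subtype_val).continuousAt

theorem analyticAt_exp_subtype (P : Submodule ℂ (V →L[ℂ] V)) (u : P) :
    AnalyticAt ℂ (fun u : P => NormedSpace.exp (u : V →L[ℂ] V)) u :=
  AnalyticAt.comp (f := Subtype.val) (NormedSpace.exp_analytic _)
    (ContinuousLinearMap.analyticAt (𝕜 := ℂ) (E := P) (F := V →L[ℂ] V) P.subtypeL u)

/-- The pullback of a holomorphic function on `M` under `u ↦ exp(u).F` is holomorphic. -/
theorem analyticAt_comp_expMap {E : Type*} [NormedAddCommGroup E] [NormedSpace ℂ E]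
    {ζ : DecFiltration V → E} {u : D.q F}
    (hu : ∀ᶠ u' in 𝓝 u, expMap D F u' ∈ D.M) (hζ : HolomorphicOnAt D.M ζ (expMap D F u)) :
    AnalyticAt ℂ (fun u' => ζ (expMap D F u')) u := by
  obtain ⟨ζ', hζ', he⟩ := hζ
  -- Holomorphy at `exp(u).F` is tested by translates of that point, so `exp(u')` is rewritten as
  -- `(exp(u') exp(-u)) exp(u)`.
  have h1 : AnalyticAt ℂ (fun u' : D.q F =>
      NormedSpace.exp (u' : V →L[ℂ] V) * NormedSpace.exp (-(u : V →L[ℂ] V))) u :=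
    (analyticAt_exp_subtype _ u).mul analyticAt_const
  have h2 : AnalyticAt ℂ (fun u' : D.q F => ζ' ((expMap D F u).map
      (NormedSpace.exp (u' : V →L[ℂ] V) * NormedSpace.exp (-(u : V →L[ℂ] V))))) u := by
    refine AnalyticAt.comp (g := fun A => ζ' ((expMap D F u).map A)) ?_ h1
    rw [exp_mul_neg]
    exact hζ'
  refine h2.congr ?_
  have h3 : Filter.Tendsto (expMap D F) (𝓝 u) (𝓝[D.M] (expMap D F u)) :=
    tendsto_nhdsWithin_iff.2 ⟨continuous_expMap.continuousAt, hu⟩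
  filter_upwards [h3.eventually he] with u' hu'
  rw [hu', expMap, map_map, mul_assoc, exp_neg_mul, mul_one]

theorem IsExpChart.isBiholomorphicOn {U : Set (D.q F)} {N : Set (DecFiltration V)}
    {ψ : DecFiltration V → D.q F} (h : IsExpChart D F U N ψ) :
    IsBiholomorphicOn D.M (expMap D F) U N := by
  have hinv : Set.InvOn ψ (expMap D F) U (N ∩ D.M) := ⟨h.left_inv, h.right_inv⟩
  refine ⟨h.isOpen_source, h.isOpen_target, hinv.bijOn h.map_mem h.symm_mem, fun u hu => ?_, ψ,
    hinv, h.continuousOn.mono Set.inter_subset_left,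
    fun F' hF' => ⟨ψ, h.holomorphicAt F' hF'.1, Filter.Eventually.of_forall fun _ => rfl⟩⟩
  have hM : ∀ᶠ u' in 𝓝 u, expMap D F u' ∈ D.M := by
    filter_upwards [h.isOpen_source.mem_nhds hu] with u' hu'
    exact (h.map_mem u' hu').2
  refine ⟨continuous_expMap.continuousAt, hM, fun ζ hζ => ?_⟩
  rw [contMDiffAt_iff_contDiffAt]
  exact (analyticAt_comp_expMap hM hζ).contDiffAt

end GradedPolarizationData


/-! ### Derivations and the holomorphic tangent space. -/

/-- Hadamard's lemma for analytic functions. -/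
theorem AnalyticAt.exists_eventually_eq_add_apply {E G : Type*} [NormedAddCommGroup E]
    [NormedSpace ℂ E] [NormedAddCommGroup G] [NormedSpace ℂ G] [CompleteSpace G] {f : E → G}
    (hf : AnalyticAt ℂ f 0) :
    ∃ g : E → E →L[ℂ] G, AnalyticAt ℂ g 0 ∧ ∀ᶠ y in 𝓝 0, f y = f 0 + g y y := by
  obtain ⟨p, r, hp⟩ := hf
  -- The shifted series splits one argument off each homogeneous term; its sum is the
  -- operator-valued function `g`.
  have hr : 0 < p.shift.radius := by
    rw [FormalMultilinearSeries.radius_shift]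
    exact hp.r_pos.trans_le hp.r_le
  have hg := p.shift.hasFPowerSeriesOnBall hr
  refine ⟨p.shift.sum, hg.analyticAt, ?_⟩
  have hm : Metric.eball (0 : E) (min r p.shift.radius) ∈ 𝓝 0 :=
    Metric.eball_mem_nhds _ (lt_min hp.r_pos hr)
  filter_upwards [hm] with y hy
  have h1 := hp.hasSum (y := y) (Metric.eball_subset_eball (min_le_left _ _) hy)
  have h2 := hg.hasSum (y := y) (Metric.eball_subset_eball (min_le_right _ _) hy)
  rw [zero_add] at h1 h2
  have h3 := (ContinuousLinearMap.apply ℂ G y).hasSum h2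
  have h4 := (hasSum_nat_add_iff' 1).2 h1
  have h5 : HasSum (fun n => p (n + 1) fun _ => y) (p.shift.sum y y) := by
    refine h3.congr_fun fun n => ?_
    change p (n + 1) (fun _ => y) = p (n + 1) (Fin.snoc (fun _ => y) y)
    congr 1
    funext i
    refine Fin.lastCases ?_ (fun j => ?_) i
    · rw [Fin.snoc_last]
    · rw [Fin.snoc_castSucc]
  have h6 := h4.unique h5
  rw [← h6, Finset.sum_range_one, hp.coeff_zero]
  abel

namespace DecFiltration

variable {V : Type*} [NormedAddCommGroup V] [NormedSpace ℂ V] {X : Set (DecFiltration V)}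
  {F : DecFiltration V}

theorem tangentSpaceAt_leibniz (δ : tangentSpaceAt X F) (ζ η : holomorphicFunctions X F) :
    δ.1 (ζ * η) = ζ.1 F * δ.1 η + η.1 F * δ.1 ζ := δ.2 ζ η

/-- The indicator `χ` of the set where `ζ = η` is holomorphic near `F`, has `χ(F) = 1`, and
satisfies `(ζ - η) χ = 0` everywhere; the Leibniz rule gives the rest. -/
theorem tangentSpaceAt_congr (hF : F ∈ X) (δ : tangentSpaceAt X F)
    {ζ η : holomorphicFunctions X F} (h : ∀ᶠ F' in 𝓝[X] F, ζ.1 F' = η.1 F') :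
    δ.1 ζ = δ.1 η := by
  classical
  let χ : holomorphicFunctions X F := ⟨Set.indicator {F' | ζ.1 F' = η.1 F'} 1, fun _ => 1,
    analyticAt_const, by
      filter_upwards [h] with F' hF'
      exact Set.indicator_of_mem (s := {F' | ζ.1 F' = η.1 F'}) hF' 1⟩
  have h0 : ζ.1 F = η.1 F := h.self_of_nhdsWithin hF
  have h1 : χ.1 F = 1 := Set.indicator_of_mem (s := {F' | ζ.1 F' = η.1 F'}) h0 1
  have h2 : (ζ - η) * χ = 0 := by
    ext F'
    change (ζ.1 F' - η.1 F') * Set.indicator {F' | ζ.1 F' = η.1 F'} 1 F' = 0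
    by_cases h : ζ.1 F' = η.1 F'
    · rw [h, sub_self, zero_mul]
    · rw [Set.indicator_of_notMem (by exact h), mul_zero]
  have h3 := tangentSpaceAt_leibniz δ (ζ - η) χ
  rw [h2, map_zero, h1, one_mul, map_sub] at h3
  have h4 : (ζ - η).1 F = 0 := sub_eq_zero.2 h0
  rw [h4, zero_mul, zero_add] at h3
  exact (sub_eq_zero.1 h3.symm)

theorem tangentSpaceAt_algebraMap (δ : tangentSpaceAt X F) (c : ℂ) :
    δ.1 (algebraMap ℂ (holomorphicFunctions X F) c) = 0 := by
  have h := tangentSpaceAt_leibniz δ 1 1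
  have h1 : (1 : holomorphicFunctions X F).1 F = 1 := rfl
  rw [mul_one, h1, one_mul] at h
  rw [Algebra.algebraMap_eq_smul_one, map_smul, left_eq_add.1 h, smul_zero]

/-- `φ` parametrizes `X` near `F = φ 0` holomorphically, with holomorphic inverse `ψ`. -/
structure IsParametrizationAt {E : Type*} [NormedAddCommGroup E] [NormedSpace ℂ E]
    (X : Set (DecFiltration V)) (F : DecFiltration V) (φ : E → DecFiltration V)
    (ψ : DecFiltration V → E) : Prop where
  mem : F ∈ X
  map_zero : φ 0 = F
  analyticAt_comp : ∀ ζ : DecFiltration V → ℂ, HolomorphicOnAt X ζ F →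
    AnalyticAt ℂ (fun u => ζ (φ u)) 0
  left_inv : ∀ᶠ u in 𝓝 0, ψ (φ u) = u
  right_inv : ∀ᶠ F' in 𝓝[X] F, φ (ψ F') = F'
  continuousAt : ContinuousAt ψ F
  holomorphicAt : HolomorphicAt ψ F

namespace IsParametrizationAt

variable {E : Type*} [NormedAddCommGroup E] [NormedSpace ℂ E] {φ : E → DecFiltration V}
    {ψ : DecFiltration V → E}

theorem apply_self (h : IsParametrizationAt X F φ ψ) : ψ F = 0 := by
  have := h.left_inv.self_of_nhds
  rwa [h.map_zero] at this

theorem hasFDerivAt_comp (h : IsParametrizationAt X F φ ψ) (ζ : holomorphicFunctions X F) :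
    HasFDerivAt (fun u => ζ.1 (φ u)) (fderiv ℂ (fun u => ζ.1 (φ u)) 0) 0 :=
  (h.analyticAt_comp _ ζ.2).differentiableAt.hasFDerivAt

/-- The derivation `ζ ↦ d/dt ζ(φ(tu))` at `t = 0`. -/
def tangentMap (h : IsParametrizationAt X F φ ψ) : E →ₗ[ℂ] tangentSpaceAt X F where
  toFun u := ⟨{
    toFun ζ := fderiv ℂ (fun u => ζ.1 (φ u)) 0 u
    map_add' ζ η := DFunLike.congr_fun ((h.hasFDerivAt_comp ζ).add (h.hasFDerivAt_comp η)).fderiv u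
    map_smul' c ζ := DFunLike.congr_fun ((h.hasFDerivAt_comp ζ).const_smul c).fderiv u },
    fun ζ η => by
      have := DFunLike.congr_fun ((h.hasFDerivAt_comp ζ).mul (h.hasFDerivAt_comp η)).fderiv u
      rw [h.map_zero] at this
      exact this⟩
  map_add' u v := by
    refine Subtype.ext (LinearMap.ext fun ζ => ?_)
    exact map_add (fderiv ℂ (fun u => ζ.1 (φ u)) 0) u v
  map_smul' c u := by
    refine Subtype.ext (LinearMap.ext fun ζ => ?_)
    exact map_smul (fderiv ℂ (fun u => ζ.1 (φ u)) 0) c u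

theorem tangentMap_apply (h : IsParametrizationAt X F φ ψ) (u : E)
    (ζ : holomorphicFunctions X F) :
    (h.tangentMap u).1 ζ = fderiv ℂ (fun u => ζ.1 (φ u)) 0 u := rfl

theorem hasDerivAt_tangentMap (h : IsParametrizationAt X F φ ψ) (u : E)
    (ζ : holomorphicFunctions X F) :
    HasDerivAt (fun t : ℂ => ζ.1 (φ (t • u))) ((h.tangentMap u).1 ζ) 0 := by
  have h1 : HasDerivAt (fun t : ℂ => t • u) u 0 := by
    simpa using (hasDerivAt_id (0 : ℂ)).smul_const u
  have h2 := h.hasFDerivAt_comp ζ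
  rw [← zero_smul ℂ u] at h2
  have h3 := HasFDerivAt.comp_hasDerivAt (f := fun t : ℂ => t • u) 0 h2 h1
  rw [zero_smul] at h3
  exact h3

/-- A holomorphic function on `E` near `0`, seen as a holomorphic function on `X` near `F`. -/
def pullback (h : IsParametrizationAt X F φ ψ) {f : E → ℂ} (hf : AnalyticAt ℂ f 0) :
    holomorphicFunctions X F :=
  ⟨fun F' => f (ψ F'), fun F' => f (ψ F'),
    AnalyticAt.comp (g := f) (f := fun A => ψ (F.map A))
      (by rw [DecFiltration.map_one, h.apply_self]; exact hf)
      h.holomorphicAt, Filter.Eventually.of_forall fun _ => rfl⟩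

theorem pullback_apply (h : IsParametrizationAt X F φ ψ) {f : E → ℂ} (hf : AnalyticAt ℂ f 0)
    (F' : DecFiltration V) : (h.pullback hf).1 F' = f (ψ F') := rfl

theorem tangentMap_pullback (h : IsParametrizationAt X F φ ψ) (u : E) {f : E → ℂ}
    (hf : AnalyticAt ℂ f 0) : (h.tangentMap u).1 (h.pullback hf) = fderiv ℂ f 0 u := by
  rw [tangentMap_apply]
  have : (fun v => (h.pullback hf).1 (φ v)) =ᶠ[𝓝 0] f := by
    filter_upwards [h.left_inv] with v hv
    rw [pullback_apply, hv]
  rw [this.fderiv_eq]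

theorem injective_tangentMap (h : IsParametrizationAt X F φ ψ) :
    Function.Injective h.tangentMap := by
  rw [← LinearMap.ker_eq_bot, LinearMap.ker_eq_bot']
  intro u hu
  refine SeparatingDual.eq_zero_of_forall_dual_eq_zero (R := ℂ) fun l => ?_
  have h1 := h.tangentMap_pullback u (l.analyticAt 0)
  rw [hu, l.fderiv] at h1
  exact h1.symm

variable [FiniteDimensional ℂ E]

/-- Hadamard's lemma writes `ζ = ζ(F) + ∑ g_i x_i` near `F` in the coordinates `x_i` of the chart,
so a derivation is determined by its values on the `x_i`. -/
theorem surjective_tangentMap (h : IsParametrizationAt X F φ ψ) :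
    Function.Surjective h.tangentMap := by
  intro δ
  let b := Module.finBasis ℂ E
  let x : Fin (Module.finrank ℂ E) → (E →L[ℂ] ℂ) :=
    fun i => (b.coord i).toContinuousLinearMap
  have hx : ∀ i, AnalyticAt ℂ (x i) 0 := fun i => (x i).analyticAt 0
  have hxs : ∀ u, ∑ i, x i u • b i = u := fun u => b.sum_repr u
  -- The coefficients depend on `ζ` but not on the derivation, so the given derivation and its
  -- candidate preimage can be compared on the coordinates.
  have hderiv : ∀ (ζ : holomorphicFunctions X F), ∃ c : Fin (Module.finrank ℂ E) → ℂ,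
      ∀ δ : tangentSpaceAt X F, δ.1 ζ = ∑ i, c i * δ.1 (h.pullback (hx i)) := by
    intro ζ
    obtain ⟨g, hg, hfg⟩ := (h.analyticAt_comp _ ζ.2).exists_eventually_eq_add_apply
    have hgi : ∀ i, AnalyticAt ℂ (fun y => g y (b i)) 0 := fun i =>
      ((ContinuousLinearMap.apply ℂ ℂ (b i)).analyticAt _).comp hg
    refine ⟨fun i => g 0 (b i), fun δ => ?_⟩
    have e : δ.1 ζ = δ.1 (algebraMap ℂ _ (ζ.1 F) +
        ∑ i, h.pullback (hgi i) * h.pullback (hx i)) := by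
      refine tangentSpaceAt_congr h.mem δ ?_
      have hψ : Filter.Tendsto ψ (𝓝[X] F) (𝓝 0) := by
        have := h.continuousAt.mono_left (nhdsWithin_le_nhds (s := X))
        rwa [h.apply_self] at this
      filter_upwards [hψ.eventually hfg, h.right_inv] with F' h1 h2
      rw [h2, h.map_zero] at h1
      have h3 : g (ψ F') (ψ F') = ∑ i, g (ψ F') (b i) * x i (ψ F') := by
        conv_lhs => rw [← hxs (ψ F')]
        rw [map_sum]
        refine Finset.sum_congr rfl fun i _ => ?_
        rw [map_smul, hxs, smul_eq_mul, mul_comm]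
      rw [h1, h3]
      simp only [Subalgebra.coe_add, AddSubmonoidClass.coe_finsetSum, Pi.add_apply,
        Finset.sum_apply]
      rfl
    rw [e, map_add, tangentSpaceAt_algebraMap, zero_add, map_sum]
    refine Finset.sum_congr rfl fun i _ => ?_
    rw [tangentSpaceAt_leibniz, pullback_apply, pullback_apply, h.apply_self, _root_.map_zero, zero_mul,
      add_zero]
  refine ⟨∑ i, δ.1 (h.pullback (hx i)) • b i, ?_⟩
  refine Subtype.ext (LinearMap.ext fun ζ => ?_)
  obtain ⟨c, hc⟩ := hderiv ζ
  rw [hc, hc]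
  refine Finset.sum_congr rfl fun i _ => ?_
  rw [h.tangentMap_pullback, (x i).fderiv]
  congr 1
  change b.coord i _ = _
  simp [Finsupp.single_apply]

/-- A parametrization identifies `E` with the tangent space. -/
def tangentEquiv (h : IsParametrizationAt X F φ ψ) : E ≃ₗ[ℂ] tangentSpaceAt X F :=
  LinearEquiv.ofBijective h.tangentMap ⟨h.injective_tangentMap, h.surjective_tangentMap⟩

end IsParametrizationAt

end DecFiltration

namespace GradedPolarizationData

open DecFiltration

variable {V : Type*} [NormedAddCommGroup V] [NormedSpace ℂ V] [Module ℚ V]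
  {D : GradedPolarizationData V} [FiniteDimensional ℂ V] {F : DecFiltration V}

theorem IsExpChart.isParametrizationAt {U : Set (D.q F)} {N : Set (DecFiltration V)}
    {ψ : DecFiltration V → D.q F} (h : IsExpChart D F U N ψ) :
    IsParametrizationAt D.M F (expMap D F) ψ := by
  have hF := h.map_mem 0 h.zero_mem
  rw [expMap_zero] at hF
  have hU := h.isOpen_source.mem_nhds h.zero_mem
  have hN := h.isOpen_target.mem_nhds hF.1
  refine ⟨hF.2, expMap_zero, fun ζ hζ => analyticAt_comp_expMap ?_ ?_, ?_, ?_,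
    h.continuousOn.continuousAt hN, h.holomorphicAt F hF.1⟩
  · filter_upwards [hU] with u hu
    exact (h.map_mem u hu).2
  · rwa [expMap_zero]
  · filter_upwards [hU] with u hu
    exact h.left_inv u hu
  · filter_upwards [mem_nhdsWithin_of_mem_nhds hN, self_mem_nhdsWithin] with F' h1 h2
    exact h.right_inv F' ⟨h1, h2⟩

end GradedPolarizationData


/-! ### Derivatives of holomorphic and horizontal maps. -/

namespace DecFiltration

theorem mfderiv_comp_apply_of_hasFDerivAt {E E' G S : Type*} [NormedAddCommGroup E]
    [NormedSpace ℂ E] [NormedAddCommGroup E'] [NormedSpace ℂ E'] [NormedAddCommGroup G]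
    [NormedSpace ℂ G] [TopologicalSpace S] [ChartedSpace E S] {k : S → E'} {f : E' → G}
    {f' : E' →L[ℂ] G} {s : S} (hf : HasFDerivAt f f' (k s))
    (hk : MDifferentiableAt 𝓘(ℂ, E) 𝓘(ℂ, E') k s) (v : TangentSpace 𝓘(ℂ, E) s) :
    (mfderiv 𝓘(ℂ, E) 𝓘(ℂ, G) (fun s' => f (k s')) s v : G) =
      f' (mfderiv 𝓘(ℂ, E) 𝓘(ℂ, E') k s v : E') := by
  have h := hf.hasMFDerivAt.comp s hk.hasMFDerivAt
  exact DFunLike.congr_fun h.mfderiv v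

variable {V : Type*} [NormedAddCommGroup V] [NormedSpace ℂ V] {X : Set (DecFiltration V)}
  {F : DecFiltration V}

namespace IsParametrizationAt

variable {E : Type*} [NormedAddCommGroup E] [NormedSpace ℂ E] {φ : E → DecFiltration V}
    {ψ : DecFiltration V → E} {B S : Type*} [NormedAddCommGroup B] [NormedSpace ℂ B]
    [TopologicalSpace S] [ChartedSpace B S] {Φ : S → DecFiltration V} {s : S}

theorem eventually_apply_eq (h : IsParametrizationAt X F φ ψ) (hΦ : HolomorphicMapAt B X Φ s)
    (hs : Φ s = F) : ∀ᶠ s' in 𝓝 s, φ (ψ (Φ s')) = Φ s' := by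
  subst hs
  exact (tendsto_nhdsWithin_iff.2 ⟨hΦ.1, hΦ.2.1⟩ : Filter.Tendsto Φ (𝓝 s) (𝓝[X] (Φ s))).eventually
    h.right_inv

variable [FiniteDimensional ℂ E]

/-- Holomorphic maps are tested on scalar functions only, so `ψ ∘ Φ` is checked in linear
coordinates of `E`. -/
theorem contMDiffAt_comp (h : IsParametrizationAt X F φ ψ) (hΦ : HolomorphicMapAt B X Φ s)
    (hs : Φ s = F) : ContMDiffAt 𝓘(ℂ, B) 𝓘(ℂ, E) ω (fun s' => ψ (Φ s')) s := by
  let e := (Module.finBasis ℂ E).equivFun.toContinuousLinearEquiv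
  have h1 : ContMDiffAt 𝓘(ℂ, B) 𝓘(ℂ, Fin (Module.finrank ℂ E) → ℂ) ω
      (fun s' => e (ψ (Φ s'))) s := by
    rw [contMDiffAt_pi_space]
    intro i
    let l : E →L[ℂ] ℂ := (ContinuousLinearMap.proj (R := ℂ) (φ := fun _ => ℂ) i).comp
      (e : E →L[ℂ] (Fin (Module.finrank ℂ E) → ℂ))
    have hl : HolomorphicOnAt X (h.pullback (l.analyticAt 0)).1 (Φ s) := by
      rw [hs]
      exact (h.pullback (l.analyticAt 0)).2
    exact hΦ.2.2 _ hl
  have h2 := (e.symm : (Fin (Module.finrank ℂ E) → ℂ) →L[ℂ] E).contMDiff.contMDiffAt.comp s h1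
    (n := ω)
  refine h2.congr_of_eventuallyEq (Filter.Eventually.of_forall fun s' => ?_)
  exact (e.symm_apply_apply _).symm

/-- Near `s` the function `ζ ∘ Φ` factors as `(ζ ∘ φ) ∘ (ψ ∘ Φ)`, and the chain rule applies. -/
theorem mfderiv_comp_eq_tangentEquiv (h : IsParametrizationAt X F φ ψ)
    (hΦ : HolomorphicMapAt B X Φ s) (hs : Φ s = F) (v : TangentSpace 𝓘(ℂ, B) s)
    (ζ : holomorphicFunctions X F) :
    (mfderiv 𝓘(ℂ, B) 𝓘(ℂ, ℂ) (fun s' => ζ.1 (Φ s')) s v : ℂ) =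
      (h.tangentEquiv (mfderiv 𝓘(ℂ, B) 𝓘(ℂ, E) (fun s' => ψ (Φ s')) s v : E)).1 ζ := by
  have h0 : ψ (Φ s) = 0 := by rw [hs, h.apply_self]
  have h1 := h.hasFDerivAt_comp ζ
  rw [← h0] at h1
  have h2 := mfderiv_comp_apply_of_hasFDerivAt (k := fun s' => ψ (Φ s')) h1
    ((h.contMDiffAt_comp hΦ hs).mdifferentiableAt (by simp)) v
  have h3 : (fun s' => ζ.1 (Φ s')) =ᶠ[𝓝 s] fun s' => ζ.1 (φ (ψ (Φ s'))) := by
    filter_upwards [h.eventually_apply_eq hΦ hs] with s' hs'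
    rw [hs']
  rw [h3.mfderiv_eq]
  rw [h0] at h2
  exact h2

end IsParametrizationAt

end DecFiltration

namespace GradedPolarizationData

open DecFiltration EndExp

variable {V : Type*} [NormedAddCommGroup V] [NormedSpace ℂ V] [Module ℚ V]
  {D : GradedPolarizationData V} [FiniteDimensional ℂ V] {F : DecFiltration V}

theorem hasFDerivAt_exp_apply (P : Submodule ℂ (V →L[ℂ] V)) (x : V) :
    HasFDerivAt (fun u : P => NormedSpace.exp (u : V →L[ℂ] V) x)
      ((ContinuousLinearMap.apply ℂ V x).comp P.subtypeL) 0 := by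
  have h1 : HasFDerivAt (NormedSpace.exp : (V →L[ℂ] V) → _)
      (1 : (V →L[ℂ] V) →L[ℂ] (V →L[ℂ] V)) (P.subtypeL 0) := by
    rw [map_zero]
    exact hasFDerivAt_exp_zero
  have h2 := HasFDerivAt.comp (f := P.subtypeL) (0 : P) h1
    (ContinuousLinearMap.hasFDerivAt (𝕜 := ℂ) (E := P) (F := V →L[ℂ] V) P.subtypeL)
  exact (ContinuousLinearMap.apply ℂ V x).hasFDerivAt.comp (0 : P) h2

/-- For `x ∈ F^p`, the vectors `exp(ψ(Φ s')) x` form a holomorphic section of the bundle with fibers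
`(Φ s')^p`, and its derivative at `s` is `u x`. Horizontality puts `u x` in `F^{p-1}`. -/
theorem IsExpChart.mfderiv_mem_horizontal {U : Set (D.q F)} {N : Set (DecFiltration V)}
    {ψ : DecFiltration V → D.q F} (h : IsExpChart D F U N ψ) {B S : Type*}
    [NormedAddCommGroup B] [NormedSpace ℂ B] [TopologicalSpace S] [ChartedSpace B S]
    {Φ : S → DecFiltration V} {s : S} (hΦ : HolomorphicMapAt B D.M Φ s) (hh : IsHorizontal B Φ)
    (hs : Φ s = F) (v : TangentSpace 𝓘(ℂ, B) s) {u : D.q F}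
    (hu : u = mfderiv 𝓘(ℂ, B) 𝓘(ℂ, D.q F) (fun s' => ψ (Φ s')) s v) :
    (u : V →L[ℂ] V) ∈ D.horizontal F := by
  have hp := h.isParametrizationAt
  have hk := hp.contMDiffAt_comp hΦ hs
  have h0 : ψ (Φ s) = 0 := by rw [hs, hp.apply_self]
  refine mem_horizontal (isDeligneBigrading_I hp.mem.1) (firstRelation_of_mem_M hp.mem)
    u.2 fun p x hx => ?_
  have ha : AnalyticAt ℂ (fun u : D.q F => NormedSpace.exp (u : V →L[ℂ] V) x) (ψ (Φ s)) :=
    ((ContinuousLinearMap.apply ℂ V x).analyticAt _).comp (analyticAt_exp_subtype _ _)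
  have hσ : ContMDiffAt 𝓘(ℂ, B) 𝓘(ℂ, V) ω
      (fun s' => NormedSpace.exp (ψ (Φ s') : V →L[ℂ] V) x) s :=
    ha.contDiffAt.contMDiffAt.comp s hk
  have h1 := hh s p _ hσ (by
    filter_upwards [hp.eventually_apply_eq hΦ hs] with s' hs'
    have h2 : NormedSpace.exp (ψ (Φ s') : V →L[ℂ] V) x ∈ expMap D F (ψ (Φ s')) p := ⟨x, hx, rfl⟩
    rwa [hs'] at h2) v
  have h2 := hasFDerivAt_exp_apply (D.q F) x
  rw [← h0] at h2
  have h3 := mfderiv_comp_apply_of_hasFDerivAt (k := fun s' => ψ (Φ s')) h2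
    (hk.mdifferentiableAt (by simp)) v
  rw [← hu] at h3
  have h4 := h3 ▸ h1
  rw [hs] at h4
  exact h4

end GradedPolarizationData

end

theorem theorem3p13 {V : Type*} [NormedAddCommGroup V] [NormedSpace ℂ V] [FiniteDimensional ℂ V]
    [Module ℚ V] (D : GradedPolarizationData V) (F : DecFiltration V) (hF : F ∈ D.M) :
    -- `q_F` is a direct sum and a nilpotent subalgebra of `Lie(G_ℂ)`
    iSupIndep (fun rs : ℤ × ℤ => D.g F rs.1 rs.2) ∧
    D.q F ≤ D.lieGC ∧ IsNilpotentLieSubalgebra (D.q F) ∧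
    -- the map `u ↦ exp(u).F` takes values in the compact dual, and restricts to a biholomorphism
    -- from a neighborhood of zero in `q_F` to a neighborhood of `F` in `M`
    (∀ u : D.q F, F.map (NormedSpace.exp (u : V →L[ℂ] V)) ∈ D.compactDual) ∧
    (∃ (U : Set (D.q F)) (N : Set (DecFiltration V)), 0 ∈ U ∧ F ∈ N ∧
      DecFiltration.IsBiholomorphicOn D.M
        (fun u : D.q F => F.map (NormedSpace.exp (u : V →L[ℂ] V))) U N) ∧
    -- the induced `ℂ`-linear isomorphism `κ` of `q_F` with the tangent space `T_F(M)`
    ∃ κ : D.q F ≃ₗ[ℂ] DecFiltration.tangentSpaceAt D.M F,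
      (∀ (u : D.q F) (ζ : DecFiltration.holomorphicFunctions D.M F),
        HasDerivAt (fun t : ℂ => ζ.1 (F.map (NormedSpace.exp (t • (u : V →L[ℂ] V)))))
          ((κ u).1 ζ) 0) ∧
      -- the derivative of a holomorphic, horizontal map `Φ : S → M` takes values in `T^horiz(M)`
      ∀ (E : Type*) [NormedAddCommGroup E] [NormedSpace ℂ E] [FiniteDimensional ℂ E]
        (S : Type*) [TopologicalSpace S] [ChartedSpace E S] [IsManifold 𝓘(ℂ, E) ω S]
        (Φ : S → DecFiltration V),
        (∀ s, DecFiltration.HolomorphicMapAt E D.M Φ s) →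
        DecFiltration.IsHorizontal E Φ →
        ∀ s, Φ s = F → ∀ v : TangentSpace 𝓘(ℂ, E) s,
          ∃ u : D.q F, (u : V →L[ℂ] V) ∈ D.horizontal F ∧
            ∀ ζ : DecFiltration.holomorphicFunctions D.M F,
              (mfderiv 𝓘(ℂ, E) 𝓘(ℂ, ℂ) (fun s' => ζ.1 (Φ s')) s v : ℂ) = (κ u).1 ζ := by
  obtain ⟨U, N, ψ, h⟩ := GradedPolarizationData.exists_isExpChart hF
  have hI := GradedPolarizationData.isDeligneBigrading_I hF.1
  have hS := GradedPolarizationData.firstRelation_of_mem_M hF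
  have hq : D.q F ≤ D.lieGC := (GradedPolarizationData.q_eq hI hS).le.trans inf_le_right
  have hp := h.isParametrizationAt
  refine ⟨GradedPolarizationData.iSupIndep_g hI, hq,
    GradedPolarizationData.isNilpotentLieSubalgebra_q hI hS,
    fun u => GradedPolarizationData.map_exp_mem_compactDual
      (GradedPolarizationData.M_subset_compactDual hF) (hq u.2),
    ⟨U, N, h.zero_mem, ?_, h.isBiholomorphicOn⟩, hp.tangentEquiv, hp.hasDerivAt_tangentMap,
    fun E _ _ _ S _ _ _ Φ hΦ hh s hs v => ⟨_, h.mfderiv_mem_horizontal (hΦ s) hh hs v rfl,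
      fun ζ => hp.mfderiv_comp_eq_tangentEquiv (hΦ s) hs v ζ⟩⟩
  have := h.map_mem 0 h.zero_mem
  rw [GradedPolarizationData.expMap_zero] at this
  exact this.1
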